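/- **Setting.** Let $K$ be a field which is complete with respect to a non-trivial non-archimedean absolute value $|\cdot|$, and let $R=\{x\in K:|x|\le 1\}$. Let $\mathbb F_\epsilon\subset K$ be a finite field with $\hat q$ elements and let $\zeta\in K$ with $0<|\zeta|<1$. Put $A_\epsilon=\mathbb F_\epsilon[[z]]$ and $Q_\epsilon=\mathbb F_\epsilon((z))$. Let $K^{\rm alg}$ be an algebraic closure of $K$ with the unique extension of $|\cdot|$, let $K^{\rm sep}\subset K^{\rm alg}$ be the separable closure of $K$, and let $\overline K$ be the completion of $K^{\rm alg}$; the group $\mathrm{Gal}(K^{\rm sep}/K)$ acts on $K^{\rm alg}$ (uniquely extending its action on $K^{\rm sep}$) and, by continuity, on $\overline K$. Let $\hat\sigma$ be the endomorphism of $R[[z]]$, of $K^{\rm sep}[[z]]$ and of $K^{\rm sep}((z))$ with $\hat\sigma(z)=z$ which raises the coefficients to the power $\hat q$, and write $\hat\sigma^*\hat M=\hat M\otimes_{R[[z]],\hat\sigma}R[[z]]$ and $\hat\sigma^*_{\hat M}m = m\otimes 1$. A *local shtuka* over $R$ is a pair $\underline{\hat M}=(\hat M,\tau)$ of a finite free $R[[z]]$-module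 $\hat M$ and an isomorphism $\tau:\hat\sigma^*\hat M[\frac1{z-\zeta}]\to\hat M[\frac1{z-\zeta}]$. A *quasi-morphism* $\underline{\hat M}\to\underline{\hat N}$ is an $R((z))$-linear map $f:\hat M[\frac1z]\to\hat N[\frac1z]$ with $\tau_{\hat N}\circ\hat\sigma^*f=f\circ\tau_{\hat M}$. The $\epsilon$-adic realizations of $\underline{\hat M}$ are $$\check T\underline{\hat M}=\{m\in\hat M\otimes_{R[[z]]}K^{\rm sep}[[z]]:\tau(\hat\sigma^*_{\hat M}m)=m\},\qquad H_\epsilon(\underline{\hat M},Q_\epsilon)=\{m\in\hat M\otimes_{R[[z]]}K^{\rm sep}((z)):\tau(\hat\sigma^*_{\hat M}m)=m\};$$ the group $\mathrm{Gal}(K^{\rm sep}/K)$ acts on them through the coefficients in $K^{\rm sep}$. Let $K[[z-\zeta]]$ and $\overline K[[z-\zeta]]$ be the power series rings in the variable $z-\zeta$, which receive maps from $R[[z]]$ by $z\mapsto\zeta+(z-\zeta)$; the same rule defines $Q_\epsilon\to K[[z-\zeta]]$ and $K^{\rm sep}\langle\frac z\zeta\rangle\to\overline K[[z-\zeta]]$,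 where $K^{\rm sep}\langle\frac z\zeta\rangle=\{\sum_{n\ge 0} b_nz^n : b_n\in K^{\rm sep},\ |b_n\zeta^n|\to0\}$. The de Rham realizations of $\underline{\hat M}$ are $$H_{\rm dR}(\underline{\hat M},K((z-\zeta)))=\hat\sigma^*\hat M\otimes_{R[[z]]}K((z-\zeta)),\qquad H_{\rm dR}(\underline{\hat M},K)=\hat\sigma^*\hat M\otimes_{R[[z]],z\mapsto\zeta}K,$$ and the first one contains the Hodge–Pink lattice $\mathfrak q=\tau^{-1}(\hat M\otimes_{R[[z]]}K[[z-\zeta]])$. **Theorem.** (1) There are isomorphisms of $\overline K((z-\zeta))$-vector spaces, one for each local shtuka $\underline{\hat M}$ over $R$, $$h_{\epsilon,\rm dR}:\ H_\epsilon(\underline{\hat M},Q_\epsilon)\otimes_{Q_\epsilon}\overline K((z-\zeta))\ \longrightarrow\ H_{\rm dR}(\underline{\hat M},K((z-\zeta)))\otimes_{K((z-\zeta))}\overline K((z-\zeta)),$$ with the following properties. * They are canonical: every $t\in\check T\underline{\hat M}$ lies in $\hat M\otimes_{R[[z]]}K^{\rm sep}\langle\frac z\zeta\rangle$, and $\tau(h_{\epsilon,\rm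 dR}(t\otimes1))$ is the image of $t$ in $\hat M\otimes_{R[[z]]}\overline K((z-\zeta))$ under $z\mapsto\zeta+(z-\zeta)$. * They are functorial with respect to all quasi-morphisms of local shtukas. * $h_{\epsilon,\rm dR}$ maps $H_\epsilon(\underline{\hat M},Q_\epsilon)\otimes_{Q_\epsilon}\overline K[[z-\zeta]]=\check T\underline{\hat M}\otimes_{A_\epsilon}\overline K[[z-\zeta]]$ onto $\mathfrak q\otimes_{K[[z-\zeta]]}\overline K[[z-\zeta]]$. * $h_{\epsilon,\rm dR}$ is equivariant for $\mathrm{Gal}(K^{\rm sep}/K)$, which acts on both factors of the source, but only on the coefficients in $\overline K$ of the second factor of the target. * If $K$ is not perfect and $\hat M\ne0$, then the de Rham realizations are not recovered as Galois invariants: $H_{\rm dR}(\underline{\hat M},K((z-\zeta)))$ is strictly contained in the image under $h_{\epsilon,\rm dR}$ of the $\mathrm{Gal}(K^{\rm sep}/K)$-invariants of $H_\epsilon(\underline{\hat M},Q_\epsilon)\otimes_{Q_\epsilon}\overline K((z-\zeta))$, and $H_{\rm dR}(\underline{\hat M},K)$ is strictly contained in the $\mathrm{Gal}(K^{\rm sep}/K)$-invariants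 of $H_{\rm dR}(\underline{\hat M},K)\otimes_K\overline K$, where the group acts on $\overline K$. (2) $\overline K^{\mathrm{Gal}(K^{\rm sep}/K)}=\widehat{K^{\rm perf}}$, the completion of the perfect closure of $K$ (i.e. the closure of $K^{\rm perf}\subset K^{\rm alg}$ in $\overline K$). (3) $\overline K((z-\zeta))^{\mathrm{Gal}(K^{\rm sep}/K)}=\widehat{K^{\rm perf}}((z-\zeta))$, where the group acts on the coefficients. -/

import Mathlib

open scoped PowerSeries LaurentSeries TensorProduct Topology
open UniformSpace

universe u v w

noncomputable section

namespace LocSht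

/-! ### Base change of modules along an explicit ring homomorphism -/

section BaseChange

variable {A B C : Type*} [CommRing A] [CommRing B] [CommRing C]

/-- The ring `B`, regarded as an `A`-algebra via `f : A →+* B`. -/
def Along (_f : A →+* B) : Type _ := B

instance (f : A →+* B) : CommRing (Along f) := inferInstanceAs (CommRing B)

instance (f : A →+* B) : Algebra A (Along f) := f.toAlgebra

instance (f : A →+* B) {S : Type*} [CommRing S] [Algebra S B] : Module S (Along f) :=
  inferInstanceAs (Module S B)

instance (f : A →+* B) {S : Type*} [CommRing S] [Algebra S B] :
    SMulCommClass A S (Along f) := ⟨fun a s b => by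
  change f a * (s • (show B from b)) = s • (f a * (show B from b))
  rw [mul_smul_comm]⟩

/-- `BC f M` is the base change `M ⊗_{A,f} B` of an `A`-module `M` along `f : A →+* B`. -/
def BC (f : A →+* B) (M : Type*) [AddCommGroup M] [Module A M] : Type _ :=
  Along f ⊗[A] M

namespace BC

variable (f : A →+* B) (M : Type*) [AddCommGroup M] [Module A M]

instance : AddCommGroup (BC f M) := inferInstanceAs (AddCommGroup (Along f ⊗[A] M))

instance {S : Type*} [CommRing S] [Algebra S B] : Module S (BC f M) :=
  inferInstanceAs (Module S (Along f ⊗[A] M))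

/-- The pure tensor `m ⊗ b`. -/
def tmul (b : B) (m : M) : BC f M := (show Along f from b) ⊗ₜ[A] m

variable {f M}

theorem smul_tmul {S : Type*} [CommRing S] [Algebra S B] (s : S) (b : B) (m : M) :
    s • tmul f M b m = tmul f M (s • b) m := rfl

theorem tmul_smul (b : B) (a : A) (m : M) : tmul f M b (a • m) = tmul f M (f a * b) m :=
  (TensorProduct.smul_tmul a (show Along f from b) m).symm

theorem tmul_add (b : B) (m n : M) : tmul f M b (m + n) = tmul f M b m + tmul f M b n :=
  TensorProduct.tmul_add (show Along f from b) m n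

theorem induction {P : BC f M → Prop} (h : ∀ b m, P (tmul f M b m))
    (hadd : ∀ x y, P x → P y → P (x + y)) (x : BC f M) : P x := by
  refine TensorProduct.induction_on (motive := P) x ?_ h hadd
  have h0 : tmul f M 0 0 = 0 := TensorProduct.tmul_zero M (show Along f from 0)
  exact h0 ▸ h 0 0

instance {S : Type*} [CommRing S] [Algebra S B] : IsScalarTower S B (BC f M) :=
  ⟨fun s b x => by
    refine induction (P := fun x => (s • b) • x = s • b • x) (fun c m => ?_)
      (fun x y hx hy => ?_) x
    · rw [smul_tmul, smul_tmul, smul_tmul, smul_assoc]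
    · rw [smul_add, hx, hy, smul_add, smul_add]⟩

variable (f) in
/-- The canonical semilinear map `M → M ⊗_{A,f} B`, `m ↦ m ⊗ 1`. -/
def ι : M →ₛₗ[f] BC f M where
  toFun m := tmul f M 1 m
  map_add' := tmul_add 1
  map_smul' a m := by rw [tmul_smul, smul_tmul, smul_eq_mul]

theorem tmul_eq (b : B) (m : M) : tmul f M b m = b • ι f m := by
  change _ = b • tmul f M 1 m
  rw [smul_tmul, smul_eq_mul, mul_one]

/-- Universal property: a map `φ : M → N` that is semilinear along `h = g ∘ f` extends to
`M ⊗_{A,f} B → N`, `m ⊗ b ↦ g b • φ m`. -/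
def desc {N : Type*} [AddCommGroup N] [Module C N] {h : A →+* C} (g : B →+* C)
    (hg : g.comp f = h) (φ : M →ₛₗ[h] N) : BC f M →ₛₗ[g] N :=
  let F : Along f ⊗[A] M →+ N := TensorProduct.liftAddHom
    ({ toFun := fun b =>
        { toFun := fun m => g b • φ m
          map_zero' := by simp
          map_add' := by simp }
       map_zero' := by ext m; change g 0 • φ m = 0; simp
       map_add' := by
        intro b c
        ext m
        exact (congrArg (· • φ m) (g.map_add b c)).trans (add_smul (g b) (g c) (φ m)) } : Along f →+ M →+ N)
    (by
      subst hg
      intro a b m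
      change g (f a * (show B from b)) • φ m = g b • φ (a • m)
      rw [φ.map_smulₛₗ, smul_smul, map_mul, mul_comm]; rfl)
  { toFun := F
    map_add' := F.map_add
    map_smul' := fun b x => by
      refine induction (f := f) (P := fun x => F (b • x) = g b • F x) (fun c m => ?_)
        (fun x y hx hy => ?_) x
      · change g (b * c) • φ m = g b • g c • φ m
        rw [map_mul, mul_smul]
      · have h1 : F (b • (x + y)) = F (b • x) + F (b • y) :=
          (congrArg F (smul_add b x y)).trans (F.map_add _ _)
        have h2 : F (x + y) = F x + F y := F.map_add x y
        exact h1.trans ((congrArg₂ (· + ·) hx hy).trans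
          ((smul_add (g b) (F x) (F y)).symm.trans (congrArg (g b • ·) h2.symm))) }

theorem desc_tmul {N : Type*} [AddCommGroup N] [Module C N] {h : A →+* C} (g : B →+* C)
    (hg : g.comp f = h) (φ : M →ₛₗ[h] N) (b : B) (m : M) :
    desc g hg φ (tmul f M b m) = g b • φ m := rfl

@[simp]
theorem desc_ι {N : Type*} [AddCommGroup N] [Module C N] {h : A →+* C} (g : B →+* C)
    (hg : g.comp f = h) (φ : M →ₛₗ[h] N) (m : M) : desc g hg φ (ι f m) = φ m := by
  change g 1 • φ m = φ m
  simp

theorem hom_ext {N : Type*} [AddCommGroup N] [Module C N] {g : B →+* C}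
    {φ ψ : BC f M →ₛₗ[g] N} (h : ∀ m, φ (ι f m) = ψ (ι f m)) : φ = ψ := by
  ext x
  refine induction (P := fun x => φ x = ψ x) (fun b m => ?_) (fun x y hx hy => ?_) x
  · rw [tmul_eq, φ.map_smulₛₗ, ψ.map_smulₛₗ, h]
  · rw [map_add, map_add, hx, hy]

/-- The canonical map `M ⊗_{A,f} B → M ⊗_{A,h} C`, `m ⊗ b ↦ m ⊗ g b`, for `h = g ∘ f`. -/
def push {h : A →+* C} (g : B →+* C) (hg : g.comp f = h) : BC f M →ₛₗ[g] BC h M :=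
  desc g hg (ι h)

@[simp]
theorem push_ι {h : A →+* C} (g : B →+* C) (hg : g.comp f = h) (m : M) :
    push g hg (ι f m) = ι h m := desc_ι _ _ _ _

/-- The base change `φ ⊗ id` of an `A`-linear map `φ`. -/
def map {N : Type*} [AddCommGroup N] [Module A N] (φ : M →ₗ[A] N) : BC f M →ₗ[B] BC f N :=
  desc (RingHom.id B) (RingHom.id_comp f)
    ({ toFun := fun m => ι f (φ m)
       map_add' := by simp
       map_smul' := by simp } : M →ₛₗ[f] BC f N)

end BC

end BaseChange

/-! ### Power series and Laurent series -/

/-- The homomorphism `A((z)) → B((z))` obtained by applying `f` to all coefficients. -/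
def laurentMap {A B : Type*} [CommRing A] [CommRing B] (f : A →+* B) : A⸨X⸩ →+* B⸨X⸩ where
  toFun x := x.map f
  map_one' := by ext n; simp [HahnSeries.coeff_one, apply_ite f]
  map_mul' x y := HahnSeries.map_mul (f : A →ₙ+* B)
  map_zero' := by ext n; simp
  map_add' x y := by ext n; simp

@[simp]
theorem laurentMap_coeff {A B : Type*} [CommRing A] [CommRing B] (f : A →+* B) (x : A⸨X⸩)
    (n : ℤ) : (laurentMap f x).coeff n = f (x.coeff n) := rfl

/-- The inclusion `A⟦z⟧ → A((z))`. -/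
abbrev ofPS (A : Type*) [CommRing A] : A⟦X⟧ →+* A⸨X⸩ := HahnSeries.ofPowerSeries ℤ A

theorem laurentMap_comp_ofPS {A B : Type*} [CommRing A] [CommRing B] (f : A →+* B) :
    (laurentMap f).comp (ofPS A) = (ofPS B).comp (PowerSeries.map f) := by
  ext x n
  simp only [RingHom.comp_apply, laurentMap_coeff]
  rcases n with n | n
  · simp only [Int.ofNat_eq_natCast, HahnSeries.ofPowerSeries_apply_coeff, PowerSeries.coeff_map]
  · rw [HahnSeries.ofPowerSeries_apply, HahnSeries.ofPowerSeries_apply,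
      HahnSeries.embDomain_of_notMem_range, HahnSeries.embDomain_of_notMem_range] <;> simp

/-- The homomorphism `A((z)) = A⟦z⟧[1/z] → B` induced by a homomorphism `A⟦z⟧ → B` which maps `z`
to a unit. -/
def laurentLift {A B : Type*} [CommRing A] [CommRing B] (g : A⟦X⟧ →+* B)
    (hg : IsUnit (g PowerSeries.X)) : A⸨X⸩ →+* B :=
  IsLocalization.Away.lift (PowerSeries.X : A⟦X⟧) hg

theorem laurentLift_comp {A B : Type*} [CommRing A] [CommRing B] (g : A⟦X⟧ →+* B)
    (hg : IsUnit (g PowerSeries.X)) : (laurentLift g hg).comp (ofPS A) = g :=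
  IsLocalization.Away.lift_comp (S := A⸨X⸩) (PowerSeries.X : A⟦X⟧) hg

theorem laurent_hom_ext {A B : Type*} [CommRing A] [CommRing B] {g h : A⸨X⸩ →+* B}
    (H : g.comp (ofPS A) = h.comp (ofPS A)) : g = h :=
  IsLocalization.ringHom_ext (Submonoid.powers (PowerSeries.X : A⟦X⟧)) H

/-! ### The field `K`, its valuation ring, separable closure and completed algebraic closure -/

section Fields

variable (K : Type u) [NontriviallyNormedField K] [CompleteSpace K] [IsUltrametricDist K]

/-- The algebraic closure of `K` carries the unique extension of the absolute value of `K`. -/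
instance algClosureNormedField : NormedField (AlgebraicClosure K) :=
  spectralNorm.normedField K (AlgebraicClosure K)

instance algClosureNormedAlgebra : NormedAlgebra K (AlgebraicClosure K) :=
  spectralNorm.normedAlgebra K (AlgebraicClosure K)

instance algClosureUltrametric : IsUltrametricDist (AlgebraicClosure K) :=
  IsUltrametricDist.isUltrametricDist_of_forall_norm_add_le_max_norm
    (isNonarchimedean_spectralNorm (K := K) (L := AlgebraicClosure K))

/-- The separable closure `K^sep` of `K` in its algebraic closure. -/
abbrev Ksep : Type u := separableClosure K (AlgebraicClosure K)

instance ksepUltrametric : IsUltrametricDist (Ksep K) :=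
  ⟨fun x y z => IsUltrametricDist.dist_triangle_max (x : AlgebraicClosure K) y z⟩

/-- The completion `K̄` of the algebraic closure of `K`. -/
abbrev Kbar : Type u := Completion (AlgebraicClosure K)

instance kbarUltrametric : IsUltrametricDist (Kbar K) := IsUltrametricDist.of_normedAlgebra K

/-- The inclusion `K^alg → K̄`. -/
def algToBar : AlgebraicClosure K →+* Kbar K := Completion.coeRingHom

/-- The inclusion `K^sep → K̄`. -/
def sepToBar : Ksep K →+* Kbar K :=
  (algToBar K).comp (algebraMap (Ksep K) (AlgebraicClosure K))

/-- The inclusion `K → K̄`. -/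
def toBar : K →+* Kbar K := (algToBar K).comp (algebraMap K (AlgebraicClosure K))

theorem norm_sepToBar (x : Ksep K) : ‖sepToBar K x‖ = ‖x‖ :=
  Completion.norm_coe (x : AlgebraicClosure K)

theorem norm_toBar (x : K) : ‖toBar K x‖ = ‖x‖ :=
  (Completion.norm_coe _).trans (norm_algebraMap' (AlgebraicClosure K) x)

theorem norm_toSep (x : K) : ‖algebraMap K (Ksep K) x‖ = ‖x‖ :=
  norm_algebraMap' (AlgebraicClosure K) x

/-- The completed perfect closure of `K`, i.e. the topological closure in `K̄` of the perfect
closure of `K` in `K^alg`. -/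
def perfCompletion : Set (Kbar K) :=
  closure (algToBar K '' (perfectClosure K (AlgebraicClosure K) : Set (AlgebraicClosure K)))

variable {K} in
/-- The action of `g ∈ Gal(K^sep/K)` on `K^alg`: the unique extension of `g`. -/
def galAlg (g : Ksep K ≃ₐ[K] Ksep K) : AlgebraicClosure K ≃ₐ[K] AlgebraicClosure K :=
  g.liftNormal (AlgebraicClosure K)

variable {K} in
theorem continuous_galAlg (g : Ksep K ≃ₐ[K] Ksep K) :
    Continuous ((galAlg g : AlgebraicClosure K →+* AlgebraicClosure K)) :=
  (AddMonoidHomClass.isometry_of_norm _ fun x =>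
    (spectralNorm_eq_of_equiv (K := K) (galAlg g) x).symm).continuous

variable {K} in
/-- The action of `g ∈ Gal(K^sep/K)` on `K̄`, by continuity. -/
def galBar (g : Ksep K ≃ₐ[K] Ksep K) : Kbar K →+* Kbar K :=
  Completion.mapRingHom (galAlg g : AlgebraicClosure K →+* AlgebraicClosure K)
    (continuous_galAlg g)

variable {K} in
/-- The action of `g ∈ Gal(K^sep/K)` on `K^sep`. -/
def galSep (g : Ksep K ≃ₐ[K] Ksep K) : Ksep K →+* Ksep K := g

variable {K} in
theorem galBar_algToBar (g : Ksep K ≃ₐ[K] Ksep K) (x : AlgebraicClosure K) :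
    galBar g (algToBar K x) = algToBar K (galAlg g x) :=
  Completion.mapRingHom_coe (continuous_galAlg g) x

variable {K} in
theorem galBar_comp_toBar (g : Ksep K ≃ₐ[K] Ksep K) : (galBar g).comp (toBar K) = toBar K := by
  ext x
  simp only [toBar, RingHom.comp_apply, galBar_algToBar, AlgEquiv.commutes]

variable {K} in
theorem galBar_sepToBar (g : Ksep K ≃ₐ[K] Ksep K) (x : Ksep K) :
    galBar g (sepToBar K x) = sepToBar K (galSep g x) :=
  (galBar_algToBar g x).trans
    (congrArg (algToBar K) (AlgEquiv.liftNormal_commutes g (AlgebraicClosure K) x))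

/-- The valuation ring `R` of `K`. -/
abbrev Rint : Subring K := (NormedField.valuation (K := K)).integer

/-- The elements `ζ` of `K` with `0 < |ζ| < 1`. -/
structure PU : Type u where
  /-- the element `ζ` -/
  val : K
  ne_zero : val ≠ 0
  norm_lt_one : ‖val‖ < 1

variable {K}

/-- `ζ` as an element of `R`. -/
def PU.toInt (ζ : PU K) : Rint K := ⟨ζ.val, ζ.norm_lt_one.le⟩

/-- The element `z - ζ` of `R⟦z⟧`. -/
def PU.zSub (ζ : PU K) : (Rint K)⟦X⟧ := PowerSeries.X - PowerSeries.C ζ.toInt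

variable (F : Type w) [Field F] [Fintype F] [Algebra F K]

variable (K) in
/-- The `q̂`-Frobenius `b ↦ b ^ q̂` of `R`, where `q̂ = #F`. -/
def frobInt : Rint K →+* Rint K :=
  ((FiniteField.frobeniusAlgHom F K : K →+* K).comp (Rint K).subtype).codRestrict (Rint K)
    fun x => (Rint K).pow_mem x.2 (Fintype.card F)

variable (K) in
/-- The `q̂`-Frobenius of `K^sep`. -/
def frobSep : Ksep K →+* Ksep K := (FiniteField.frobeniusAlgHom F (Ksep K) : Ksep K →+* Ksep K)

variable (K) in
/-- The inclusion `F → R`. -/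
def constInt : F →+* Rint K :=
  (algebraMap F K).codRestrict (Rint K) fun x => by
    change ‖algebraMap F K x‖ ≤ 1
    by_cases hx : x = 0
    · simp [hx]
    · have h1 : ‖algebraMap F K x‖ ^ (Fintype.card F - 1) = 1 := by
        rw [← norm_pow, ← map_pow, FiniteField.pow_card_sub_one_eq_one x hx]; simp
      exact le_of_eq ((pow_eq_one_iff_of_nonneg (norm_nonneg _)
        (Nat.sub_ne_zero_of_lt Fintype.one_lt_card)).1 h1)

variable (K) in
/-- The endomorphism `σ̂` of `R⟦z⟧` with `σ̂(z) = z` and `σ̂(b) = b ^ q̂` for `b ∈ R`. -/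
def sigma : (Rint K)⟦X⟧ →+* (Rint K)⟦X⟧ := PowerSeries.map (frobInt K F)

variable (K) in
/-- The inclusion `R → K^sep`. -/
def intToSep : Rint K →+* Ksep K := (algebraMap K (Ksep K)).comp (Rint K).subtype

end Fields

/-! ### Convergent power series and their expansion at `z = ζ` -/

section Taylor

/-- The ring `L⟨z/ζ⟩` of power series `∑ b_n z^n` over `L` with `|b_n| c^n → 0`, for `c = |ζ|`. -/
abbrev Tate (L : Type*) [NormedField L] [IsUltrametricDist L] (c : ℝ) : Subring L⟦X⟧ :=
  PowerSeries.IsRestricted.subring (R := L) c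

theorem mem_Tate {L : Type*} [NormedField L] [IsUltrametricDist L] {c : ℝ} {f : L⟦X⟧} :
    f ∈ Tate L c ↔
      Filter.Tendsto (fun n => ‖PowerSeries.coeff n f‖ * c ^ n) Filter.atTop (𝓝 0) :=
  PowerSeries.isRestricted_iff' c f

theorem choose_mul_aux {L : Type*} [Field L] (ζ : L) (a b : ℕ → L) (k n : ℕ) :
    (n.choose k : L) * (∑ x ∈ Finset.HasAntidiagonal.antidiagonal n, a x.1 * b x.2) * ζ ^ (n - k) =
      ∑ p ∈ Finset.HasAntidiagonal.antidiagonal k, ∑ x ∈ Finset.HasAntidiagonal.antidiagonal n, ((x.1.choose p.1 : L) * a x.1 * ζ ^ (x.1 - p.1)) *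
        ((x.2.choose p.2 : L) * b x.2 * ζ ^ (x.2 - p.2)) := by
  rw [Finset.sum_comm, Finset.mul_sum, Finset.sum_mul]
  refine Finset.sum_congr rfl fun x hx => ?_
  have hn : x.1 + x.2 = n := Finset.HasAntidiagonal.mem_antidiagonal.1 hx
  subst hn
  rw [Nat.add_choose_eq]
  push_cast
  rw [Finset.sum_mul, Finset.sum_mul]
  refine Finset.sum_congr rfl fun p hp => ?_
  rcases lt_or_ge x.1 p.1 with h | h
  · simp [Nat.choose_eq_zero_of_lt h]
  rcases lt_or_ge x.2 p.2 with h' | h'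
  · simp [Nat.choose_eq_zero_of_lt h']
  have h3 : x.1 + x.2 - k = (x.1 - p.1) + (x.2 - p.2) := by
    have := Finset.HasAntidiagonal.mem_antidiagonal.1 hp; omega
  rw [h3, pow_add]; ring

theorem tsum_cauchy_aux {L : Type*} [NormedField L] [IsUltrametricDist L]
    {u v : ℕ → ℕ → L} (hu : ∀ i, Summable (u i)) (hv : ∀ i, Summable (v i))
    (k : ℕ) :
    ∑ p ∈ Finset.HasAntidiagonal.antidiagonal k, (∑' n, u p.1 n) * ∑' n, v p.2 n =
      ∑' n, ∑ p ∈ Finset.HasAntidiagonal.antidiagonal k, ∑ x ∈ Finset.HasAntidiagonal.antidiagonal n, u p.1 x.1 * v p.2 x.2 := by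
  have : NonarchimedeanRing L :=
    { is_nonarchimedean := NonarchimedeanAddGroup.is_nonarchimedean }
  have hs : ∀ p : ℕ × ℕ, Summable fun x : ℕ × ℕ => u p.1 x.1 * v p.2 x.2 := fun p =>
    (hu p.1).mul_of_nonarchimedean (hv p.2)
  have h1 : ∀ p ∈ Finset.HasAntidiagonal.antidiagonal k, (∑' n, u p.1 n) * ∑' n, v p.2 n =
      ∑' n, ∑ x ∈ Finset.HasAntidiagonal.antidiagonal n, u p.1 x.1 * v p.2 x.2 := fun p _ =>
    (hu p.1).tsum_mul_tsum_eq_tsum_sum_antidiagonal (hv p.2) (hs p)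
  rw [Finset.sum_congr rfl h1]
  exact (Summable.tsum_finsetSum fun p _ =>
    summable_sum_mul_antidiagonal_of_summable_mul (hs p)).symm

variable {L : Type*} [NormedField L] [CompleteSpace L] [IsUltrametricDist L]

theorem taylor_summable {ζ : L} (hζ : ζ ≠ 0) {f : L⟦X⟧} (hf : f ∈ Tate L ‖ζ‖) (i : ℕ) :
    Summable fun n : ℕ => (n.choose i : L) * PowerSeries.coeff n f * ζ ^ (n - i) := by
  apply NonarchimedeanAddGroup.summable_of_tendsto_cofinite_zero
  rw [Nat.cofinite_eq_atTop]
  have h := (mem_Tate.1 hf).mul_const (‖ζ‖ ^ i)⁻¹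
  rw [zero_mul] at h
  refine squeeze_zero_norm (fun n => ?_) h
  rcases lt_or_ge n i with hn | hn
  · rw [Nat.choose_eq_zero_of_lt hn]
    simp only [Nat.cast_zero, zero_mul, norm_zero]
    positivity
  · have hz : ‖ζ‖ ^ i ≠ 0 := pow_ne_zero _ (norm_ne_zero_iff.2 hζ)
    have h2 : ‖ζ‖ ^ n * (‖ζ‖ ^ i)⁻¹ = ‖ζ‖ ^ (n - i) := by
      rw [← Nat.sub_add_cancel hn, pow_add, Nat.add_sub_cancel, mul_assoc, mul_inv_cancel₀ hz,
        mul_one]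
    rw [norm_mul, norm_mul, norm_pow, mul_assoc (‖PowerSeries.coeff n f‖), h2, mul_assoc]
    exact mul_le_of_le_one_left (by positivity) (IsUltrametricDist.norm_natCast_le_one L _)

/-- The expansion at `z = ζ`: the homomorphism `L⟨z/ζ⟩ → L⟦z - ζ⟧` given by `z ↦ ζ + (z - ζ)`,
that is `∑ b_n z^n ↦ ∑_i (∑_n (n choose i) b_n ζ^(n-i)) (z - ζ)^i`. The variable of the target
stands for `z - ζ`. -/
def taylor (ζ : L) (hζ : ζ ≠ 0) : Tate L ‖ζ‖ →+* L⟦X⟧ where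
  toFun f := PowerSeries.mk fun i =>
    ∑' n : ℕ, (n.choose i : L) * PowerSeries.coeff n (f : L⟦X⟧) * ζ ^ (n - i)
  map_zero' := by ext i; simp
  map_one' := by
    ext i
    rw [PowerSeries.coeff_mk, tsum_eq_single 0]
    · rcases i with _ | i <;> simp [PowerSeries.coeff_one]
    · intro n hn; simp [PowerSeries.coeff_one, hn]
  map_add' f g := by
    ext i
    simp only [PowerSeries.coeff_mk, map_add, Subring.coe_add]
    rw [← (taylor_summable hζ f.2 i).tsum_add (taylor_summable hζ g.2 i)]
    congr 1; ext n; ring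
  map_mul' f g := by
    ext k
    rw [PowerSeries.coeff_mul]
    simp only [PowerSeries.coeff_mk, Subring.coe_mul, PowerSeries.coeff_mul]
    exact (tsum_congr fun n => choose_mul_aux ζ (fun n => PowerSeries.coeff n (f : L⟦X⟧))
      (fun n => PowerSeries.coeff n (g : L⟦X⟧)) k n).trans (tsum_cauchy_aux (taylor_summable hζ f.2) (taylor_summable hζ g.2) k).symm

theorem coeff_taylor (ζ : L) (hζ : ζ ≠ 0) (f : Tate L ‖ζ‖) (i : ℕ) :
    PowerSeries.coeff i (taylor ζ hζ f) =
      ∑' n : ℕ, (n.choose i : L) * PowerSeries.coeff n (f : L⟦X⟧) * ζ ^ (n - i) :=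
  PowerSeries.coeff_mk i fun i : ℕ =>
    ∑' n : ℕ, (n.choose i : L) * PowerSeries.coeff n (f : L⟦X⟧) * ζ ^ (n - i)

end Taylor

/-! ### The coefficient rings and the homomorphisms between them -/

section Rings

set_option linter.unusedSectionVars false

variable {K : Type u} [NontriviallyNormedField K] [CompleteSpace K] [IsUltrametricDist K]

theorem norm_subtype_le (x : Rint K) : ‖(Rint K).subtype x‖ ≤ 1 := x.2

/-- The homomorphism `R⟦z⟧ → E⟨z/ζ⟩` induced by a homomorphism `j : R → E` into a valued field. -/
def toTate {E : Type*} [NormedField E] [IsUltrametricDist E] (j : Rint K →+* E)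
    (hj : ∀ x, ‖j x‖ ≤ 1) (ζ : PU K) : (Rint K)⟦X⟧ →+* Tate E ‖ζ.val‖ :=
  (PowerSeries.map j).codRestrict (Tate E ‖ζ.val‖) fun f => mem_Tate.2 <| by
    refine squeeze_zero (fun n => by positivity) (fun n => ?_)
      (tendsto_pow_atTop_nhds_zero_of_lt_one (norm_nonneg ζ.val) ζ.norm_lt_one)
    rw [PowerSeries.coeff_map]
    exact mul_le_of_le_one_left (by positivity) (hj _)

theorem toTate_coe {E : Type*} [NormedField E] [IsUltrametricDist E] (j : Rint K →+* E)
    (hj : ∀ x, ‖j x‖ ≤ 1) (ζ : PU K) (f : (Rint K)⟦X⟧) :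
    (toTate j hj ζ f : E⟦X⟧) = PowerSeries.map j f := rfl

/-- The homomorphism `R⟦z⟧ → K⟦z - ζ⟧`, `z ↦ ζ + (z - ζ)`. -/
def psDR (ζ : PU K) : (Rint K)⟦X⟧ →+* K⟦X⟧ :=
  (taylor ζ.val ζ.ne_zero).comp (toTate (Rint K).subtype norm_subtype_le ζ)

theorem coeff_psDR (ζ : PU K) (f : (Rint K)⟦X⟧) (i : ℕ) :
    PowerSeries.coeff i (psDR ζ f) =
      ∑' n : ℕ, (n.choose i : K) * ((PowerSeries.coeff n f : Rint K) : K) * ζ.val ^ (n - i) := by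
  rw [psDR, RingHom.comp_apply, coeff_taylor]
  refine tsum_congr fun n => ?_
  rw [toTate_coe, PowerSeries.coeff_map]
  rfl

theorem psDR_C (ζ : PU K) (a : Rint K) : psDR ζ (PowerSeries.C a) = PowerSeries.C (a : K) := by
  ext i
  rw [coeff_psDR, tsum_eq_single 0]
  · rcases i with _ | i <;> simp [PowerSeries.coeff_C]
  · intro n hn; simp [PowerSeries.coeff_C, hn]

theorem psDR_X (ζ : PU K) : psDR ζ PowerSeries.X = PowerSeries.X + PowerSeries.C ζ.val := by
  ext i
  rw [coeff_psDR, tsum_eq_single 1]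
  · rcases i with _ | _ | i
    · simp
    · simp
    · simp [PowerSeries.coeff_X, Nat.choose_eq_zero_of_lt]
  · intro n hn; simp [PowerSeries.coeff_X, hn]

theorem psDR_zSub (ζ : PU K) : psDR ζ ζ.zSub = PowerSeries.X := by
  rw [PU.zSub, map_sub, psDR_X, psDR_C]
  exact add_sub_cancel_right _ _

theorem isUnit_psDR_X (ζ : PU K) : IsUnit (psDR ζ PowerSeries.X) := by
  rw [psDR_X, PowerSeries.isUnit_iff_constantCoeff]
  simpa using ζ.ne_zero

/-- The homomorphism `R⟦z⟧ → K((z - ζ))`, `z ↦ ζ + (z - ζ)`. -/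
def bdR (ζ : PU K) : (Rint K)⟦X⟧ →+* K⸨X⸩ := (ofPS K).comp (psDR ζ)

theorem isUnit_bdR_zSub (ζ : PU K) : IsUnit (bdR ζ ζ.zSub) := by
  rw [bdR, RingHom.comp_apply, psDR_zSub]
  exact IsLocalization.map_units K⸨X⸩
    (⟨PowerSeries.X, 1, pow_one _⟩ : Submonoid.powers (PowerSeries.X : K⟦X⟧))

/-- The homomorphism `R((z)) → K((z - ζ))`, `z ↦ ζ + (z - ζ)`. -/
def laurentDR (ζ : PU K) : (Rint K)⸨X⸩ →+* K⸨X⸩ :=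
  laurentLift (bdR ζ) ((isUnit_psDR_X ζ).map (ofPS K))

theorem laurentDR_comp (ζ : PU K) : (laurentDR ζ).comp (ofPS (Rint K)) = bdR ζ :=
  laurentLift_comp _ _

/-- The homomorphism `R⟦z⟧ → K`, `z ↦ ζ`. -/
def evalDR (ζ : PU K) : (Rint K)⟦X⟧ →+* K := PowerSeries.constantCoeff.comp (psDR ζ)

/-- The inclusion `K((z - ζ)) → K̄((z - ζ))`. -/
abbrev toBarL (K : Type u) [NontriviallyNormedField K] [CompleteSpace K] [IsUltrametricDist K] :
    K⸨X⸩ →+* (Kbar K)⸨X⸩ := laurentMap (toBar K)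

/-- The homomorphism `R⟦z⟧ → K̄((z - ζ))`, `z ↦ ζ + (z - ζ)`. -/
def bdRbar (ζ : PU K) : (Rint K)⟦X⟧ →+* (Kbar K)⸨X⸩ := (toBarL K).comp (bdR ζ)

theorem toBarL_comp_bdR (ζ : PU K) : (toBarL K).comp (bdR ζ) = bdRbar ζ := rfl

theorem ofPS_comp_psDR (ζ : PU K) : (ofPS K).comp (psDR ζ) = bdR ζ := rfl

/-- The inclusion `R⟦z⟧ → K^sep⟦z⟧`. -/
def psSep (K : Type u) [NontriviallyNormedField K] [CompleteSpace K] [IsUltrametricDist K] :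
    (Rint K)⟦X⟧ →+* (Ksep K)⟦X⟧ := PowerSeries.map (intToSep K)

/-- The inclusion `R((z)) → K^sep((z))`. -/
abbrev laurentSep (K : Type u) [NontriviallyNormedField K] [CompleteSpace K]
    [IsUltrametricDist K] : (Rint K)⸨X⸩ →+* (Ksep K)⸨X⸩ := laurentMap (intToSep K)

/-- The inclusion `R⟦z⟧ → K^sep((z))`. -/
def bSep (K : Type u) [NontriviallyNormedField K] [CompleteSpace K] [IsUltrametricDist K] :
    (Rint K)⟦X⟧ →+* (Ksep K)⸨X⸩ := (laurentSep K).comp (ofPS (Rint K))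

theorem ofPS_comp_psSep : (ofPS (Ksep K)).comp (psSep K) = bSep K :=
  (laurentMap_comp_ofPS _).symm

theorem laurentSep_comp : (laurentSep K).comp (ofPS (Rint K)) = bSep K := rfl

theorem isUnit_psSep_zSub (ζ : PU K) : IsUnit (psSep K ζ.zSub) := by
  rw [PowerSeries.isUnit_iff_constantCoeff, psSep, PU.zSub, map_sub, PowerSeries.map_X,
    PowerSeries.map_C, map_sub, PowerSeries.constantCoeff_X, PowerSeries.constantCoeff_C, zero_sub,
    IsUnit.neg_iff, isUnit_iff_ne_zero, ← norm_ne_zero_iff]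
  exact (norm_toSep K ζ.val).symm ▸ norm_ne_zero_iff.2 ζ.ne_zero

theorem isUnit_bSep_zSub (ζ : PU K) : IsUnit (bSep K ζ.zSub) := by
  rw [← ofPS_comp_psSep]
  exact (isUnit_psSep_zSub ζ).map (ofPS (Ksep K))

/-- The inclusion `R⟦z⟧ → K^sep⟨z/ζ⟩`. -/
def tateSep (ζ : PU K) : (Rint K)⟦X⟧ →+* Tate (Ksep K) ‖ζ.val‖ :=
  toTate (intToSep K) (fun x => (norm_toSep K (x : K)).le.trans (norm_subtype_le x)) ζ

theorem tateSep_comp (ζ : PU K) :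
    (Tate (Ksep K) ‖ζ.val‖).subtype.comp (tateSep ζ) = psSep K := rfl

/-- The homomorphism `K^sep⟨z/ζ⟩ → K̄⟦z - ζ⟧`, `z ↦ ζ + (z - ζ)`. -/
def tateDR (ζ : PU K) : Tate (Ksep K) ‖ζ.val‖ →+* (Kbar K)⟦X⟧ :=
  (taylor (toBar K ζ.val) ((map_ne_zero _).2 ζ.ne_zero)).comp
    (((PowerSeries.map (sepToBar K)).comp (Tate (Ksep K) ‖ζ.val‖).subtype).codRestrict
      (Tate (Kbar K) ‖toBar K ζ.val‖) fun f => mem_Tate.2 <| by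
        have h := mem_Tate.1 f.2
        simpa only [RingHom.comp_apply, PowerSeries.coeff_map, norm_sepToBar, norm_toBar,
          Subring.subtype_apply] using h)

theorem coeff_tateDR (ζ : PU K) (f : Tate (Ksep K) ‖ζ.val‖) (i : ℕ) :
    PowerSeries.coeff i (tateDR ζ f) = ∑' n : ℕ, (n.choose i : Kbar K) *
      sepToBar K (PowerSeries.coeff n (f : (Ksep K)⟦X⟧)) * toBar K ζ.val ^ (n - i) := by
  rw [tateDR, RingHom.comp_apply, coeff_taylor]
  refine tsum_congr fun n => ?_
  rw [← PowerSeries.coeff_map]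
  rfl

theorem continuous_toBar : Continuous (toBar K) :=
  (AddMonoidHomClass.isometry_of_norm _ (norm_toBar K)).continuous

theorem tateDR_comp (ζ : PU K) :
    (tateDR ζ).comp (tateSep ζ) = (PowerSeries.map (toBar K)).comp (psDR ζ) := by
  ext f i
  rw [RingHom.comp_apply, RingHom.comp_apply, PowerSeries.coeff_map, coeff_psDR, coeff_tateDR]
  have hs : Summable fun n : ℕ =>
      (n.choose i : K) * ((PowerSeries.coeff n f : Rint K) : K) * ζ.val ^ (n - i) :=
    taylor_summable ζ.ne_zero (toTate (Rint K).subtype norm_subtype_le ζ f).2 i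
  rw [hs.map_tsum (toBar K) continuous_toBar]
  refine tsum_congr fun n => ?_
  rw [map_mul, map_mul, map_pow, map_natCast]
  rfl

theorem ofPS_comp_tateDR_comp (ζ : PU K) :
    ((ofPS (Kbar K)).comp (tateDR ζ)).comp (tateSep ζ) = bdRbar ζ := by
  rw [RingHom.comp_assoc, tateDR_comp, ← RingHom.comp_assoc, ← laurentMap_comp_ofPS]
  rfl

variable (F : Type w) [Field F] [Fintype F] [Algebra F K]

/-- The homomorphism `Q_ε = F((z)) → K⟦z - ζ⟧`, `z ↦ ζ + (z - ζ)`. -/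
def constDR (ζ : PU K) : F⸨X⸩ →+* K⟦X⟧ :=
  laurentLift ((psDR ζ).comp (PowerSeries.map (constInt K F))) (by
    rw [RingHom.comp_apply, PowerSeries.map_X]; exact isUnit_psDR_X ζ)

/-- The homomorphism `Q_ε = F((z)) → K̄((z - ζ))`, `z ↦ ζ + (z - ζ)`. -/
def constBar (ζ : PU K) : F⸨X⸩ →+* (Kbar K)⸨X⸩ :=
  (toBarL K).comp ((ofPS K).comp (constDR F ζ))

/-- The inclusion `Q_ε = F((z)) → K^sep((z))`. -/
def constSep (K : Type u) [NontriviallyNormedField K] [CompleteSpace K] [IsUltrametricDist K]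
    (F : Type w) [Field F] [Fintype F] [Algebra F K] : F⸨X⸩ →+* (Ksep K)⸨X⸩ :=
  laurentMap ((intToSep K).comp (constInt K F))

/-- The endomorphism `σ̂` of `R((z))`. -/
abbrev sigmaL (K : Type u) [NontriviallyNormedField K] [CompleteSpace K] [IsUltrametricDist K]
    (F : Type w) [Field F] [Fintype F] [Algebra F K] : (Rint K)⸨X⸩ →+* (Rint K)⸨X⸩ :=
  laurentMap (frobInt K F)

theorem sigmaL_comp : (sigmaL K F).comp (ofPS (Rint K)) = (ofPS (Rint K)).comp (sigma K F) :=
  laurentMap_comp_ofPS _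

/-- The endomorphism `σ̂` of `K^sep⟦z⟧`. -/
def sigmaSep (K : Type u) [NontriviallyNormedField K] [CompleteSpace K] [IsUltrametricDist K]
    (F : Type w) [Field F] [Fintype F] [Algebra F K] : (Ksep K)⟦X⟧ →+* (Ksep K)⟦X⟧ :=
  PowerSeries.map (frobSep K F)

/-- The endomorphism `σ̂` of `K^sep((z))`. -/
def sigmaSepL (K : Type u) [NontriviallyNormedField K] [CompleteSpace K] [IsUltrametricDist K]
    (F : Type w) [Field F] [Fintype F] [Algebra F K] : (Ksep K)⸨X⸩ →+* (Ksep K)⸨X⸩ :=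
  laurentMap (frobSep K F)

theorem frobSep_comp : (frobSep K F).comp (intToSep K) = (intToSep K).comp (frobInt K F) := by
  ext x
  exact congrArg Subtype.val
    (map_pow (algebraMap K (Ksep K)) (x : K) (Fintype.card F)).symm

theorem laurentMap_comp {A B C : Type*} [CommRing A] [CommRing B] [CommRing C] (f : A →+* B)
    (g : B →+* C) : (laurentMap g).comp (laurentMap f) = laurentMap (g.comp f) := rfl

theorem psMap_comp {A B C : Type*} [CommRing A] [CommRing B] [CommRing C] (f : A →+* B)
    (g : B →+* C) :
    (PowerSeries.map g).comp (PowerSeries.map f) = PowerSeries.map (g.comp f) := rfl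

theorem sigmaSep_comp : (sigmaSep K F).comp (psSep K) = (psSep K).comp (sigma K F) := by
  rw [sigmaSep, psSep, sigma, psMap_comp, psMap_comp, frobSep_comp]

theorem sigmaSepL_comp_laurentSep :
    (sigmaSepL K F).comp (laurentSep K) = (laurentSep K).comp (sigmaL K F) := by
  rw [sigmaSepL, laurentMap_comp, laurentMap_comp, frobSep_comp]

theorem sigmaSepL_comp : (sigmaSepL K F).comp (bSep K) = (bSep K).comp (sigma K F) := by
  rw [bSep, ← RingHom.comp_assoc, sigmaSepL_comp_laurentSep, RingHom.comp_assoc, sigmaL_comp,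
    RingHom.comp_assoc]

theorem sigmaSepL_constSep (c : F⸨X⸩) : sigmaSepL K F (constSep K F c) = constSep K F c := by
  ext n
  have h : ∀ a : F, frobSep K F (intToSep K (constInt K F a)) = intToSep K (constInt K F a) :=
    fun a => (FiniteField.frobeniusAlgHom F (Ksep K)).commutes a
  exact congrArg Subtype.val (h (c.coeff n))

theorem galSep_comp (g : Ksep K ≃ₐ[K] Ksep K) : (galSep g).comp (intToSep K) = intToSep K := by
  ext x
  exact congrArg Subtype.val (g.commutes (x : K))

theorem galSep_comp_frobSep (g : Ksep K ≃ₐ[K] Ksep K) :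
    (galSep g).comp (frobSep K F) = (frobSep K F).comp (galSep g) := by
  ext x
  exact congrArg Subtype.val (map_pow g x (Fintype.card F))

theorem galBar_comp_toBarL (g : Ksep K ≃ₐ[K] Ksep K) :
    (laurentMap (galBar g)).comp (toBarL K) = toBarL K := by
  rw [laurentMap_comp, galBar_comp_toBar]

theorem galBar_comp_constBar (g : Ksep K ≃ₐ[K] Ksep K) (ζ : PU K) :
    (laurentMap (galBar g)).comp (constBar F ζ) = constBar F ζ := by
  rw [constBar, ← RingHom.comp_assoc, galBar_comp_toBarL]

end Rings

/-! ### Local shtukas -/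

section Shtukas

set_option linter.unusedSectionVars false

variable {K : Type u} [NontriviallyNormedField K] [CompleteSpace K] [IsUltrametricDist K]
variable (F : Type w) [Field F] [Fintype F] [Algebra F K] (ζ : PU K)

/-- The ring `R⟦z⟧[1/(z - ζ)]`. -/
abbrev Rloc : Type u := Localization.Away ζ.zSub

/-- The Frobenius pullback `σ̂^* M = M ⊗_{R⟦z⟧,σ̂} R⟦z⟧`. -/
abbrev SigmaStar (K : Type u) [NontriviallyNormedField K] [CompleteSpace K]
    [IsUltrametricDist K] (F : Type w) [Field F] [Fintype F] [Algebra F K]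
    (M : Type v) [AddCommGroup M] [Module (Rint K)⟦X⟧ M] : Type _ :=
  BC (sigma K F) M

/-- A local `σ̂`-shtuka over `R`: a finite free `R⟦z⟧`-module `M` together with an isomorphism
`τ : σ̂^* M[1/(z - ζ)] → M[1/(z - ζ)]`. -/
structure LocalShtuka where
  /-- the underlying module -/
  carrier : Type v
  [addCommGroup : AddCommGroup carrier]
  [module : Module (Rint K)⟦X⟧ carrier]
  [free : Module.Free (Rint K)⟦X⟧ carrier]
  [finite : Module.Finite (Rint K)⟦X⟧ carrier]
  /-- the Frobenius isomorphism -/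
  tau : BC (algebraMap (Rint K)⟦X⟧ (Rloc ζ)) (SigmaStar K F carrier) ≃ₗ[Rloc ζ]
    BC (algebraMap (Rint K)⟦X⟧ (Rloc ζ)) carrier

attribute [instance] LocalShtuka.addCommGroup LocalShtuka.module LocalShtuka.free
  LocalShtuka.finite

namespace LocalShtuka

variable {F ζ}
variable (M N : LocalShtuka.{u, v, w} F ζ)

/-- `σ̂^* M`. -/
abbrev sig : Type _ := SigmaStar K F M.carrier

section Base

variable {B : Type*} [CommRing B] {C : Type*} [CommRing C]

/-- The extension `σ̂^* M ⊗_{R⟦z⟧} B → M ⊗_{R⟦z⟧} B` of `τ` to an `R⟦z⟧`-algebra `B` in which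
`z - ζ` is invertible. -/
def tauExt (g : (Rint K)⟦X⟧ →+* B) (hg : IsUnit (g ζ.zSub)) : BC g M.sig →ₗ[B] BC g M.carrier :=
  haveI hc : (IsLocalization.Away.lift ζ.zSub hg).comp (algebraMap (Rint K)⟦X⟧ (Rloc ζ)) = g :=
    IsLocalization.Away.lift_comp ζ.zSub hg
  BC.desc (RingHom.id B) (RingHom.id_comp g)
    ({ toFun := fun n => BC.push (IsLocalization.Away.lift ζ.zSub hg) hc (M.tau (BC.ι _ n))
       map_add' := by simp
       map_smul' := fun a n => by
        rw [LinearMap.map_smulₛₗ, map_smul, LinearMap.map_smulₛₗ, ← RingHom.comp_apply, hc] } :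
      M.sig →ₛₗ[g] BC g M.carrier)

/-- The natural map `M ⊗ B → σ̂^* M ⊗ B`, `m ⊗ b ↦ σ̂^* m ⊗ s b`, for a ring endomorphism `s` of
`B` compatible with `σ̂`. -/
def sigExt {g : (Rint K)⟦X⟧ →+* B} {s : B →+* B} (hs : s.comp g = g.comp (sigma K F)) :
    BC g M.carrier →ₛₗ[s] BC g M.sig :=
  BC.desc s hs
    ({ toFun := fun m => BC.ι g (BC.ι (sigma K F) m)
       map_add' := by simp
       map_smul' := fun a m => by
        rw [LinearMap.map_smulₛₗ, LinearMap.map_smulₛₗ, RingHom.comp_apply] } :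
      M.carrier →ₛₗ[g.comp (sigma K F)] BC g M.sig)

/-- The Frobenius invariants `{m ∈ M ⊗ B : τ (σ̂^* m) = m}`. -/
def invariants (g : (Rint K)⟦X⟧ →+* B) (hg : IsUnit (g ζ.zSub)) {s : B →+* B}
    (hs : s.comp g = g.comp (sigma K F)) : AddSubgroup (BC g M.carrier) where
  carrier := {m | M.tauExt g hg (M.sigExt hs m) = m}
  zero_mem' := by simp
  add_mem' := by
    intro x y hx hy
    change M.tauExt g hg (M.sigExt hs x) = x at hx
    change M.tauExt g hg (M.sigExt hs y) = y at hy
    change M.tauExt g hg (M.sigExt hs (x + y)) = x + y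
    rw [map_add, map_add, hx, hy]
  neg_mem' := by
    intro x hx
    change M.tauExt g hg (M.sigExt hs x) = x at hx
    change M.tauExt g hg (M.sigExt hs (-x)) = -x
    rw [map_neg, map_neg, hx]

theorem mem_invariants {g : (Rint K)⟦X⟧ →+* B} {hg : IsUnit (g ζ.zSub)} {s : B →+* B}
    {hs : s.comp g = g.comp (sigma K F)} {m : BC g M.carrier} :
    m ∈ M.invariants g hg hs ↔ M.tauExt g hg (M.sigExt hs m) = m := Iff.rfl

theorem smul_mem_invariants {g : (Rint K)⟦X⟧ →+* B} {hg : IsUnit (g ζ.zSub)} {s : B →+* B}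
    {hs : s.comp g = g.comp (sigma K F)} {b : B} (hb : s b = b) {m : BC g M.carrier}
    (hm : m ∈ M.invariants g hg hs) : b • m ∈ M.invariants g hg hs := by
  rw [mem_invariants] at hm ⊢
  rw [LinearMap.map_smulₛₗ, hb, map_smul, hm]

theorem push_tauExt {g : (Rint K)⟦X⟧ →+* B} (hg : IsUnit (g ζ.zSub))
    {h : (Rint K)⟦X⟧ →+* C} (hh : IsUnit (h ζ.zSub)) (p : B →+* C) (hp : p.comp g = h)
    (x : BC g M.sig) :
    BC.push p hp (M.tauExt g hg x) = M.tauExt h hh (BC.push p hp x) := by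
  have hc1 := IsLocalization.Away.lift_comp (S := Rloc ζ) ζ.zSub hg
  have hc2 := IsLocalization.Away.lift_comp (S := Rloc ζ) ζ.zSub hh
  have key : ∀ y : BC (algebraMap (Rint K)⟦X⟧ (Rloc ζ)) M.carrier,
      BC.push p hp (BC.push (IsLocalization.Away.lift ζ.zSub hg) hc1 y) =
        BC.push (IsLocalization.Away.lift ζ.zSub hh) hc2 y := by
    have hl : p.comp (IsLocalization.Away.lift (S := Rloc ζ) ζ.zSub hg) =
        IsLocalization.Away.lift (S := Rloc ζ) ζ.zSub hh := by
      apply IsLocalization.ringHom_ext (Submonoid.powers ζ.zSub)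
      rw [RingHom.comp_assoc, hc1, hc2, hp]
    intro y
    refine BC.induction (P := fun y => BC.push p hp
      (BC.push (IsLocalization.Away.lift ζ.zSub hg) hc1 y) =
        BC.push (IsLocalization.Away.lift ζ.zSub hh) hc2 y) (fun b m => ?_) (fun x y hx hy => ?_) y
    · simp only [BC.tmul_eq, LinearMap.map_smulₛₗ, BC.push_ι, ← hl, RingHom.comp_apply]
    · simp only [map_add, hx, hy]
  refine BC.induction (P := fun x => BC.push p hp (M.tauExt g hg x) =
    M.tauExt h hh (BC.push p hp x)) (fun b m => ?_) (fun x y hx hy => ?_) x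
  · simp only [BC.tmul_eq, LinearMap.map_smulₛₗ, BC.push_ι, RingHom.id_apply]
    rw [tauExt, tauExt, BC.desc_ι, BC.desc_ι]
    exact congrArg (p b • ·) (key _)
  · simp only [map_add, hx, hy]

theorem push_sigExt {g : (Rint K)⟦X⟧ →+* B} {s : B →+* B} (hs : s.comp g = g.comp (sigma K F))
    {h : (Rint K)⟦X⟧ →+* C} {t : C →+* C} (ht : t.comp h = h.comp (sigma K F)) (p : B →+* C)
    (hp : p.comp g = h) (hst : p.comp s = t.comp p) (x : BC g M.carrier) :
    BC.push p hp (M.sigExt hs x) = M.sigExt ht (BC.push p hp x) := by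
  refine BC.induction (P := fun x => BC.push p hp (M.sigExt hs x) =
    M.sigExt ht (BC.push p hp x)) (fun b m => ?_) (fun x y hx hy => ?_) x
  · simp only [BC.tmul_eq, LinearMap.map_smulₛₗ, BC.push_ι]
    rw [sigExt, sigExt, BC.desc_ι, BC.desc_ι, ← RingHom.comp_apply p s, hst]
    exact congrArg ((t.comp p) b • ·) (BC.push_ι _ _ _)
  · simp only [map_add, hx, hy]

theorem push_mem_invariants {g : (Rint K)⟦X⟧ →+* B} {hg : IsUnit (g ζ.zSub)} {s : B →+* B}
    {hs : s.comp g = g.comp (sigma K F)} {h : (Rint K)⟦X⟧ →+* C} {hh : IsUnit (h ζ.zSub)}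
    {t : C →+* C} {ht : t.comp h = h.comp (sigma K F)} (p : B →+* C) (hp : p.comp g = h)
    (hst : p.comp s = t.comp p) {x : BC g M.carrier} (hx : x ∈ M.invariants g hg hs) :
    BC.push p hp x ∈ M.invariants h hh ht := by
  rw [mem_invariants] at hx ⊢
  rw [← M.push_sigExt hs ht p hp hst, ← M.push_tauExt hg hh, hx]

end Base

/-! #### The `ε`-adic realization -/

/-- The (dual) Tate module `Ť M = {m ∈ M ⊗ K^sep⟦z⟧ : τ (σ̂^* m) = m}`. -/
def Tate : AddSubgroup (BC (psSep K) M.carrier) :=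
  M.invariants (psSep K) (isUnit_psSep_zSub ζ) (sigmaSep_comp F)

/-- The rational (dual) Tate module, the `ε`-adic realization
`H_ε(M, Q_ε) = {m ∈ M ⊗ K^sep((z)) : τ (σ̂^* m) = m}`. -/
def RatTate : AddSubgroup (BC (bSep K) M.carrier) :=
  M.invariants (bSep K) (isUnit_bSep_zSub ζ) (sigmaSepL_comp F)

/-- `H_ε(M, Q_ε)` is a vector space over `Q_ε = F((z)) ⊆ K^sep((z))`. -/
instance : Module F⸨X⸩ M.RatTate where
  smul c x := ⟨constSep K F c • (x : BC (bSep K) M.carrier),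
    M.smul_mem_invariants (sigmaSepL_constSep F c) x.2⟩
  one_smul x := Subtype.ext <| by
    change constSep K F 1 • (x : BC (bSep K) M.carrier) = x
    rw [map_one, one_smul]
  mul_smul c d x := Subtype.ext <| by
    change constSep K F (c * d) • (x : BC (bSep K) M.carrier) = constSep K F c •
      constSep K F d • (x : BC (bSep K) M.carrier)
    rw [map_mul, mul_smul]
  smul_zero c := Subtype.ext (smul_zero (constSep K F c))
  smul_add c x y := Subtype.ext (smul_add (constSep K F c) (x : BC (bSep K) M.carrier) y)
  add_smul c d x := Subtype.ext <| by
    change constSep K F (c + d) • (x : BC (bSep K) M.carrier) =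
      constSep K F c • (x : BC (bSep K) M.carrier) + constSep K F d • (x : BC (bSep K) M.carrier)
    rw [map_add, add_smul]
  zero_smul x := Subtype.ext <|
    (congrArg (· • (x : BC (bSep K) M.carrier)) (map_zero (constSep K F))).trans
      (zero_smul (Ksep K)⸨X⸩ (x : BC (bSep K) M.carrier))

theorem coe_smul_ratTate (c : F⸨X⸩) (x : M.RatTate) :
    ((c • x : M.RatTate) : BC (bSep K) M.carrier) = constSep K F c • (x : BC (bSep K) M.carrier) :=
  rfl

/-- The inclusion `Ť M → H_ε(M, Q_ε)`. -/
def tateToRat (t : M.Tate) : M.RatTate :=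
  ⟨BC.push (ofPS (Ksep K)) ofPS_comp_psSep (t : BC (psSep K) M.carrier),
    M.push_mem_invariants _ _ (laurentMap_comp_ofPS (frobSep K F)).symm t.2⟩

/-- The action of the Galois group on `H_ε(M, Q_ε)`, through its action on `K^sep((z))`. -/
def galRat (g : Ksep K ≃ₐ[K] Ksep K) : M.RatTate →ₗ[F⸨X⸩] M.RatTate where
  toFun x := ⟨BC.push (laurentMap (galSep g))
      (by rw [bSep, ← RingHom.comp_assoc, laurentMap_comp, galSep_comp])
      (x : BC (bSep K) M.carrier),
    M.push_mem_invariants _ _ (by rw [sigmaSepL, laurentMap_comp, laurentMap_comp,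
      galSep_comp_frobSep]) x.2⟩
  map_add' x y := Subtype.ext (map_add _ (x : BC (bSep K) M.carrier) y)
  map_smul' c x := Subtype.ext <| by
    change BC.push (laurentMap (galSep g)) _ (constSep K F c • (x : BC (bSep K) M.carrier)) =
      constSep K F c • BC.push (laurentMap (galSep g)) _ (x : BC (bSep K) M.carrier)
    rw [LinearMap.map_smulₛₗ]
    congr 1
    change ((laurentMap (galSep g)).comp (laurentMap _)) c = _
    rw [laurentMap_comp, ← RingHom.comp_assoc, galSep_comp]
    rfl

/-- `H_ε(M, Q_ε) ⊗_{Q_ε} K̄((z - ζ))`. -/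
abbrev EpsBar : Type _ := BC (constBar F ζ) M.RatTate

/-- The Galois group acts on both factors of `H_ε(M, Q_ε) ⊗_{Q_ε} K̄((z - ζ))`, by
`v ⊗ f ↦ g v ⊗ g f`. -/
def galEpsBar (g : Ksep K ≃ₐ[K] Ksep K) : M.EpsBar →ₛₗ[laurentMap (galBar g)] M.EpsBar :=
  BC.desc (laurentMap (galBar g)) (galBar_comp_constBar F g ζ)
    ((BC.ι (constBar F ζ)).comp (M.galRat g))

/-! #### The de Rham realization -/

/-- The de Rham realization `H_dR(M, K((z - ζ))) = σ̂^* M ⊗_{R⟦z⟧} K((z - ζ))`. -/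
abbrev DR : Type _ := BC (bdR ζ) M.sig

/-- The Hodge-Pink lattice `𝔮 = τ⁻¹ (M ⊗_{R⟦z⟧} K⟦z - ζ⟧) ⊆ H_dR(M, K((z - ζ)))`. -/
def hodgePink : Set M.DR :=
  M.tauExt (bdR ζ) (isUnit_bdR_zSub ζ) ⁻¹'
    Set.range (BC.push (ofPS K) (ofPS_comp_psDR ζ) : BC (psDR ζ) M.carrier → BC (bdR ζ) M.carrier)

/-- `H_dR(M, K((z - ζ))) ⊗_{K((z - ζ))} K̄((z - ζ))`. -/
abbrev DRBar : Type _ := BC (toBarL K) M.DR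

/-- The Galois group acts only on the second factor of
`H_dR(M, K((z - ζ))) ⊗_{K((z - ζ))} K̄((z - ζ))`. -/
def galDRBar (g : Ksep K ≃ₐ[K] Ksep K) : M.DRBar →ₛₗ[laurentMap (galBar g)] M.DRBar :=
  BC.push (laurentMap (galBar g)) (galBar_comp_toBarL g)

/-- The de Rham realization `H_dR(M, K) = σ̂^* M ⊗_{R⟦z⟧, z ↦ ζ} K`. -/
abbrev DRK : Type _ := BC (evalDR ζ) M.sig

/-- The Galois action on the second factor of `H_dR(M, K) ⊗_K K̄`. -/
def galDRKBar (g : Ksep K ≃ₐ[K] Ksep K) :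
    BC (toBar K) M.DRK →ₛₗ[galBar g] BC (toBar K) M.DRK :=
  BC.push (galBar g) (galBar_comp_toBar g)

/-- The base change `H_dR(M, K((z - ζ))) ⊗ K̄((z - ζ)) → M ⊗_{R⟦z⟧} K̄((z - ζ))` of `τ`. -/
def tauBar : M.DRBar →ₗ[(Kbar K)⸨X⸩] BC (bdRbar ζ) M.carrier :=
  BC.desc (RingHom.id _) (RingHom.id_comp (toBarL K))
    ({ toFun := fun x => BC.push (toBarL K) (toBarL_comp_bdR ζ) (M.tauExt (bdR ζ) (isUnit_bdR_zSub ζ) x)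
       map_add' := by simp
       map_smul' := fun a x => by rw [map_smul, LinearMap.map_smulₛₗ] } :
      M.DR →ₛₗ[toBarL K] BC (bdRbar ζ) M.carrier)

/-! #### The lattices over `K̄⟦z - ζ⟧` -/

/-- `H_ε(M, Q_ε) ⊗_{Q_ε} K̄⟦z - ζ⟧`, as a submodule of `H_ε(M, Q_ε) ⊗_{Q_ε} K̄((z - ζ))`. -/
def ratLattice : Submodule (Kbar K)⟦X⟧ M.EpsBar :=
  Submodule.span (Kbar K)⟦X⟧ (Set.range (BC.ι (constBar F ζ) : M.RatTate → M.EpsBar))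

/-- `Ť M ⊗_{A_ε} K̄⟦z - ζ⟧`, as a submodule of `H_ε(M, Q_ε) ⊗_{Q_ε} K̄((z - ζ))`. -/
def tateLattice : Submodule (Kbar K)⟦X⟧ M.EpsBar :=
  Submodule.span (Kbar K)⟦X⟧
    (Set.range fun t : M.Tate => (BC.ι (constBar F ζ) (M.tateToRat t) : M.EpsBar))

/-- `𝔮 ⊗_{K⟦z - ζ⟧} K̄⟦z - ζ⟧`, as a submodule of
`H_dR(M, K((z - ζ))) ⊗_{K((z - ζ))} K̄((z - ζ))`. -/
def hodgePinkBar : Submodule (Kbar K)⟦X⟧ M.DRBar :=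
  Submodule.span (Kbar K)⟦X⟧ ((BC.ι (toBarL K) : M.DR → M.DRBar) '' M.hodgePink)

/-! #### Convergent elements -/

/-- `M ⊗_{R⟦z⟧} K^sep⟨z/ζ⟩`. -/
abbrev Conv : Type _ := BC (tateSep ζ) M.carrier

/-- The map `M ⊗ K^sep⟨z/ζ⟩ → M ⊗ K^sep⟦z⟧` given by the inclusion `K^sep⟨z/ζ⟩ ⊆ K^sep⟦z⟧`. -/
def convToSep : M.Conv →ₛₗ[(LocSht.Tate (Ksep K) ‖ζ.val‖).subtype] BC (psSep K) M.carrier :=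
  BC.push _ (tateSep_comp ζ)

/-- The expansion map `M ⊗ K^sep⟨z/ζ⟩ → M ⊗ K̄((z - ζ))` given by `z ↦ ζ + (z - ζ)`. -/
def convExpand : M.Conv →ₛₗ[(ofPS (Kbar K)).comp (tateDR ζ)] BC (bdRbar ζ) M.carrier :=
  BC.push _ (ofPS_comp_tateDR_comp ζ)

/-! #### Quasi-morphisms -/

section Base

variable {M N}
variable {B : Type*} [CommRing B] {C : Type*} [CommRing C]

/-- The extension `M ⊗ B → N ⊗ B` of an `R((z))`-linear map `f : M[1/z] → N[1/z]` to an
`R((z))`-algebra `B`. -/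
def homExt (f : BC (ofPS (Rint K)) M.carrier →ₗ[(Rint K)⸨X⸩] BC (ofPS (Rint K)) N.carrier)
    {g : (Rint K)⟦X⟧ →+* B} (p : (Rint K)⸨X⸩ →+* B) (hp : p.comp (ofPS (Rint K)) = g) :
    BC g M.carrier →ₗ[B] BC g N.carrier :=
  BC.desc (RingHom.id B) (RingHom.id_comp g)
    ({ toFun := fun m => BC.push p hp (f (BC.ι _ m))
       map_add' := by simp
       map_smul' := fun a m => by
        rw [LinearMap.map_smulₛₗ, map_smul, LinearMap.map_smulₛₗ, ← RingHom.comp_apply, hp] } :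
      M.carrier →ₛₗ[g] BC g N.carrier)

/-- The natural map `N[1/z] → σ̂^* N ⊗ B`, `n ⊗ a ↦ σ̂^* n ⊗ p (σ̂ a)`. -/
def sigLaurent (N : LocalShtuka.{u, v, w} F ζ) {g : (Rint K)⟦X⟧ →+* B} (p : (Rint K)⸨X⸩ →+* B)
    (hp : p.comp (ofPS (Rint K)) = g) :
    BC (ofPS (Rint K)) N.carrier →ₛₗ[p.comp (sigmaL K F)] BC g N.sig :=
  BC.desc (h := g.comp (sigma K F)) (p.comp (sigmaL K F))
    (by rw [RingHom.comp_assoc, sigmaL_comp, ← RingHom.comp_assoc, hp])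
    ({ toFun := fun m => BC.ι g (BC.ι (sigma K F) m)
       map_add' := by simp
       map_smul' := fun a m => by
        rw [LinearMap.map_smulₛₗ, LinearMap.map_smulₛₗ, RingHom.comp_apply] } :
      N.carrier →ₛₗ[g.comp (sigma K F)] BC g N.sig)

/-- The extension `σ̂^* M ⊗ B → σ̂^* N ⊗ B` of the pullback `σ̂^* f` of an `R((z))`-linear map
`f : M[1/z] → N[1/z]` to an `R((z))`-algebra `B`. -/
def sigHomExt (f : BC (ofPS (Rint K)) M.carrier →ₗ[(Rint K)⸨X⸩] BC (ofPS (Rint K)) N.carrier)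
    {g : (Rint K)⟦X⟧ →+* B} (p : (Rint K)⸨X⸩ →+* B) (hp : p.comp (ofPS (Rint K)) = g) :
    BC g M.sig →ₗ[B] BC g N.sig :=
  BC.desc (RingHom.id B) (RingHom.id_comp g)
    (BC.desc g rfl
      ({ toFun := fun m => N.sigLaurent p hp (f (BC.ι _ m))
         map_add' := by simp
         map_smul' := fun a m => by
          rw [LinearMap.map_smulₛₗ, map_smul, LinearMap.map_smulₛₗ, ← RingHom.comp_apply,
            RingHom.comp_assoc, sigmaL_comp, ← RingHom.comp_assoc, hp] } :
        M.carrier →ₛₗ[g.comp (sigma K F)] BC g N.sig))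

end Base

variable (ζ) in
/-- The ring `R((z))[1/(z - ζ)]`. -/
abbrev RLloc : Type u := Localization.Away (ofPS (Rint K) ζ.zSub)

variable (ζ) in
/-- The homomorphism `R⟦z⟧ → R((z))[1/(z - ζ)]`. -/
def toRLloc : (Rint K)⟦X⟧ →+* RLloc ζ :=
  (algebraMap (Rint K)⸨X⸩ (RLloc ζ)).comp (ofPS (Rint K))

variable (ζ) in
theorem algebraMap_RLloc_comp :
    (algebraMap (Rint K)⸨X⸩ (RLloc ζ)).comp (ofPS (Rint K)) = toRLloc ζ := rfl

variable (ζ) in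
theorem isUnit_toRLloc : IsUnit (toRLloc ζ ζ.zSub) :=
  IsLocalization.Away.algebraMap_isUnit (ofPS (Rint K) ζ.zSub)

/-- A quasi-morphism of local shtukas: an `R((z))`-linear map `f : M[1/z] → N[1/z]` with
`τ_N ∘ σ̂^* f = f ∘ τ_M` over `R((z))[1/(z - ζ)]`. -/
structure QuasiHom where
  /-- the underlying linear map -/
  toLin : BC (ofPS (Rint K)) M.carrier →ₗ[(Rint K)⸨X⸩] BC (ofPS (Rint K)) N.carrier
  comm : N.tauExt (toRLloc ζ) (isUnit_toRLloc ζ) ∘ₗ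
      sigHomExt toLin (algebraMap (Rint K)⸨X⸩ (RLloc ζ)) (algebraMap_RLloc_comp ζ) =
    homExt toLin (algebraMap (Rint K)⸨X⸩ (RLloc ζ)) (algebraMap_RLloc_comp ζ) ∘ₗ
      M.tauExt (toRLloc ζ) (isUnit_toRLloc ζ)

namespace QuasiHom

variable {M N}
variable {B : Type*} [CommRing B] {C : Type*} [CommRing C]

theorem push_homExt
    (f : BC (ofPS (Rint K)) M.carrier →ₗ[(Rint K)⸨X⸩] BC (ofPS (Rint K)) N.carrier)
    {g : (Rint K)⟦X⟧ →+* B} {p : (Rint K)⸨X⸩ →+* B} (hp : p.comp (ofPS (Rint K)) = g)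
    {h : (Rint K)⟦X⟧ →+* C} {p' : (Rint K)⸨X⸩ →+* C} (hp' : p'.comp (ofPS (Rint K)) = h)
    (q : B →+* C) (hq : q.comp g = h) (hqp : q.comp p = p') (x : BC g M.carrier) :
    BC.push q hq (homExt f p hp x) = homExt f p' hp' (BC.push q hq x) := by
  have key : ∀ y : BC (ofPS (Rint K)) N.carrier,
      BC.push q hq (BC.push p hp y) = BC.push p' hp' y := by
    intro y
    refine BC.induction (P := fun y => BC.push q hq (BC.push p hp y) = BC.push p' hp' y)
      (fun b m => ?_) (fun x y hx hy => ?_) y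
    · simp only [BC.tmul_eq, LinearMap.map_smulₛₗ, BC.push_ι, ← hqp, RingHom.comp_apply]
    · simp only [map_add, hx, hy]
  refine BC.induction (P := fun x => BC.push q hq (homExt f p hp x) =
    homExt f p' hp' (BC.push q hq x)) (fun b m => ?_) (fun x y hx hy => ?_) x
  · simp only [BC.tmul_eq, LinearMap.map_smulₛₗ, BC.push_ι, RingHom.id_apply]
    rw [homExt, homExt, BC.desc_ι, BC.desc_ι]
    exact congrArg (q b • ·) (key _)
  · simp only [map_add, hx, hy]

theorem push_sigLaurent (N : LocalShtuka.{u, v, w} F ζ)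
    {g : (Rint K)⟦X⟧ →+* B} {p : (Rint K)⸨X⸩ →+* B} (hp : p.comp (ofPS (Rint K)) = g)
    {h : (Rint K)⟦X⟧ →+* C} {p' : (Rint K)⸨X⸩ →+* C} (hp' : p'.comp (ofPS (Rint K)) = h)
    (q : B →+* C) (hq : q.comp g = h) (hqp : q.comp p = p') (y : BC (ofPS (Rint K)) N.carrier) :
    BC.push q hq (N.sigLaurent p hp y) = N.sigLaurent p' hp' y := by
  subst hqp
  refine BC.induction (P := fun y => BC.push q hq (N.sigLaurent p hp y) =
    N.sigLaurent (q.comp p) hp' y) (fun b m => ?_) (fun x y hx hy => ?_) y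
  · simp only [BC.tmul_eq, LinearMap.map_smulₛₗ]
    rw [sigLaurent, sigLaurent, BC.desc_ι, BC.desc_ι]
    exact congrArg (q (p (sigmaL K F b)) • ·) (BC.push_ι q hq _)
  · simp only [map_add, hx, hy]

theorem push_sigHomExt
    (f : BC (ofPS (Rint K)) M.carrier →ₗ[(Rint K)⸨X⸩] BC (ofPS (Rint K)) N.carrier)
    {g : (Rint K)⟦X⟧ →+* B} {p : (Rint K)⸨X⸩ →+* B} (hp : p.comp (ofPS (Rint K)) = g)
    {h : (Rint K)⟦X⟧ →+* C} {p' : (Rint K)⸨X⸩ →+* C} (hp' : p'.comp (ofPS (Rint K)) = h)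
    (q : B →+* C) (hq : q.comp g = h) (hqp : q.comp p = p') (x : BC g M.sig) :
    BC.push q hq (sigHomExt f p hp x) = sigHomExt f p' hp' (BC.push q hq x) := by
  refine BC.induction (P := fun x => BC.push q hq (sigHomExt f p hp x) =
    sigHomExt f p' hp' (BC.push q hq x)) (fun b n => ?_) (fun x y hx hy => ?_) x
  · simp only [BC.tmul_eq, LinearMap.map_smulₛₗ, BC.push_ι, RingHom.id_apply]
    congr 1
    rw [sigHomExt, sigHomExt, BC.desc_ι, BC.desc_ι]
    refine BC.induction (P := fun n => BC.push q hq (BC.desc g rfl _ n) = BC.desc h rfl _ n)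
      (fun a m => ?_) (fun x y hx hy => ?_) n
    · simp only [BC.tmul_eq, LinearMap.map_smulₛₗ, BC.desc_ι]
      rw [← RingHom.comp_apply, hq]
      exact congrArg (h a • ·) (push_sigLaurent N hp hp' q hq hqp _)
    · simp only [map_add, hx, hy]
  · simp only [map_add, hx, hy]

/-- The relation `τ_N ∘ σ̂^* f = f ∘ τ_M` holds over every `R((z))[1/(z - ζ)]`-algebra. -/
theorem comm_ext (f : QuasiHom M N) {g : (Rint K)⟦X⟧ →+* B} (hg : IsUnit (g ζ.zSub))
    (p : (Rint K)⸨X⸩ →+* B) (hp : p.comp (ofPS (Rint K)) = g) (x : BC g M.sig) :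
    N.tauExt g hg (sigHomExt f.toLin p hp x) = homExt f.toLin p hp (M.tauExt g hg x) := by
  have hu : IsUnit (p (ofPS (Rint K) ζ.zSub)) := by rw [← hp] at hg; exact hg
  have hq : (IsLocalization.Away.lift (S := RLloc ζ) (ofPS (Rint K) ζ.zSub) hu).comp
      (algebraMap (Rint K)⸨X⸩ (RLloc ζ)) = p := IsLocalization.Away.lift_comp _ hu
  have hq' : (IsLocalization.Away.lift (S := RLloc ζ) (ofPS (Rint K) ζ.zSub) hu).comp
      (toRLloc ζ) = g := by rw [toRLloc, ← RingHom.comp_assoc, hq, hp]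
  refine BC.induction (P := fun x => N.tauExt g hg (sigHomExt f.toLin p hp x) =
    homExt f.toLin p hp (M.tauExt g hg x)) (fun b n => ?_) (fun x y hx hy => ?_) x
  · simp only [BC.tmul_eq, LinearMap.map_smulₛₗ, RingHom.id_apply]
    congr 1
    have h := congrArg (BC.push _ hq') (LinearMap.congr_fun f.comm (BC.ι (toRLloc ζ) n))
    simp only [LinearMap.comp_apply] at h
    rw [N.push_tauExt (isUnit_toRLloc ζ) hg, push_sigHomExt f.toLin (algebraMap_RLloc_comp ζ) hp _ hq' hq,
      push_homExt f.toLin (algebraMap_RLloc_comp ζ) hp _ hq' hq, M.push_tauExt (isUnit_toRLloc ζ) hg, BC.push_ι] at h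
    exact h
  · simp only [map_add, hx, hy]

theorem sigExt_homExt
    (f : BC (ofPS (Rint K)) M.carrier →ₗ[(Rint K)⸨X⸩] BC (ofPS (Rint K)) N.carrier)
    {g : (Rint K)⟦X⟧ →+* B} {p : (Rint K)⸨X⸩ →+* B} (hp : p.comp (ofPS (Rint K)) = g)
    {s : B →+* B} (hs : s.comp g = g.comp (sigma K F)) (hsp : s.comp p = p.comp (sigmaL K F))
    (x : BC g M.carrier) :
    N.sigExt hs (homExt f p hp x) = sigHomExt f p hp (M.sigExt hs x) := by
  have key : ∀ y : BC (ofPS (Rint K)) N.carrier,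
      N.sigExt hs (BC.push p hp y) = N.sigLaurent p hp y := by
    intro y
    refine BC.induction (P := fun y => N.sigExt hs (BC.push p hp y) = N.sigLaurent p hp y)
      (fun b m => ?_) (fun x y hx hy => ?_) y
    · simp only [BC.tmul_eq, LinearMap.map_smulₛₗ, BC.push_ι]
      rw [sigLaurent, sigExt, BC.desc_ι, BC.desc_ι]
      exact congrArg (· • _) (RingHom.congr_fun hsp b)
    · simp only [map_add, hx, hy]
  refine BC.induction (P := fun x => N.sigExt hs (homExt f p hp x) =
    sigHomExt f p hp (M.sigExt hs x)) (fun b m => ?_) (fun x y hx hy => ?_) x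
  · simp only [BC.tmul_eq, LinearMap.map_smulₛₗ, RingHom.id_apply]
    congr 1
    rw [homExt, BC.desc_ι, sigHomExt]
    refine (key _).trans ?_
    refine Eq.trans ?_ (congrArg _ (BC.desc_ι s hs _ m).symm)
    refine Eq.trans ?_ (BC.desc_ι (RingHom.id B) _ _ _).symm
    refine Eq.trans ?_ (BC.desc_ι g rfl _ m).symm
    rfl
  · simp only [map_add, hx, hy]

/-- The map `H_ε(f) : H_ε(M, Q_ε) → H_ε(N, Q_ε)` induced by a quasi-morphism. -/
def ratMap (f : QuasiHom M N) : M.RatTate →ₗ[F⸨X⸩] N.RatTate where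
  toFun x := ⟨homExt f.toLin (laurentSep K) laurentSep_comp (x : BC (bSep K) M.carrier), by
    have hx := M.mem_invariants.1 x.2
    refine N.mem_invariants.2 ?_
    rw [sigExt_homExt f.toLin laurentSep_comp _ (sigmaSepL_comp_laurentSep F), f.comm_ext, hx]⟩
  map_add' x y := Subtype.ext (map_add _ (x : BC (bSep K) M.carrier) y)
  map_smul' c x := Subtype.ext (map_smul _ (constSep K F c) (x : BC (bSep K) M.carrier))

/-- The map `H_dR(f) : H_dR(M, K((z - ζ))) → H_dR(N, K((z - ζ)))` induced by a quasi-morphism. -/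
def dRMap (f : QuasiHom M N) : M.DR →ₗ[K⸨X⸩] N.DR :=
  sigHomExt f.toLin (laurentDR ζ) (laurentDR_comp ζ)

end QuasiHom

end LocalShtuka

end Shtukas

end LocSht
end

/-!
The comparison isomorphism is `h = τ⁻¹ ∘ (z ↦ ζ + (z - ζ))`, evaluated on the Tate module. After the
choice of a basis of `M`, everything is expressed by the matrix `T` of `τ`.

*Trivialization.* Over `K^sep⟦z⟧` the element `z - ζ` is a unit, so `T` is invertible, and Lang's
theorem (`span_fixed_eq_top`, `exists_powerSeries_mul_frob_eq`) provides an invertible `Y` with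
`T σ̂(Y) = Y`. Its columns are a basis of `Ť M`. Some power of `z - ζ` makes `T⁻¹` integral, so `Y`
satisfies `(z - ζ)ᵉ σ̂(Y) = S Y` with `S` integral. This bounds the `q̂`-th power of the `n`-th
coefficient linearly by the coefficients up to `n`, which forces convergence for `|z| ≤ |ζ|`
(`mem_Tate_of_sub_pow_mul_frob_eq`). The inverse of `Y` satisfies the transposed equation for `T⁻¹`,
so the same estimate applies to it. Hence `Y` is invertible over `K^sep⟨z/ζ⟩`, and its expansion at
`z = ζ` is invertible over `K̄⟦z - ζ⟧`. This gives both the isomorphism and the comparison of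
lattices.

*Functoriality and Galois equivariance.* The expansion is a partially defined ring homomorphism from
`K^sep((z))` to `K̄((z - ζ))` with domain `K^sep⟨z/ζ⟩[1/z]`; its graph `expansionGraph` is a subring
which contains the images of `R((z))` and `F((z))` and is stable under the Galois group. The
coordinates of `v` and of `τ(h(v ⊗ 1))` correspond under this graph, and this property characterizes
`h`; so `h` is compatible with matrices over `R((z))` and with the Galois group.

*Invariants.* In a finite Galois extension, an element of trace `1` can be replaced by its
`pⁿ`-th root, over the perfect closure, whose norm is as close to `1` as necessary. Averaging
against such an element moves an almost invariant `α` into the perfect closure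
(`exists_mem_perfectClosure_norm_sub_le`), and density of `K^alg` in `K̄` gives the invariants of
`K̄`. Those of `K̄((z - ζ))` follow coefficientwise. If `K` is not perfect, a `p`-th root of an
element that is not a `p`-th power is an invariant scalar outside `K`, which separates the de Rham
realizations from the Galois invariants.
-/

noncomputable section

namespace LocSht

set_option linter.unusedSectionVars false

/-! ### Lang's theorem for `GL_n` over a separably closed field -/

section Lang

open Polynomial

variable (F : Type*) [Field F] [Fintype F] {L : Type*} [Field L] [Algebra F L]

variable (L) in
/-- The `q`-Frobenius `x ↦ x ^ q` of an `F`-algebra `L`, where `q = #F`. -/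
abbrev frob : L →+* L := (FiniteField.frobeniusAlgHom F L : L →+* L)

theorem frob_apply (x : L) : frob F L x = x ^ Fintype.card F := rfl

/-- Artin-Schreier equations are solvable: `X ^ q - X - a` is separable. -/
theorem exists_frob_sub_eq [IsSepClosed L] (a : L) : ∃ y : L, frob F L y - y = a := by
  have hq : (Fintype.card F : L) = 0 := by
    rw [← map_natCast (algebraMap F L), FiniteField.cast_card_eq_zero, map_zero]
  have hd : (X ^ Fintype.card F - X - C a : L[X]).natDegree = Fintype.card F := by
    have := Fintype.one_lt_card (α := F)
    compute_degree!
    · rw [if_neg (by omega)]; simp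
    · omega
  have hs : (X ^ Fintype.card F - X - C a : L[X]).Separable := by
    rw [separable_def]
    have : derivative (X ^ Fintype.card F - X - C a : L[X]) = -1 := by
      simp [derivative_X_pow, hq]
    rw [this]
    exact isCoprime_one_right.neg_right
  obtain ⟨y, hy⟩ := IsSepClosed.exists_root _
    (fun h => by rw [natDegree_eq_of_degree_eq_some h] at hd; exact Fintype.card_ne_zero hd.symm) hs
  refine ⟨y, ?_⟩
  simpa [frob_apply, sub_eq_zero] using hy

/-- A polynomial `g ∈ X² L[X]` with vanishing derivative has a nonzero fixed point, because
`g - X` is separable. -/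
theorem exists_ne_zero_eval_eq_self [IsSepClosed L] {g : L[X]} (h0 : g ≠ 0) (hX : X ^ 2 ∣ g)
    (hg : derivative g = 0) : ∃ y : L, y ≠ 0 ∧ g.eval y = y := by
  obtain ⟨k, rfl⟩ := hX
  have hk : k ≠ 0 := by rintro rfl; simp at h0
  have hs : (X * (X * k - 1) : L[X]).Separable := by
    have h1 : (X * (X * k - 1) : L[X]) = X ^ 2 * k - X := by ring
    rw [h1, separable_def, derivative_sub, hg, derivative_X, zero_sub]
    exact isCoprime_one_right.neg_right
  have hd : (X * k - 1 : L[X]).degree ≠ 0 := by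
    have h2 : (X * k).degree = k.degree + 1 := by rw [mul_comm, degree_mul_X]
    have h3 : (0 : WithBot ℕ) < (X * k).degree := by
      rw [h2, degree_eq_natDegree hk]; exact_mod_cast Nat.succ_pos _
    rw [sub_eq_add_neg, degree_add_eq_left_of_degree_lt (by rwa [degree_neg, degree_one])]
    exact h3.ne'
  obtain ⟨y, hy⟩ := IsSepClosed.exists_root _ hd hs.of_mul_right
  have hy' : y * k.eval y = 1 := by simpa [sub_eq_zero] using hy
  refine ⟨y, by rintro rfl; simp at hy', ?_⟩
  rw [eval_mul, eval_pow, eval_X, pow_two, mul_assoc, hy', mul_one]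

variable (L) in
/-- The polynomials `g₀ = 0`, `gᵢ₊₁ = gᵢ^q + cᵢ X^q`: if `φⁿ v = ∑ cᵢ φⁱ v` for a Frobenius
semilinear map `φ`, a fixed point `y` of `gₙ` gives the `φ`-fixed vector `∑ gᵢ₊₁(y) φⁱ v`. -/
def cyclicPoly (c : ℕ → L) : ℕ → L[X]
  | 0 => 0
  | i + 1 => cyclicPoly c i ^ Fintype.card F + C (c i) * X ^ Fintype.card F

theorem X_pow_dvd_cyclicPoly (c : ℕ → L) (n : ℕ) :
    X ^ Fintype.card F ∣ cyclicPoly F L c n := by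
  induction n with
  | zero => exact dvd_zero _
  | succ n ih =>
    refine dvd_add (ih.trans (dvd_pow_self _ Fintype.card_ne_zero)) (dvd_mul_left _ _)

theorem derivative_cyclicPoly (c : ℕ → L) (n : ℕ) : derivative (cyclicPoly F L c n) = 0 := by
  have hq : (Fintype.card F : L) = 0 := by
    rw [← map_natCast (algebraMap F L), FiniteField.cast_card_eq_zero, map_zero]
  cases n with
  | zero => simp [cyclicPoly]
  | succ n => simp [cyclicPoly, derivative_pow, hq]

theorem eq_zero_of_cyclicPoly_eq_zero {c : ℕ → L} {n : ℕ} (h : cyclicPoly F L c n = 0) :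
    ∀ i < n, c i = 0 := by
  induction n with
  | zero => intro i hi; omega
  | succ n ih =>
    have hq := Fintype.one_lt_card (α := F)
    obtain ⟨k, hk⟩ := X_pow_dvd_cyclicPoly F c n
    have hc : c n = 0 := by
      have h1 := congrArg (coeff · (Fintype.card F)) h
      have h2 : coeff (cyclicPoly F L c n ^ Fintype.card F) (Fintype.card F) = 0 := by
        rw [hk, mul_pow, ← pow_mul, coeff_X_pow_mul', if_neg]
        nlinarith
      simpa [cyclicPoly, h2] using h1
    have h0 : cyclicPoly F L c n = 0 := by
      refine pow_eq_zero_iff (Fintype.card_ne_zero (α := F)) |>.1 ?_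
      simpa [cyclicPoly, hc] using h
    intro i hi
    rcases Nat.lt_succ_iff_lt_or_eq.1 hi with hi | rfl
    · exact ih h0 i hi
    · exact hc

variable {V : Type*} [AddCommGroup V] [Module L V]

/-- `φ - 1` maps the span of the fixed vectors of `φ` onto itself, by Artin-Schreier equations for
the coefficients. -/
theorem exists_sub_eq_of_mem_span_fixed [IsSepClosed L] (φ : V →ₛₗ[frob F L] V) {w : V}
    (hw : w ∈ Submodule.span L {x | φ x = x}) :
    ∃ u ∈ Submodule.span L {x | φ x = x}, φ u - u = w := by
  induction hw using Submodule.closure_induction with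
  | zero => exact ⟨0, zero_mem _, by simp⟩
  | add x y _ _ hx hy =>
    obtain ⟨u, hu, rfl⟩ := hx
    obtain ⟨v, hv, rfl⟩ := hy
    exact ⟨u + v, add_mem hu hv, by rw [map_add]; abel⟩
  | smul_mem a x hx =>
    obtain ⟨y, hy⟩ := exists_frob_sub_eq F a
    refine ⟨y • x, Submodule.smul_mem _ _ (Submodule.subset_span hx), ?_⟩
    rw [LinearMap.map_smulₛₗ, show φ x = x from hx, ← sub_smul, hy]

/-- Lang's theorem: the fixed vectors of a Frobenius semilinear map span, provided that the map is
nondegenerate (`hφ`). For `v` outside the span `W` of the fixed vectors, some cyclic relation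
`φⁿ v ∈ W + ⟨v, …, φⁿ⁻¹ v⟩` yields a vector outside `W` which is fixed modulo `W`; a correction in
`W` makes it fixed, a contradiction. -/
theorem span_fixed_eq_top [IsSepClosed L] [FiniteDimensional L V] (φ : V →ₛₗ[frob F L] V)
    (hφ : ∀ x, φ x ∈ Submodule.span L {x | φ x = x} → x ∈ Submodule.span L {x | φ x = x}) :
    Submodule.span L {x | φ x = x} = ⊤ := by
  set W := Submodule.span L {x | φ x = x} with hW
  by_contra hne
  obtain ⟨v, -, hv⟩ := SetLike.exists_of_lt (lt_top_iff_ne_top.2 hne)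
  let a : ℕ → V := fun i => φ^[i] v
  have ha : ∀ i, φ (a i) = a (i + 1) := fun i => (Function.iterate_succ_apply' φ i v).symm
  have haW : ∀ i, a i ∉ W := by
    intro i
    induction i with
    | zero => exact hv
    | succ i ih => exact fun h => ih (hφ _ (by rwa [ha]))
  let S : ℕ → Submodule L V := fun n => W ⊔ Submodule.span L (a '' (Finset.range n : Finset ℕ))
  have hS : Monotone S := fun m n h => sup_le_sup_left (Submodule.span_mono
    (Set.image_mono (by exact_mod_cast Finset.range_mono h))) _
  have haS : ∀ {i n}, i < n → a i ∈ S n := fun h =>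
    Submodule.mem_sup_right (Submodule.subset_span ⟨_, by simpa using h, rfl⟩)
  have hex : ∃ n, a n ∈ S n := by
    obtain ⟨n, hn⟩ := monotone_stabilizes_iff_noetherian.2 (inferInstance : IsNoetherian L V)
      ⟨S, hS⟩
    refine ⟨n, ?_⟩
    have h1 : S n = S (n + 1) := hn (n + 1) (Nat.le_succ n)
    rw [h1]
    exact haS (Nat.lt_succ_self n)
  classical
  obtain ⟨n, hn, hmin⟩ : ∃ n, a n ∈ S n ∧ ∀ m < n, a m ∉ S m :=
    ⟨Nat.find hex, Nat.find_spec hex, fun m hm => Nat.find_min hex hm⟩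
  obtain ⟨n, rfl⟩ : ∃ k, n = k + 1 := by
    refine Nat.exists_eq_succ_of_ne_zero ?_
    rintro rfl
    exact haW 0 (by simpa [S] using hn)
  -- the first cyclic relation; its coefficients do not all vanish since `φⁿ⁺¹ v ∉ W`
  obtain ⟨w, hw, s, hs, hws⟩ := Submodule.mem_sup.1 hn
  obtain ⟨c, rfl⟩ : ∃ c : ℕ → L, ∑ i ∈ Finset.range (n + 1), c i • a i = s := by
    obtain ⟨c, hc⟩ := (Submodule.mem_span_image_finset_iff_exists_fun L).1 hs
    refine ⟨fun i => if h : i ∈ Finset.range (n + 1) then c ⟨i, h⟩ else 0, ?_⟩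
    rw [← hc, ← Finset.sum_coe_sort]
    exact Finset.sum_congr rfl fun i _ => congrArg (· • a i) (dif_pos i.2)
  have hc0 : cyclicPoly F L c (n + 1) ≠ 0 := by
    intro h
    refine haW (n + 1) ?_
    rw [← hws, Finset.sum_eq_zero, add_zero]
    · exact hw
    · intro i hi
      rw [eq_zero_of_cyclicPoly_eq_zero F h i (Finset.mem_range.1 hi), zero_smul]
  obtain ⟨y, hy0, hy⟩ := exists_ne_zero_eval_eq_self hc0
    ((pow_dvd_pow X Fintype.one_lt_card).trans (X_pow_dvd_cyclicPoly F c _))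
    (derivative_cyclicPoly F c _)
  let e : ℕ → L := fun i => (cyclicPoly F L c i).eval y
  have he : ∀ i, e (i + 1) = e i ^ Fintype.card F + c i * y ^ Fintype.card F := fun i => by
    simp [e, cyclicPoly]
  have he0 : e 0 = 0 := by simp [e, cyclicPoly]
  have hen : e (n + 1) = y := hy
  set x : V := ∑ i ∈ Finset.range (n + 1), e (i + 1) • a i with hx
  -- the coefficient of `φⁿ v` in `x` is `y ≠ 0`, and `n + 1` is minimal
  have hxW : x ∉ W := by
    intro h
    refine hmin n (Nat.lt_succ_self n) ?_
    rw [hx, Finset.sum_range_succ, hen] at h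
    have h1 : ∑ i ∈ Finset.range n, e (i + 1) • a i ∈ S n :=
      Submodule.sum_mem _ fun i hi => Submodule.smul_mem _ _ (haS (Finset.mem_range.1 hi))
    have h2 : y • a n ∈ S n :=
      ((S n).add_mem_iff_right h1).1 (Submodule.mem_sup_left h)
    exact ((S n).smul_mem_iff hy0).1 h2
  have hφx : φ x - x = y ^ Fintype.card F • w := by
    have h1 : φ x = ∑ i ∈ Finset.range (n + 1), e i ^ Fintype.card F • a i +
        y ^ Fintype.card F • a (n + 1) := by
      rw [hx, map_sum]
      simp only [LinearMap.map_smulₛₗ, ha, frob_apply]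
      rw [Finset.sum_range_succ, hen, Finset.sum_range_succ' (fun i => e i ^ Fintype.card F • a i),
        he0, zero_pow Fintype.card_ne_zero, zero_smul, add_zero]
    rw [h1, hx, ← hws, smul_add, Finset.smul_sum]
    simp only [he, add_smul, Finset.sum_add_distrib, smul_smul]
    simp only [mul_comm]
    abel
  obtain ⟨u, hu, hu'⟩ := exists_sub_eq_of_mem_span_fixed F φ (W.smul_mem (y ^ Fintype.card F) hw)
  refine hxW ?_
  have h3 : x - u ∈ W := Submodule.subset_span (by
    change φ (x - u) = x - u
    rw [map_sub, ← sub_eq_zero]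
    calc φ x - φ u - (x - u) = (φ x - x) - (φ u - u) := by abel
      _ = 0 := by rw [hφx, hu', sub_self])
  simpa using add_mem h3 hu

variable {I : Type*} [Fintype I] [DecidableEq I]

/-- Lang's theorem in matrix form. The semilinear map `x ↦ P σ(x)` is nondegenerate: if a linear
form `f` kills all fixed vectors, then so does `x ↦ σ(f)(P⁻¹ x)`, and the latter takes the value
`σ(f(v))` at `P σ(v)`. -/
theorem exists_matrix_mul_frob_eq [IsSepClosed L] {P : Matrix I I L} (hP : IsUnit P) :
    ∃ X : Matrix I I L, IsUnit X ∧ P * X.map (frob F L) = X := by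
  let φ : (I → L) →ₛₗ[frob F L] (I → L) :=
    { toFun := fun x => P.mulVec (frob F L ∘ x)
      map_add' := fun x y => by
        rw [← Matrix.mulVec_add]; congr 1; ext i; exact map_add _ _ _
      map_smul' := fun a x => by
        rw [← Matrix.mulVec_smul]; congr 1; ext i; exact map_mul _ _ _ }
  have hφ : ∀ x, φ x = P.mulVec (frob F L ∘ x) := fun _ => rfl
  have hdet := (Matrix.isUnit_iff_isUnit_det P).1 hP
  have htop := span_fixed_eq_top F φ (by
    intro v hv
    by_contra hvW
    obtain ⟨f, hfv, hf⟩ := Submodule.exists_le_ker_of_notMem hvW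
    have hsum : ∀ x, f x = ∑ i, x i * f (Pi.single i 1) := fun x => by
      conv_lhs => rw [pi_eq_sum_univ' x, map_sum]
      refine Finset.sum_congr rfl fun i _ => ?_
      rw [map_smul, smul_eq_mul]
    let G : (I → L) →ₗ[L] L :=
      (∑ i, frob F L (f (Pi.single i 1)) • LinearMap.proj i) ∘ₗ Matrix.mulVecLin P⁻¹
    have hG : ∀ x, G (φ x) = frob F L (f x) := fun x => by
      simp only [G, LinearMap.comp_apply, Matrix.mulVecLin_apply, hφ, Matrix.mulVec_mulVec,
        Matrix.nonsing_inv_mul _ hdet, Matrix.one_mulVec, LinearMap.sum_apply, LinearMap.smul_apply,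
        LinearMap.proj_apply, smul_eq_mul, Function.comp_apply]
      rw [hsum x, map_sum]
      refine Finset.sum_congr rfl fun i _ => ?_
      rw [map_mul, mul_comm]
    have hker : Submodule.span L {x | φ x = x} ≤ LinearMap.ker G := by
      refine Submodule.span_le.2 fun x hx => ?_
      have h0 : f x = 0 := hf (Submodule.subset_span hx)
      have h1 := hG x
      rw [show φ x = x from hx, h0, map_zero] at h1
      exact h1
    have h2 : G (φ v) = 0 := hker hv
    rw [hG] at h2
    exact hfv ((map_eq_zero _).1 h2))
  obtain ⟨s, hs, hspan, hli⟩ := exists_linearIndependent L {x | φ x = x}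
  let b : Module.Basis s L (I → L) := Module.Basis.mk hli (by
    rw [Subtype.range_coe, hspan, htop])
  let e := b.indexEquiv (Pi.basisFun L I)
  let b' := b.reindex e
  have hb' : ∀ i, φ (b' i) = b' i := fun i => by
    have : b' i = (e.symm i : I → L) := by simp [b', b]
    rw [this]
    exact hs (e.symm i).2
  refine ⟨(Pi.basisFun L I).toMatrix b', ?_, ?_⟩
  · have := (Pi.basisFun L I).invertibleToMatrix b'
    exact isUnit_of_invertible _
  · ext i j
    have := congrFun (hb' j) i
    rw [hφ] at this
    exact this

end Lang

/-! ### Frobenius equations over power series rings -/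

section PowerSeriesLang

variable (F : Type*) [Field F] [Fintype F] {L : Type*} [Field L] [Algebra F L]
variable {I : Type*} [Fintype I] [DecidableEq I]

/-- The sequence with `y n = step n (y 0, …, y (n - 1))`. -/
def recSeq {α : Type*} (step : (n : ℕ) → (Fin n → α) → α) (n : ℕ) : α :=
  step n fun b => recSeq step b
termination_by n
decreasing_by exact b.2

theorem recSeq_eq {α : Type*} (step : (n : ℕ) → (Fin n → α) → α) (n : ℕ) :
    recSeq step n = step n fun b => recSeq step b := by
  rw [recSeq]

/-- If `P ≡ 1` modulo `z`, the equation `P σ(Y) = Y` is solved coefficient by coefficient with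
`Y ≡ 1` modulo `z`: the `n`-th coefficient satisfies an Artin-Schreier equation. -/
theorem exists_mul_frob_eq_of_one [IsSepClosed L] {P : Matrix I I L⟦X⟧}
    (hP : P.map PowerSeries.constantCoeff = 1) :
    ∃ Y : Matrix I I L⟦X⟧, IsUnit Y ∧ P * Y.map (PowerSeries.map (frob F L)) = Y := by
  have hg : ∀ A : Matrix I I L, ∃ B : Matrix I I L, B.map (frob F L) + A = B := by
    intro A
    choose y hy using fun i j => exists_frob_sub_eq F (-A i j)
    refine ⟨Matrix.of y, ?_⟩
    ext i j
    have := hy i j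
    simp only [Matrix.add_apply, Matrix.map_apply, Matrix.of_apply]
    linear_combination this
  choose g hg using hg
  let c : ℕ → Matrix I I L := fun n => P.map (PowerSeries.coeff n)
  let step : (n : ℕ) → (Fin n → Matrix I I L) → Matrix I I L := fun n f =>
    if n = 0 then 1 else g (∑ b : Fin n, c (n - b) * (f b).map (frob F L))
  let y := recSeq step
  have hc0 : c 0 = 1 := by
    rw [← hP]; ext i j; simp [c]
  have hy0 : y 0 = 1 := (recSeq_eq step 0).trans (if_pos rfl)
  have hy : ∀ n, ∑ b ∈ Finset.range (n + 1), c (n - b) * (y b).map (frob F L) = y n := by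
    intro n
    rw [Finset.sum_range_succ, Nat.sub_self, hc0, one_mul, add_comm]
    rcases Nat.eq_zero_or_pos n with rfl | hn
    · simp [hy0]
    · have h1 : y n = g (∑ b : Fin n, c (n - b) * (y b).map (frob F L)) :=
        (recSeq_eq step n).trans (if_neg hn.ne')
      rw [Fin.sum_univ_eq_sum_range (fun b => c (n - b) * (y b).map (frob F L))] at h1
      rw [h1]
      exact hg _
  let Y : Matrix I I L⟦X⟧ := Matrix.of fun i j => PowerSeries.mk fun n => y n i j
  refine ⟨Y, ?_, ?_⟩
  · rw [Matrix.isUnit_iff_isUnit_det, PowerSeries.isUnit_iff_constantCoeff, RingHom.map_det]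
    have : PowerSeries.constantCoeff.mapMatrix Y = 1 := by
      rw [← hy0]; ext i j; simp [Y, ← PowerSeries.coeff_zero_eq_constantCoeff_apply]
    rw [this]
    simp
  · ext i j n
    have h2 := congrFun (congrFun (hy n) i) j
    rw [← Finset.Nat.sum_antidiagonal_eq_sum_range_succ (fun b a => c a * (y b).map (frob F L)) n,
      ← Finset.Nat.sum_antidiagonal_swap] at h2
    simp only [Matrix.mul_apply, map_sum, PowerSeries.coeff_mul]
    rw [Finset.sum_comm]
    simp only [Matrix.sum_apply, Matrix.mul_apply, Prod.fst_swap, Prod.snd_swap] at h2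
    simpa [Y, c] using h2

/-- Lang's theorem over `L⟦z⟧`. -/
theorem exists_powerSeries_mul_frob_eq [IsSepClosed L] {P : Matrix I I L⟦X⟧} (hP : IsUnit P) :
    ∃ Y : Matrix I I L⟦X⟧, IsUnit Y ∧ P * Y.map (PowerSeries.map (frob F L)) = Y := by
  let c := (PowerSeries.constantCoeff (R := L)).mapMatrix (m := I)
  let C := (PowerSeries.C (R := L)).mapMatrix (m := I)
  let σ := (PowerSeries.map (frob F L)).mapMatrix (m := I)
  have hcC : ∀ A, c (C A) = A := fun A => by ext i j; simp [c, C]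
  have hcσ : ∀ A, c (σ A) = (c A).map (frob F L) := fun A => by
    ext i j
    simp only [c, σ, RingHom.mapMatrix_apply, Matrix.map_apply]
    rw [← PowerSeries.coeff_zero_eq_constantCoeff_apply, PowerSeries.coeff_map,
      PowerSeries.coeff_zero_eq_constantCoeff_apply]
  obtain ⟨U, hUu, h⟩ := exists_matrix_mul_frob_eq F (hP.map c)
  obtain ⟨W, hUW, hWU⟩ := isUnit_iff_exists.1 hUu
  obtain ⟨Y, hYu, hY⟩ := exists_mul_frob_eq_of_one F (P := C W * P * σ (C U)) (by
    change c _ = 1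
    rw [map_mul, map_mul, hcσ, hcC, hcC, mul_assoc, h, hWU])
  refine ⟨C U * Y, (hUu.map C).mul hYu, ?_⟩
  change P * σ (C U * Y) = _
  change C W * P * σ (C U) * σ Y = Y at hY
  conv_rhs => rw [← hY]
  rw [map_mul]
  simp only [← mul_assoc]
  rw [← map_mul C, hUW, map_one, one_mul]

end PowerSeriesLang

/-! ### Convergence of Frobenius-invariant power series -/

section Convergence

theorem norm_sub_le_max_norm {G : Type*} [SeminormedAddCommGroup G] [IsUltrametricDist G]
    (x y : G) : ‖x - y‖ ≤ max ‖x‖ ‖y‖ := by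
  simpa [sub_eq_add_neg] using IsUltrametricDist.norm_add_le_max x (-y)

variable {L : Type*} [NormedField L] [IsUltrametricDist L] {ζ : L}

/-- Division by `z - ζ` loses at most a factor `|ζ|⁻¹` in the Gauss norm of radius `|ζ|` of
truncated power series. -/
theorem norm_coeff_le_of_sub_mul {y : L⟦X⟧} {V : ℝ} {n : ℕ}
    (h : ∀ i ≤ n, ‖ζ‖ ^ i * ‖PowerSeries.coeff i ((PowerSeries.X - PowerSeries.C ζ) * y)‖ ≤ V) :
    ∀ i ≤ n, ‖ζ‖ ^ (i + 1) * ‖PowerSeries.coeff i y‖ ≤ V := by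
  intro i
  induction i with
  | zero =>
    intro hi
    have := h 0 hi
    simpa [sub_mul] using this
  | succ i ih =>
    intro hi
    have h2 := h (i + 1) hi
    have h3 := ih (Nat.le_of_succ_le hi)
    have h4 : ζ * PowerSeries.coeff (i + 1) y = PowerSeries.coeff i y -
        PowerSeries.coeff (i + 1) ((PowerSeries.X - PowerSeries.C ζ) * y) := by
      rw [sub_mul, map_sub, PowerSeries.coeff_succ_X_mul, PowerSeries.coeff_C_mul]; ring
    rw [pow_succ, mul_assoc, ← norm_mul, h4]
    rcases le_max_iff.1 (norm_sub_le_max_norm (PowerSeries.coeff i y)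
      (PowerSeries.coeff (i + 1) ((PowerSeries.X - PowerSeries.C ζ) * y))) with h5 | h5
    · exact (mul_le_mul_of_nonneg_left h5 (by positivity)).trans h3
    · exact (mul_le_mul_of_nonneg_left h5 (by positivity)).trans h2

theorem norm_coeff_le_of_sub_pow_mul (h0 : ζ ≠ 0) (e : ℕ) {y : L⟦X⟧} {V : ℝ} {n : ℕ}
    (h : ∀ i ≤ n,
      ‖ζ‖ ^ i * ‖PowerSeries.coeff i ((PowerSeries.X - PowerSeries.C ζ) ^ e * y)‖ ≤ V) :
    ∀ i ≤ n, ‖ζ‖ ^ i * ‖PowerSeries.coeff i y‖ ≤ (‖ζ‖⁻¹) ^ e * V := by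
  have hpos := norm_pos_iff.2 h0
  induction e generalizing V with
  | zero => simpa using h
  | succ e ih =>
    rw [pow_succ, mul_assoc]
    refine ih fun i hi => ?_
    have h2 := norm_coeff_le_of_sub_mul
      (y := (PowerSeries.X - PowerSeries.C ζ) ^ e * y) (V := V) (n := n)
      (by simpa only [pow_succ', mul_assoc] using h) i hi
    rw [inv_mul_eq_div, le_div_iff₀ hpos]
    refine le_trans (le_of_eq ?_) h2
    ring

variable (F : Type*) [Field F] [Fintype F] [Algebra F L]
variable {I : Type*} [Fintype I]

/-- Solutions of `(z - ζ)ᵉ σ(x) = S x` with integral `S` lie in `L⟨z/ζ⟩`. With `uₙ = |ζ|ⁿ |xₙ|` and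
`D = |ζ|⁻ᵉ`, the equation gives `uₙ^q ≤ D |ζ|^{(q - 1) n} max_{i ≤ n} uᵢ`; hence `uₙ` is bounded
by `D`, and then it tends to `0`. -/
theorem mem_Tate_of_sub_pow_mul_frob_eq (h0 : ζ ≠ 0) (h1 : ‖ζ‖ < 1) (e : ℕ) (x : I → L⟦X⟧)
    (S : I → I → L⟦X⟧) (hS : ∀ i j n, ‖PowerSeries.coeff n (S i j)‖ ≤ 1)
    (h : ∀ i, (PowerSeries.X - PowerSeries.C ζ) ^ e * PowerSeries.map (frob F L) (x i) =
      ∑ j, S i j * x j) (i : I) : x i ∈ Tate L ‖ζ‖ := by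
  set c := ‖ζ‖ with hc
  have hpos : 0 < c := norm_pos_iff.2 h0
  have hq : 1 < Fintype.card F := Fintype.one_lt_card
  set q := Fintype.card F with hqdef
  set D : ℝ := (c⁻¹) ^ e with hD
  have hD1 : 1 ≤ D := one_le_pow₀ ((one_le_inv₀ hpos).2 h1.le)
  let u : I → ℕ → ℝ := fun i n => c ^ n * ‖PowerSeries.coeff n (x i)‖
  have hu0 : ∀ i n, 0 ≤ u i n := fun i n => by positivity
  have key : ∀ (n : ℕ) (V : ℝ), 0 ≤ V → (∀ j, ∀ i ≤ n, u j i ≤ V) →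
      ∀ j, u j n ^ q ≤ c ^ ((q - 1) * n) * (D * V) := by
    intro n V hV hb j
    have h2 : ∀ i ≤ n, c ^ i * ‖PowerSeries.coeff i
        ((PowerSeries.X - PowerSeries.C ζ) ^ e * PowerSeries.map (frob F L) (x j))‖ ≤ V := by
      intro i hi
      rw [h j, map_sum]
      have h3 : ∀ k ∈ Finset.univ, ‖PowerSeries.coeff i (S j k * x k)‖ ≤ V / c ^ i := by
        intro k _
        rw [PowerSeries.coeff_mul]
        refine IsUltrametricDist.norm_sum_le_of_forall_le_of_nonneg (by positivity) fun p hp => ?_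
        rw [norm_mul]
        refine (mul_le_of_le_one_left (norm_nonneg _) (hS _ _ _)).trans ?_
        have hpi : p.2 ≤ i := Finset.HasAntidiagonal.antidiagonal.snd_le hp
        rw [le_div_iff₀ (by positivity), mul_comm]
        exact (mul_le_mul_of_nonneg_right (pow_le_pow_of_le_one hpos.le h1.le hpi)
          (norm_nonneg _)).trans (hb k p.2 (hpi.trans hi))
      have h4 := IsUltrametricDist.norm_sum_le_of_forall_le_of_nonneg (by positivity) h3
      rw [le_div_iff₀ (by positivity)] at h4
      linarith
    have h5 := norm_coeff_le_of_sub_pow_mul h0 e h2 n le_rfl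
    rw [PowerSeries.coeff_map, frob_apply, norm_pow] at h5
    have h6 : u j n ^ q = c ^ ((q - 1) * n) * (c ^ n * ‖PowerSeries.coeff n (x j)‖ ^ q) := by
      rw [mul_pow, ← pow_mul, ← mul_assoc, ← pow_add]
      congr 2
      rw [mul_comm n q, ← Nat.succ_mul]
      congr 1
      omega
    rw [h6]
    exact mul_le_mul_of_nonneg_left h5 (by positivity)
  -- if `D < u` for the first index `n`, the maximal such `u` satisfies `u² ≤ u^q ≤ D u`
  have hbound : ∀ n, ∀ j, u j n ≤ D := by
    intro n
    induction n using Nat.strong_induction_on with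
    | _ n ih =>
      by_contra! hcon
      obtain ⟨j₀, hj₀⟩ := hcon
      obtain ⟨j, -, hj⟩ := Finset.exists_max_image Finset.univ (u · n) ⟨j₀, Finset.mem_univ _⟩
      have hjD : D < u j n := hj₀.trans_le (hj j₀ (Finset.mem_univ _))
      have h7 := key n (u j n) (hu0 _ _) (fun k i hi => by
        rcases hi.lt_or_eq with hi | rfl
        · exact (ih i hi k).trans hjD.le
        · exact hj k (Finset.mem_univ _)) j
      have h8 : u j n ^ q ≤ D * u j n :=
        h7.trans (mul_le_of_le_one_left (mul_nonneg (by linarith) (hu0 _ _))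
          (pow_le_one₀ hpos.le h1.le))
      have h9 : u j n ^ 2 ≤ u j n ^ q := pow_le_pow_right₀ (by linarith) hq
      nlinarith
  rw [mem_Tate]
  have h11 : Filter.Tendsto (fun n => u i n ^ q) Filter.atTop (𝓝 0) := by
    have h12 := (tendsto_pow_atTop_nhds_zero_of_lt_one hpos.le h1).mul_const (D * D)
    rw [zero_mul] at h12
    refine squeeze_zero (fun n => pow_nonneg (hu0 _ _) _) (fun n => ?_) h12
    refine (key n D (by linarith) (fun j i _ => hbound i j) i).trans ?_
    refine mul_le_mul_of_nonneg_right (pow_le_pow_of_le_one hpos.le h1.le ?_) (by nlinarith)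
    exact Nat.le_mul_of_pos_left n (by omega)
  -- extraction of `q`-th roots
  have h13 := h11.rpow_const (p := (q : ℝ)⁻¹) (Or.inr (by positivity))
  rw [Real.zero_rpow (by positivity)] at h13
  refine h13.congr fun n => ?_
  rw [Real.pow_rpow_inv_natCast (hu0 _ _) (by omega)]
  exact mul_comm _ _

/-- A Frobenius matrix `P` over `L⟦z⟧` which, together with its inverse `Q`, becomes integral after
multiplication by a power of `z - ζ`, is trivialized by a matrix that is invertible over
`L⟨z/ζ⟩`: the inverse of a solution of `P σ(Y) = Y` satisfies the transposed equation for `Q`. -/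
theorem exists_Tate_mul_frob_eq [IsSepClosed L] [DecidableEq I] (h0 : ζ ≠ 0) (h1 : ‖ζ‖ < 1)
    {P Q : Matrix I I L⟦X⟧} (hPQ : P * Q = 1) {d e : ℕ}
    (hP : ∀ i j n, ‖PowerSeries.coeff n ((PowerSeries.X - PowerSeries.C ζ) ^ d * P i j)‖ ≤ 1)
    (hQ : ∀ i j n, ‖PowerSeries.coeff n ((PowerSeries.X - PowerSeries.C ζ) ^ e * Q i j)‖ ≤ 1) :
    ∃ Y Z : Matrix I I L⟦X⟧, Y * Z = 1 ∧ (∀ i j, Y i j ∈ Tate L ‖ζ‖) ∧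
      (∀ i j, Z i j ∈ Tate L ‖ζ‖) ∧ P * Y.map (PowerSeries.map (frob F L)) = Y := by
  have hQP : Q * P = 1 := mul_eq_one_comm.1 hPQ
  obtain ⟨U, hUu, hY⟩ := exists_powerSeries_mul_frob_eq F
    (P := P) ⟨⟨P, Q, hPQ, hQP⟩, rfl⟩
  obtain ⟨W, hUW, hWU⟩ := isUnit_iff_exists.1 hUu
  let σ := (PowerSeries.map (frob F L)).mapMatrix (m := I)
  have hσU : σ U * σ W = 1 := by rw [← map_mul, hUW, map_one]
  have hY' : σ U = Q * U := by
    conv_rhs => rw [← hY, ← mul_assoc, hQP, one_mul]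
    rfl
  have hZ' : σ W = W * P := by
    calc σ W = W * U * σ W := by rw [hWU, one_mul]
      _ = W * (P * σ U) * σ W := by rw [show P * σ U = U from hY]
      _ = W * P := by simp only [mul_assoc, hσU, mul_one]
  refine ⟨U, W, hUW, fun i j => ?_, fun i j => ?_, hY⟩
  · refine mem_Tate_of_sub_pow_mul_frob_eq F h0 h1 e (fun i => U i j)
      (fun i j => (PowerSeries.X - PowerSeries.C ζ) ^ e * Q i j) hQ (fun i => ?_) i
    have := congrFun (congrFun hY' i) j
    rw [Matrix.mul_apply] at this
    simp only [mul_assoc, ← Finset.mul_sum, ← this]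
    rfl
  · refine mem_Tate_of_sub_pow_mul_frob_eq F h0 h1 d (fun j => W i j)
      (fun i j => (PowerSeries.X - PowerSeries.C ζ) ^ d * P j i) (fun i j => hP j i)
      (fun j => ?_) j
    have := congrFun (congrFun hZ' i) j
    rw [Matrix.mul_apply] at this
    simp only [mul_assoc, ← Finset.mul_sum]
    congr 1
    exact this.trans (Finset.sum_congr rfl fun k _ => mul_comm _ _)

end Convergence

/-! ### Galois invariants of the completed algebraic closure -/

section GaloisInvariants

variable {K : Type u} [NontriviallyNormedField K] [CompleteSpace K] [IsUltrametricDist K]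

theorem norm_galAlg (g : Ksep K ≃ₐ[K] Ksep K) (x : AlgebraicClosure K) : ‖galAlg g x‖ = ‖x‖ :=
  (spectralNorm_eq_of_equiv (K := K) (galAlg g) x).symm

theorem continuous_galBar (g : Ksep K ≃ₐ[K] Ksep K) : Continuous (galBar g) :=
  Completion.continuous_map

theorem norm_algToBar (x : AlgebraicClosure K) : ‖algToBar K x‖ = ‖x‖ :=
  Completion.norm_coe x

theorem norm_galBar (g : Ksep K ≃ₐ[K] Ksep K) (x : Kbar K) : ‖galBar g x‖ = ‖x‖ := by
  induction x using Completion.induction_on with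
  | hp => exact isClosed_eq (continuous_norm.comp (continuous_galBar g)) continuous_norm
  | ih a =>
    change ‖galBar g (algToBar K a)‖ = ‖algToBar K a‖
    rw [galBar_algToBar, norm_algToBar, norm_algToBar, norm_galAlg]

theorem galAlg_eq_self_of_mem_perfectClosure (g : Ksep K ≃ₐ[K] Ksep K) {x : AlgebraicClosure K}
    (hx : x ∈ perfectClosure K (AlgebraicClosure K)) : galAlg g x = x := by
  obtain ⟨p, hp⟩ := ExpChar.exists K
  have : ExpChar (AlgebraicClosure K) p := expChar_of_injective_algebraMap
    (algebraMap K (AlgebraicClosure K)).injective p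
  obtain ⟨n, y, hy⟩ := (mem_perfectClosure_iff_pow_mem p).1 hx
  apply iterateFrobenius_inj (AlgebraicClosure K) p n
  rw [iterateFrobenius_def, iterateFrobenius_def, ← map_pow, ← hy]
  exact (galAlg g).commutes y

/-- An approximation theorem of Ax type in positive characteristic `p`: if all conjugates of `α`
have distance at most `ε` from `α`, then `α` has distance at most `2 ε` from the perfect closure.

For `L / K` finite Galois containing `β = α^{pⁿ}` and `c ∈ L` of trace `1`, the `pⁿ`-th root `a` of
`Tr(c β) ∈ K` satisfies `(a - α)^{pⁿ} = ∑ s(c) (s(β) - β)`, so that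
`|a - α| ≤ |c|^{1/pⁿ} ε`, and `n` can be taken as large as necessary. -/
theorem exists_mem_perfectClosure_norm_sub_le (p : ℕ) [hp : Fact p.Prime] [CharP K p]
    (α : AlgebraicClosure K) {ε : ℝ} (hε : 0 ≤ ε)
    (h : ∀ g : Ksep K ≃ₐ[K] Ksep K, ‖galAlg g α - α‖ ≤ ε) :
    ∃ a ∈ perfectClosure K (AlgebraicClosure K), ‖a - α‖ ≤ 2 * ε := by
  have : ExpChar K p := ExpChar.prime hp.out
  have : CharP (AlgebraicClosure K) p := charP_of_injective_algebraMap
    (algebraMap K (AlgebraicClosure K)).injective p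
  have : ExpChar (AlgebraicClosure K) p := ExpChar.prime hp.out
  have : ExpChar (Ksep K) p := expChar_of_injective_algebraMap
    (algebraMap K (Ksep K)).injective p
  obtain ⟨m, β₀, hβ₀⟩ := IsPurelyInseparable.pow_mem (Ksep K) p α
  let E := IntermediateField.adjoin K {β₀}
  have hfin : FiniteDimensional K E :=
    IntermediateField.adjoin.finiteDimensional (Algebra.IsIntegral.isIntegral β₀)
  let L := IntermediateField.normalClosure K E (Ksep K)
  have : IsGalois K L := ⟨⟩
  have hβL : β₀ ∈ L := by
    have h1 : E ≤ L := IntermediateField.le_normalClosure E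
    exact h1 (IntermediateField.mem_adjoin_simple_self K β₀)
  let i : L →+* AlgebraicClosure K := (algebraMap (Ksep K) _).comp (algebraMap L (Ksep K))
  have hiK : ∀ x : K, i (algebraMap K L x) = algebraMap K (AlgebraicClosure K) x := fun x => rfl
  obtain ⟨c, hc⟩ := Algebra.trace_surjective K L 1
  obtain ⟨N, hN⟩ := pow_unbounded_of_one_lt ‖i c‖ (one_lt_two (α := ℝ))
  let n := m + N
  have hcn : ‖i c‖ ≤ 2 ^ p ^ n := hN.le.trans (pow_le_pow_right₀ one_le_two
    ((Nat.le_add_left N m).trans (Nat.lt_pow_self hp.out.one_lt).le))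
  have hpn : p ^ n ≠ 0 := pow_ne_zero _ hp.out.ne_zero
  let β : L := ⟨β₀, hβL⟩ ^ p ^ N
  have hβ : i β = α ^ p ^ n := by
    rw [map_pow, show p ^ n = p ^ m * p ^ N from pow_add _ _ _, pow_mul, ← hβ₀]; rfl
  obtain ⟨a, ha⟩ := IsAlgClosed.exists_pow_nat_eq
    (algebraMap K (AlgebraicClosure K) (Algebra.trace K L (c * β))) (Nat.pos_of_ne_zero hpn)
  refine ⟨a, (mem_perfectClosure_iff_pow_mem p).2 ⟨n, _, ha.symm⟩, ?_⟩
  have hconj : ∀ s : L ≃ₐ[K] L, ∃ g : Ksep K ≃ₐ[K] Ksep K, ∀ x : L, i (s x) = galAlg g (i x) := by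
    intro s
    refine ⟨s.liftNormal (Ksep K), fun x => ?_⟩
    change _ = (s.liftNormal (Ksep K)).liftNormal (AlgebraicClosure K) _
    simp only [i, RingHom.comp_apply]
    rw [AlgEquiv.liftNormal_commutes, AlgEquiv.liftNormal_commutes]
  have hsum : (a - α) ^ p ^ n = ∑ s : L ≃ₐ[K] L, i (s c) * (i (s β) - i β) := by
    rw [sub_pow_expChar_pow, ha, ← hβ, ← hiK, trace_eq_sum_automorphisms, map_sum]
    have h2 : ∑ s : L ≃ₐ[K] L, i (s c) = 1 := by
      rw [← map_sum, ← trace_eq_sum_automorphisms, hc, map_one, map_one]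
    simp only [mul_sub, Finset.sum_sub_distrib, map_mul]
    rw [← Finset.sum_mul, h2, one_mul]
  have hle : ‖(a - α) ^ p ^ n‖ ≤ (2 * ε) ^ p ^ n := by
    rw [hsum]
    refine IsUltrametricDist.norm_sum_le_of_forall_le_of_nonneg (by positivity) fun s _ => ?_
    obtain ⟨g, hg⟩ := hconj s
    rw [norm_mul, mul_pow]
    refine mul_le_mul ?_ ?_ (norm_nonneg _) (by positivity)
    · rwa [hg, norm_galAlg]
    · rw [hg, hβ, map_pow, ← sub_pow_expChar_pow, norm_pow]
      exact pow_le_pow_left₀ (norm_nonneg _) (h g) _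
  rw [norm_pow] at hle
  exact le_of_pow_le_pow_left₀ hpn (by positivity) hle

/-- The invariants of `K̄` are the completed perfect closure of `K`. -/
theorem galBar_invariants_eq_perfCompletion (p : ℕ) [hp : Fact p.Prime] [CharP K p] :
    {x : Kbar K | ∀ g : Ksep K ≃ₐ[K] Ksep K, galBar g x = x} = perfCompletion K := by
  refine Set.Subset.antisymm (fun x hx => ?_) ?_
  · refine Metric.mem_closure_iff.2 fun ε hε => ?_
    obtain ⟨_, ⟨α, rfl⟩, hα⟩ := Metric.mem_closure_iff.1
      (Completion.denseRange_coe (α := AlgebraicClosure K) x) (ε / 4) (by positivity)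
    change dist x (algToBar K α) < _ at hα
    rw [dist_eq_norm] at hα
    obtain ⟨a, ha, hle⟩ := exists_mem_perfectClosure_norm_sub_le p α (ε := ε / 4) (by positivity)
      fun g => by
        rw [← norm_algToBar, map_sub, ← galBar_algToBar]
        have h1 : galBar g (algToBar K α) - algToBar K α =
            (x - algToBar K α) - galBar g (x - algToBar K α) := by
          rw [map_sub, hx g]; ring
        rw [h1]
        exact (norm_sub_le_max_norm _ _).trans (max_le hα.le (by rw [norm_galBar]; exact hα.le))
    refine ⟨_, ⟨a, ha, rfl⟩, ?_⟩
    have h2 : x - algToBar K a = (x - algToBar K α) - algToBar K (a - α) := by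
      rw [map_sub]; ring
    rw [dist_eq_norm, h2]
    refine (norm_sub_le_max_norm _ _).trans_lt (max_lt (hα.trans (by linarith)) ?_)
    rw [norm_algToBar]
    linarith
  · refine closure_minimal ?_ ?_
    · rintro _ ⟨x, hx, rfl⟩ g
      rw [galBar_algToBar, galAlg_eq_self_of_mem_perfectClosure g hx]
    · simp only [Set.ofPred_forall]
      exact isClosed_iInter fun g => isClosed_eq (continuous_galBar g) continuous_id

/-- If `K` is not perfect, then `K̄` contains Galois invariant elements outside `K`. -/
theorem exists_galBar_invariant_notMem_range (p : ℕ) [hp : Fact p.Prime] [CharP K p]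
    (hK : ¬ PerfectField K) :
    ∃ a : Kbar K, (∀ g : Ksep K ≃ₐ[K] Ksep K, galBar g a = a) ∧ a ∉ Set.range (toBar K) := by
  have : ExpChar K p := ExpChar.prime hp.out
  have : CharP (AlgebraicClosure K) p := charP_of_injective_algebraMap
    (algebraMap K (AlgebraicClosure K)).injective p
  have : ExpChar (AlgebraicClosure K) p := ExpChar.prime hp.out
  have h1 : ¬ Function.Surjective (frobenius K p) := fun h => hK <| by
    have := PerfectRing.ofSurjective K p h
    exact PerfectRing.toPerfectField K p
  simp only [Function.Surjective, not_forall] at h1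
  obtain ⟨b, hb⟩ := h1
  obtain ⟨a, ha⟩ := IsAlgClosed.exists_pow_nat_eq (algebraMap K (AlgebraicClosure K) b) hp.out.pos
  refine ⟨algToBar K a, fun g => ?_, ?_⟩
  · rw [galBar_algToBar, galAlg_eq_self_of_mem_perfectClosure g
      ((mem_perfectClosure_iff_pow_mem p).2 ⟨1, b, by rw [pow_one, ha]⟩)]
  · rintro ⟨y, hy⟩
    have h2 : algebraMap K (AlgebraicClosure K) y = a := (algToBar K).injective hy
    refine hb ⟨y, (algebraMap K (AlgebraicClosure K)).injective ?_⟩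
    rw [frobenius_def, map_pow, h2, ha]

end GaloisInvariants

/-! ### Bases of base changes -/

namespace BC

variable {A B C : Type*} [CommRing A] [CommRing B] [CommRing C]
variable {M : Type*} [AddCommGroup M] [Module A M] {I : Type*} [Fintype I]

/-- The coordinates on `M ⊗_{A,f} B` with respect to a basis `b` of `M`. -/
def coord (f : A →+* B) (b : Module.Basis I A M) : BC f M →ₗ[B] (I → B) :=
  desc (RingHom.id B) (RingHom.id_comp f)
    ({ toFun := fun m i => f (b.repr m i)
       map_add' := fun m n => by ext i; simp
       map_smul' := fun a m => by ext i; simp } : M →ₛₗ[f] (I → B))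

theorem coord_ι (f : A →+* B) (b : Module.Basis I A M) (m : M) (i : I) :
    coord f b (ι f m) i = f (b.repr m i) :=
  congrFun (desc_ι _ _ _ m) i

theorem sum_coord_smul (f : A →+* B) (b : Module.Basis I A M) (x : BC f M) :
    ∑ i, coord f b x i • ι f (b i) = x := by
  let ψ : (I → B) →ₗ[B] BC f M := ∑ i, (LinearMap.proj i).smulRight (ι f (b i))
  have hψ : ∀ c, ψ c = ∑ i, c i • ι f (b i) := fun c => by simp [ψ]
  have h : ψ ∘ₗ coord f b = LinearMap.id := by
    refine hom_ext fun m => ?_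
    rw [LinearMap.comp_apply, hψ, LinearMap.id_apply]
    conv_rhs => rw [← b.sum_repr m, map_sum]
    exact Finset.sum_congr rfl fun i _ => by rw [coord_ι, LinearMap.map_smulₛₗ]
  rw [← hψ]
  exact LinearMap.congr_fun h x

/-- The basis `b i ⊗ 1` of `M ⊗_{A,f} B`. -/
def basis (f : A →+* B) (b : Module.Basis I A M) : Module.Basis I B (BC f M) :=
  .ofEquivFun
    { coord f b with
      invFun := fun c => ∑ i, c i • ι f (b i)
      left_inv := sum_coord_smul f b
      right_inv := fun c => by
        classical
        ext i
        change coord f b (∑ j, c j • ι f (b j)) i = c i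
        rw [map_sum, Finset.sum_apply, Finset.sum_eq_single i]
        · rw [map_smul, Pi.smul_apply, coord_ι]; simp
        · intro j _ hj
          rw [map_smul, Pi.smul_apply, coord_ι, b.repr_self, Finsupp.single_eq_of_ne hj.symm,
            map_zero, smul_zero]
        · simp }

theorem basis_repr_ι (f : A →+* B) (b : Module.Basis I A M) (m : M) (i : I) :
    (basis f b).repr (ι f m) i = f (b.repr m i) := coord_ι f b m i

theorem basis_apply (f : A →+* B) (b : Module.Basis I A M) (i : I) :
    basis f b i = ι f (b i) := by
  classical
  refine (basis f b).repr.injective (Finsupp.ext fun j => ?_)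
  rw [Module.Basis.repr_self, basis_repr_ι, Module.Basis.repr_self, Finsupp.single_apply,
    Finsupp.single_apply]
  split_ifs <;> simp

/-- A semilinear map is computed in coordinates by its matrix on a basis. -/
theorem repr_semilinear {N N' J : Type*} [AddCommGroup N] [Module B N] [AddCommGroup N']
    [Module C N'] [Fintype J] {g : B →+* C} (φ : N →ₛₗ[g] N') (n : Module.Basis I B N)
    (n' : Module.Basis J C N') (x : N) (j : J) :
    n'.repr (φ x) j = ∑ i, n'.repr (φ (n i)) j * g (n.repr x i) := by
  conv_lhs => rw [← n.sum_repr x, map_sum, map_sum, Finsupp.finsetSum_apply]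
  refine Finset.sum_congr rfl fun i _ => ?_
  rw [LinearMap.map_smulₛₗ, map_smul, Finsupp.smul_apply, smul_eq_mul, mul_comm]

theorem repr_push {f : A →+* B} {h : A →+* C} (g : B →+* C) (hg : g.comp f = h)
    (b : Module.Basis I A M) (x : BC f M) (i : I) :
    (basis h b).repr (push g hg x) i = g ((basis f b).repr x i) := by
  classical
  rw [repr_semilinear (push g hg) (basis f b)]
  simp only [basis_apply, push_ι, basis_repr_ι, Module.Basis.repr_self]
  rw [Finset.sum_eq_single i]
  · simp
  · intro j _ hj
    simp [Finsupp.single_eq_of_ne hj.symm]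
  · simp

/-- If `a ∈ B` is invariant under the endomorphisms `γ s` but not in the image of `A`, then a
nonzero free `A`-module is strictly smaller than the invariants of its base change to `B`. -/
theorem range_ι_ssubset_invariants [hI : Nonempty I] (f : A →+* B) (b : Module.Basis I A M)
    {G : Type*} (γ : G → B →+* B) (hγ : ∀ s, (γ s).comp f = f) {a : B} (ha : ∀ s, γ s a = a)
    (ha' : a ∉ Set.range f) :
    Set.range (ι f : M → BC f M) ⊂ {x : BC f M | ∀ s, push (γ s) (hγ s) x = x} := by
  refine (Set.ssubset_iff_of_subset ?_).2 ?_
  · rintro _ ⟨m, rfl⟩ s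
    exact push_ι _ _ m
  · obtain ⟨i⟩ := hI
    refine ⟨a • ι f (b i), fun s => ?_, ?_⟩
    · rw [LinearMap.map_smulₛₗ, push_ι, ha]
    · rintro ⟨m, hm⟩
      refine ha' ⟨b.repr m i, ?_⟩
      rw [← basis_repr_ι, hm, map_smul, Finsupp.smul_apply, basis_repr_ι, b.repr_self,
        Finsupp.single_eq_same, map_one, smul_eq_mul, mul_one]

end BC

/-! ### Frobenius matrices -/

namespace LocalShtuka

variable {K : Type u} [NontriviallyNormedField K] [CompleteSpace K] [IsUltrametricDist K]
variable {F : Type w} [Field F] [Fintype F] [Algebra F K] {ζ : PU K}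
variable (M : LocalShtuka.{u, v, w} F ζ)

/-- The index set of the chosen basis of `M`. -/
abbrev Idx : Type v := Module.Free.ChooseBasisIndex (Rint K)⟦X⟧ M.carrier

instance : Fintype M.Idx :=
  inferInstanceAs (Fintype (Module.Free.ChooseBasisIndex (Rint K)⟦X⟧ M.carrier))

instance : DecidableEq M.Idx := Classical.decEq _

/-- The chosen basis of `M`. -/
def base : Module.Basis M.Idx (Rint K)⟦X⟧ M.carrier := Module.Free.chooseBasis _ _

/-- The basis of `σ̂^* M` obtained from the chosen basis of `M`. -/
def sigBase : Module.Basis M.Idx (Rint K)⟦X⟧ M.sig := BC.basis (sigma K F) M.base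

/-- The matrix of `τ` over `R⟦z⟧[1/(z - ζ)]`. -/
def tauMat : Matrix M.Idx M.Idx (Rloc ζ) :=
  LinearMap.toMatrix (BC.basis _ M.sigBase) (BC.basis _ M.base) M.tau.toLinearMap

/-- The matrix of `τ⁻¹` over `R⟦z⟧[1/(z - ζ)]`. -/
def tauInvMat : Matrix M.Idx M.Idx (Rloc ζ) :=
  LinearMap.toMatrix (BC.basis _ M.base) (BC.basis _ M.sigBase) M.tau.symm.toLinearMap

theorem tauMat_mul_tauInvMat : M.tauMat * M.tauInvMat = 1 := by
  rw [tauMat, tauInvMat, ← LinearMap.toMatrix_comp]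
  simp

section Base

variable {B : Type*} [CommRing B] {C : Type*} [CommRing C]

/-- The image of the matrix of `τ` in an `R⟦z⟧`-algebra in which `z - ζ` is invertible. -/
def tauMatExt (g : (Rint K)⟦X⟧ →+* B) (hg : IsUnit (g ζ.zSub)) : Matrix M.Idx M.Idx B :=
  M.tauMat.map (IsLocalization.Away.lift ζ.zSub hg)

/-- The image of the matrix of `τ⁻¹` in an `R⟦z⟧`-algebra in which `z - ζ` is invertible. -/
def tauInvMatExt (g : (Rint K)⟦X⟧ →+* B) (hg : IsUnit (g ζ.zSub)) : Matrix M.Idx M.Idx B :=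
  M.tauInvMat.map (IsLocalization.Away.lift ζ.zSub hg)

theorem tauMatExt_mul_tauInvMatExt (g : (Rint K)⟦X⟧ →+* B) (hg : IsUnit (g ζ.zSub)) :
    M.tauMatExt g hg * M.tauInvMatExt g hg = 1 := by
  rw [tauMatExt, tauInvMatExt, ← Matrix.map_mul, tauMat_mul_tauInvMat]
  simp

theorem tauExt_repr (g : (Rint K)⟦X⟧ →+* B) (hg : IsUnit (g ζ.zSub)) (x : BC g M.sig)
    (i : M.Idx) : (BC.basis g M.base).repr (M.tauExt g hg x) i =
      ∑ j, M.tauMatExt g hg i j * (BC.basis g M.sigBase).repr x j := by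
  rw [BC.repr_semilinear (M.tauExt g hg) (BC.basis g M.sigBase)]
  refine Finset.sum_congr rfl fun j _ => ?_
  rw [RingHom.id_apply]
  congr 1
  rw [BC.basis_apply, tauExt, BC.desc_ι]
  refine (BC.repr_push _ (IsLocalization.Away.lift_comp (S := Rloc ζ) ζ.zSub hg) _ _ _).trans ?_
  rw [tauMatExt, Matrix.map_apply, tauMat, LinearMap.toMatrix_apply, BC.basis_apply]
  rfl

theorem sigExt_repr {g : (Rint K)⟦X⟧ →+* B} {s : B →+* B} (hs : s.comp g = g.comp (sigma K F))
    (x : BC g M.carrier) (i : M.Idx) : (BC.basis g M.sigBase).repr (M.sigExt hs x) i =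
      s ((BC.basis g M.base).repr x i) := by
  rw [BC.repr_semilinear (M.sigExt hs) (BC.basis g M.base), Finset.sum_eq_single i]
  · rw [BC.basis_apply, sigExt, BC.desc_ι]
    change (BC.basis g M.sigBase).repr (BC.ι g (BC.ι (sigma K F) (M.base i))) i * _ = _
    rw [BC.basis_repr_ι, sigBase, BC.basis_repr_ι]
    simp
  · intro j _ hj
    rw [BC.basis_apply, sigExt, BC.desc_ι]
    change (BC.basis g M.sigBase).repr (BC.ι g (BC.ι (sigma K F) (M.base j))) i * _ = _
    rw [BC.basis_repr_ι, sigBase, BC.basis_repr_ι, Module.Basis.repr_self,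
      Finsupp.single_eq_of_ne hj.symm]
    simp
  · simp

theorem mem_invariants_iff_repr {g : (Rint K)⟦X⟧ →+* B} {hg : IsUnit (g ζ.zSub)} {s : B →+* B}
    {hs : s.comp g = g.comp (sigma K F)} {m : BC g M.carrier} :
    m ∈ M.invariants g hg hs ↔ ∀ i, ∑ j, M.tauMatExt g hg i j *
      s ((BC.basis g M.base).repr m j) = (BC.basis g M.base).repr m i := by
  rw [mem_invariants, ← (BC.basis g M.base).repr.injective.eq_iff, Finsupp.ext_iff]
  simp only [tauExt_repr, sigExt_repr]

theorem tauExt_bijective (g : (Rint K)⟦X⟧ →+* B) (hg : IsUnit (g ζ.zSub)) :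
    Function.Bijective (M.tauExt g hg) := by
  have h : LinearMap.toMatrix (BC.basis g M.sigBase) (BC.basis g M.base) (M.tauExt g hg) =
      M.tauMatExt g hg := by
    ext i j
    rw [LinearMap.toMatrix_apply, tauExt_repr, Module.Basis.repr_self]
    simp [Finsupp.single_apply]
  have hu : IsUnit (LinearMap.toMatrix (BC.basis g M.sigBase) (BC.basis g M.base)
      (M.tauExt g hg)).det := by
    rw [h]
    exact (Matrix.isUnit_iff_isUnit_det _).1
      ⟨⟨_, _, M.tauMatExt_mul_tauInvMatExt g hg,
        mul_eq_one_comm.1 (M.tauMatExt_mul_tauInvMatExt g hg)⟩, rfl⟩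
  exact (LinearEquiv.ofIsUnitDet hu).bijective

end Base

/-- Some power of `z - ζ` makes a given matrix over `R⟦z⟧[1/(z - ζ)]` integral. -/
theorem exists_pow_mul_eq_algebraMap {I : Type*} [Finite I] (T : Matrix I I (Rloc ζ)) :
    ∃ (d : ℕ) (T₀ : Matrix I I (Rint K)⟦X⟧), ∀ i j,
      algebraMap (Rint K)⟦X⟧ (Rloc ζ) ζ.zSub ^ d * T i j = algebraMap _ _ (T₀ i j) := by
  obtain ⟨⟨_, d, rfl⟩, h⟩ := IsLocalization.exist_integer_multiples_of_finite
    (Submonoid.powers ζ.zSub) fun p : I × I => T p.1 p.2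
  choose T₀ hT₀ using h
  refine ⟨d, Matrix.of fun i j => T₀ (i, j), fun i j => ?_⟩
  rw [Matrix.of_apply, hT₀, ← map_pow, Algebra.smul_def]

instance : IsSepClosed (Ksep K) :=
  IsSepClosure.sep_closed K

theorem norm_coeff_psSep_le (f : (Rint K)⟦X⟧) (n : ℕ) : ‖PowerSeries.coeff n (psSep K f)‖ ≤ 1 := by
  rw [psSep, PowerSeries.coeff_map]
  exact (norm_toSep K _).le.trans (norm_subtype_le _)

/-- The image of `ζ` in `K^sep`. -/
abbrev zetaSep (ζ : PU K) : Ksep K := algebraMap K (Ksep K) ζ.val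

theorem psSep_zSub : psSep K ζ.zSub = PowerSeries.X - PowerSeries.C (zetaSep ζ) := by
  rw [psSep, PU.zSub, map_sub, PowerSeries.map_X, PowerSeries.map_C]
  rfl

theorem zetaSep_ne_zero : zetaSep ζ ≠ 0 := (map_ne_zero _).2 ζ.ne_zero

theorem norm_zetaSep : ‖zetaSep ζ‖ = ‖ζ.val‖ := norm_toSep K ζ.val

theorem norm_zetaSep_lt_one : ‖zetaSep ζ‖ < 1 := norm_zetaSep.trans_lt ζ.norm_lt_one

theorem exists_norm_coeff_pow_mul_le {I : Type*} [Finite I] (T : Matrix I I (Rloc ζ)) :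
    ∃ d : ℕ, ∀ i j n, ‖PowerSeries.coeff n ((PowerSeries.X - PowerSeries.C (zetaSep ζ)) ^ d *
      T.map (IsLocalization.Away.lift ζ.zSub (isUnit_psSep_zSub ζ)) i j)‖ ≤ 1 := by
  obtain ⟨d, T₀, h⟩ := exists_pow_mul_eq_algebraMap T
  refine ⟨d, fun i j n => ?_⟩
  have h1 := congrArg (IsLocalization.Away.lift ζ.zSub (isUnit_psSep_zSub ζ)) (h i j)
  rw [map_mul, map_pow, IsLocalization.Away.lift_eq, IsLocalization.Away.lift_eq, psSep_zSub] at h1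
  rw [Matrix.map_apply, h1]
  exact norm_coeff_psSep_le _ _

/-- The matrix of `τ` over `K^sep⟦z⟧`. -/
abbrev tauMatSep : Matrix M.Idx M.Idx (Ksep K)⟦X⟧ := M.tauMatExt (psSep K) (isUnit_psSep_zSub ζ)

/-- The matrix of `τ⁻¹` over `K^sep⟦z⟧`. -/
abbrev tauInvMatSep : Matrix M.Idx M.Idx (Ksep K)⟦X⟧ :=
  M.tauInvMatExt (psSep K) (isUnit_psSep_zSub ζ)

/-- The equation `τ(σ̂^* m) = m` has a fundamental matrix `Y` of solutions which is invertible over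
`K^sep⟨z/ζ⟩`; its columns lie in `Ť M`. -/
theorem exists_tateMat : ∃ Y Z : Matrix M.Idx M.Idx (LocSht.Tate (Ksep K) ‖ζ.val‖), Y * Z = 1 ∧
    M.tauMatSep * (Y.map (Subring.subtype _)).map (sigmaSep K F) = Y.map (Subring.subtype _) := by
  obtain ⟨d, hd⟩ := exists_norm_coeff_pow_mul_le M.tauMat
  obtain ⟨e, he⟩ := exists_norm_coeff_pow_mul_le M.tauInvMat
  obtain ⟨Y, Z, hYZ, hY, hZ, h⟩ := exists_Tate_mul_frob_eq F zetaSep_ne_zero norm_zetaSep_lt_one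
    (M.tauMatExt_mul_tauInvMatExt (psSep K) (isUnit_psSep_zSub ζ)) hd he
  rw [norm_zetaSep] at hY hZ
  refine ⟨Matrix.of fun i j => ⟨Y i j, hY i j⟩, Matrix.of fun i j => ⟨Z i j, hZ i j⟩, ?_, h⟩
  have hinj : Function.Injective
      ((Subring.subtype (LocSht.Tate (Ksep K) ‖ζ.val‖)).mapMatrix :
        Matrix M.Idx M.Idx _ →+* Matrix M.Idx M.Idx _) :=
    fun A B hAB => Matrix.ext fun i j => Subtype.ext (congrFun (congrFun hAB i) j)
  apply hinj
  rw [map_mul, map_one]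
  exact hYZ

/-- Elements of `Ť M` have coordinates in `K^sep⟨z/ζ⟩`. -/
theorem repr_mem_Tate (t : M.Tate) (i : M.Idx) :
    (BC.basis (psSep K) M.base).repr t i ∈ LocSht.Tate (Ksep K) ‖ζ.val‖ := by
  obtain ⟨e, he⟩ := exists_norm_coeff_pow_mul_le M.tauInvMat
  rw [← norm_zetaSep]
  let x : M.Idx → (Ksep K)⟦X⟧ := (BC.basis (psSep K) M.base).repr t
  have h1 : M.tauMatSep.mulVec (fun j => sigmaSep K F (x j)) = x :=
    funext (M.mem_invariants_iff_repr.1 t.2)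
  have h2 : M.tauInvMatSep * M.tauMatSep = 1 :=
    mul_eq_one_comm.1 (M.tauMatExt_mul_tauInvMatExt (psSep K) (isUnit_psSep_zSub ζ))
  have h3 : (fun j => sigmaSep K F (x j)) = M.tauInvMatSep.mulVec x := by
    conv_rhs => rw [← h1]
    rw [Matrix.mulVec_mulVec, h2, Matrix.one_mulVec]
  refine mem_Tate_of_sub_pow_mul_frob_eq F zetaSep_ne_zero norm_zetaSep_lt_one e x
    (fun i j => (PowerSeries.X - PowerSeries.C (zetaSep ζ)) ^ e * M.tauInvMatSep i j) he
    (fun i => ?_) i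
  have h4 := congrFun h3 i
  rw [Matrix.mulVec, dotProduct] at h4
  simp only [mul_assoc, ← Finset.mul_sum]
  exact congrArg _ h4

/-- Every element of `Ť M` comes from `M ⊗ K^sep⟨z/ζ⟩`. -/
theorem exists_convToSep_eq (t : M.Tate) :
    ∃ m : M.Conv, M.convToSep m = (t : BC (psSep K) M.carrier) := by
  refine ⟨∑ i, (⟨_, M.repr_mem_Tate t i⟩ : LocSht.Tate (Ksep K) ‖ζ.val‖) •
    BC.ι (tateSep ζ) (M.base i), ?_⟩
  rw [map_sum]
  refine Eq.trans ?_ ((BC.basis (psSep K) M.base).sum_repr t)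
  refine Finset.sum_congr rfl fun i _ => ?_
  rw [LinearMap.map_smulₛₗ, convToSep, BC.push_ι, BC.basis_apply]
  rfl

end LocalShtuka

/-! ### Expansion at `z = ζ` after inverting `z` -/

theorem mem_range_algebraMap_of_frob_eq (F : Type*) [Field F] [Fintype F] {L : Type*} [Field L]
    [Algebra F L] {y : L} (hy : frob F L y = y) : y ∈ Set.range (algebraMap F L) := by
  classical
  by_contra hn
  have hq := Fintype.one_lt_card (α := F)
  let s : Finset L := Finset.univ.map ⟨algebraMap F L, (algebraMap F L).injective⟩
  have hys : y ∉ s := by simpa [s] using hn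
  have h0 := FiniteField.X_pow_card_sub_X_ne_zero L hq
  have h1 : (insert y s).card ≤ Fintype.card F := by
    rw [← FiniteField.X_pow_card_sub_X_natDegree_eq L hq]
    refine Polynomial.card_le_degree_of_subset_roots fun x hx => ?_
    rw [Polynomial.mem_roots h0, Polynomial.IsRoot.def]
    have hx' : frob F L x = x := by
      rcases Finset.mem_insert.1 hx with rfl | hx
      · exact hy
      · obtain ⟨a, -, rfl⟩ := Finset.mem_map.1 hx
        exact (FiniteField.frobeniusAlgHom F L).commutes a
    rw [frob_apply] at hx'
    simp [hx']
  rw [Finset.card_insert_of_notMem hys, Finset.card_map, Finset.card_univ] at h1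
  omega

section Expansion

variable {K : Type u} [NontriviallyNormedField K] [CompleteSpace K] [IsUltrametricDist K]
variable (F : Type w) [Field F] [Fintype F] [Algebra F K] (ζ : PU K)

/-- The Frobenius invariants of `K^sep((z))` are `F((z))`. -/
theorem mem_range_constSep_of_sigmaSepL_eq {x : (Ksep K)⸨X⸩} (hx : sigmaSepL K F x = x) :
    ∃ c : F⸨X⸩, constSep K F c = x := by
  have h : ∀ n, ∃ a : F, algebraMap F (Ksep K) a = x.coeff n := fun n =>
    mem_range_algebraMap_of_frob_eq F (congrArg (fun y => HahnSeries.coeff y n) hx)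
  choose a ha using h
  refine ⟨⟨a, x.isPWO_support.mono fun n hn hxn => hn ?_⟩, HahnSeries.ext (funext ha)⟩
  exact (algebraMap F (Ksep K)).injective ((ha n).trans (hxn.trans (map_zero _).symm))

theorem constSep_injective : Function.Injective (constSep K F) := (constSep K F).injective

/-- The inclusion `K^sep⟨z/ζ⟩ → K^sep((z))`. -/
def tateToSep : Tate (Ksep K) ‖ζ.val‖ →+* (Ksep K)⸨X⸩ :=
  (ofPS (Ksep K)).comp (Tate (Ksep K) ‖ζ.val‖).subtype

/-- The expansion `K^sep⟨z/ζ⟩ → K̄((z - ζ))`. -/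
abbrev tateToBar : Tate (Ksep K) ‖ζ.val‖ →+* (Kbar K)⸨X⸩ := (ofPS (Kbar K)).comp (tateDR ζ)

theorem tateToSep_comp_tateSep : (tateToSep ζ).comp (tateSep ζ) = bSep K := by
  rw [tateToSep, RingHom.comp_assoc, tateSep_comp, ofPS_comp_psSep]

theorem tateToSep_injective : Function.Injective (tateToSep ζ) :=
  HahnSeries.ofPowerSeries_injective.comp Subtype.val_injective

theorem isUnit_bdRbar_X : IsUnit (bdRbar ζ PowerSeries.X) :=
  ((isUnit_psDR_X ζ).map (ofPS K)).map (toBarL K)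

/-- The inclusion `R((z)) → K̄((z - ζ))`. -/
abbrev laurentBar : (Rint K)⸨X⸩ →+* (Kbar K)⸨X⸩ := (toBarL K).comp (laurentDR ζ)

theorem laurentBar_comp : (laurentBar ζ).comp (ofPS (Rint K)) = bdRbar ζ := by
  rw [laurentBar, RingHom.comp_assoc, laurentDR_comp, toBarL_comp_bdR]

/-- The graph of the expansion homomorphism `K^sep⟨z/ζ⟩[1/z] → K̄((z - ζ))`, `z ↦ ζ + (z - ζ)`:
pairs `(a, b)` such that, for some `k`, `z^k a` lies in `K^sep⟨z/ζ⟩` and has expansion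
`z^k b`. -/
def expansionGraph : Subring ((Ksep K)⸨X⸩ × (Kbar K)⸨X⸩) where
  carrier := {p | ∃ (k : ℕ) (f : Tate (Ksep K) ‖ζ.val‖),
    tateToSep ζ f = bSep K PowerSeries.X ^ k * p.1 ∧
      tateToBar ζ f = bdRbar ζ PowerSeries.X ^ k * p.2}
  one_mem' := ⟨0, 1, by simp, by simp⟩
  zero_mem' := ⟨0, 0, by simp, by simp⟩
  mul_mem' := by
    rintro ⟨a, b⟩ ⟨a', b'⟩ ⟨k, f, h1, h2⟩ ⟨k', f', h1', h2'⟩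
    refine ⟨k + k', f * f', ?_, ?_⟩
    · rw [map_mul, h1, h1', Prod.fst_mul]; ring
    · rw [map_mul, h2, h2', Prod.snd_mul]; ring
  add_mem' := by
    rintro ⟨a, b⟩ ⟨a', b'⟩ ⟨k, f, h1, h2⟩ ⟨k', f', h1', h2'⟩
    refine ⟨k + k', tateSep ζ PowerSeries.X ^ k' * f + tateSep ζ PowerSeries.X ^ k * f', ?_, ?_⟩
    · have hX := RingHom.congr_fun (tateToSep_comp_tateSep ζ) PowerSeries.X
      rw [RingHom.comp_apply] at hX
      rw [map_add, map_mul, map_mul, map_pow, map_pow, h1, h1', hX, Prod.fst_add]; ring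
    · have hX := RingHom.congr_fun (ofPS_comp_tateDR_comp ζ) PowerSeries.X
      rw [RingHom.comp_apply] at hX
      rw [map_add, map_mul, map_mul, map_pow, map_pow, h2, h2', hX, Prod.snd_add]; ring
  neg_mem' := by
    rintro ⟨a, b⟩ ⟨k, f, h1, h2⟩
    refine ⟨k, -f, ?_, ?_⟩
    · rw [map_neg, h1, Prod.fst_neg]; ring
    · rw [map_neg, h2, Prod.snd_neg]; ring

theorem tate_mem_expansionGraph (f : Tate (Ksep K) ‖ζ.val‖) :
    (tateToSep ζ f, tateToBar ζ f) ∈ expansionGraph ζ := ⟨0, f, by simp, by simp⟩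

theorem expansionGraph_unique {a : (Ksep K)⸨X⸩} {b b' : (Kbar K)⸨X⸩}
    (h : (a, b) ∈ expansionGraph ζ) (h' : (a, b') ∈ expansionGraph ζ) : b = b' := by
  obtain ⟨k, f, h1, h2⟩ := sub_mem h h'
  rw [Prod.mk_sub_mk, sub_self, mul_zero] at h1
  rw [(map_eq_zero_iff _ (tateToSep_injective ζ)).1 h1, map_zero] at h2
  exact sub_eq_zero.1 ((((isUnit_bdRbar_X ζ).pow k).mul_right_eq_zero).1 h2.symm)

theorem laurent_mem_expansionGraph (a : (Rint K)⸨X⸩) :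
    (laurentSep K a, laurentBar ζ a) ∈ expansionGraph ζ := by
  obtain ⟨k, a₀, h⟩ := IsLocalization.Away.surj (PowerSeries.X : (Rint K)⟦X⟧) a
  rw [LaurentSeries.coe_algebraMap] at h
  refine ⟨k, tateSep ζ a₀, ?_, ?_⟩
  · have h1 := congrArg (laurentSep K) h
    rw [map_mul, map_pow, ← RingHom.comp_apply, ← RingHom.comp_apply, laurentSep_comp] at h1
    rw [← RingHom.comp_apply, tateToSep_comp_tateSep, ← h1, mul_comm]
  · have h1 := congrArg (laurentBar ζ) h
    rw [map_mul, map_pow, ← RingHom.comp_apply, ← RingHom.comp_apply, laurentBar_comp] at h1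
    rw [← RingHom.comp_apply, ofPS_comp_tateDR_comp, ← h1, mul_comm]

theorem const_mem_expansionGraph (c : F⸨X⸩) :
    (constSep K F c, constBar F ζ c) ∈ expansionGraph ζ := by
  have h : constBar F ζ = (laurentBar ζ).comp (laurentMap (constInt K F)) := by
    refine laurent_hom_ext ?_
    rw [RingHom.comp_assoc, laurentMap_comp_ofPS, ← RingHom.comp_assoc, laurentBar_comp, constBar,
      RingHom.comp_assoc, RingHom.comp_assoc, constDR, laurentLift_comp, ← RingHom.comp_assoc,
      ← RingHom.comp_assoc]
    rfl
  rw [h]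
  exact laurent_mem_expansionGraph ζ (laurentMap (constInt K F) c)

theorem sum_mul_mem_expansionGraph {I : Type*} [Fintype I] {a a' : I → (Ksep K)⸨X⸩}
    {b b' : I → (Kbar K)⸨X⸩} (h : ∀ j, (a j, b j) ∈ expansionGraph ζ)
    (h' : ∀ j, (a' j, b' j) ∈ expansionGraph ζ) :
    (∑ j, a j * a' j, ∑ j, b j * b' j) ∈ expansionGraph ζ := by
  have h1 : (∑ j, a j * a' j, ∑ j, b j * b' j) = ∑ j, (a j, b j) * (a' j, b' j) :=
    Prod.ext (by rw [Prod.fst_sum]; rfl) (by rw [Prod.snd_sum]; rfl)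
  rw [h1]
  exact sum_mem fun j _ => mul_mem (h j) (h' j)

theorem gal_mem_expansionGraph (g : Ksep K ≃ₐ[K] Ksep K) {a : (Ksep K)⸨X⸩} {b : (Kbar K)⸨X⸩}
    (h : (a, b) ∈ expansionGraph ζ) :
    (laurentMap (galSep g) a, laurentMap (galBar g) b) ∈ expansionGraph ζ := by
  obtain ⟨k, f, h1, h2⟩ := h
  have hnorm : ∀ x, ‖galSep g x‖ = ‖x‖ := fun x => by
    rw [← norm_sepToBar, ← galBar_sepToBar, norm_galBar, norm_sepToBar]
  let f' : Tate (Ksep K) ‖ζ.val‖ := ⟨PowerSeries.map (galSep g) f, mem_Tate.2 (by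
    simpa only [PowerSeries.coeff_map, hnorm] using mem_Tate.1 f.2)⟩
  have hf1 : tateToSep ζ f' = laurentMap (galSep g) (tateToSep ζ f) :=
    (RingHom.congr_fun (laurentMap_comp_ofPS (galSep g)) (f : (Ksep K)⟦X⟧)).symm
  have hf2 : tateDR ζ f' = PowerSeries.map (galBar g) (tateDR ζ f) := by
    ext i
    rw [PowerSeries.coeff_map, coeff_tateDR, coeff_tateDR, Summable.map_tsum _ (galBar g)
      (continuous_galBar g)]
    · refine tsum_congr fun n => ?_
      rw [map_mul, map_mul, map_pow, map_natCast, galBar_sepToBar, ← RingHom.comp_apply (galBar g),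
        galBar_comp_toBar]
      change _ * sepToBar K (PowerSeries.coeff n (PowerSeries.map (galSep g) _)) * _ = _
      rw [PowerSeries.coeff_map]
    · have h3 : PowerSeries.map (sepToBar K) f ∈ Tate (Kbar K) ‖toBar K ζ.val‖ := mem_Tate.2 <| by
        simpa only [PowerSeries.coeff_map, norm_sepToBar, norm_toBar] using mem_Tate.1 f.2
      have h4 := taylor_summable ((map_ne_zero (toBar K)).2 ζ.ne_zero) h3 i
      simpa only [PowerSeries.coeff_map] using h4
  refine ⟨k, f', ?_, ?_⟩
  · rw [hf1, h1, map_mul, map_pow]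
    congr 2
    rw [← RingHom.comp_apply, bSep, ← RingHom.comp_assoc, laurentMap_comp, galSep_comp]
  · rw [RingHom.comp_apply, hf2, ← RingHom.comp_apply (ofPS (Kbar K)), ← laurentMap_comp_ofPS,
      RingHom.comp_apply]
    change laurentMap (galBar g) (tateToBar ζ f) = _
    rw [h2, map_mul, map_pow]
    congr 2
    rw [bdRbar, RingHom.comp_apply, ← RingHom.comp_apply (laurentMap (galBar g)),
      galBar_comp_toBarL]

end Expansion

/-! ### Bases of the realizations -/

namespace LocalShtuka

variable {K : Type u} [NontriviallyNormedField K] [CompleteSpace K] [IsUltrametricDist K]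
variable {F : Type w} [Field F] [Fintype F] [Algebra F K] {ζ : PU K}
variable (M N : LocalShtuka.{u, v, w} F ζ)

theorem map_tauMatExt {B C : Type*} [CommRing B] [CommRing C] {g : (Rint K)⟦X⟧ →+* B}
    {h : (Rint K)⟦X⟧ →+* C} (p : B →+* C) (hp : p.comp g = h) (hg : IsUnit (g ζ.zSub))
    (hh : IsUnit (h ζ.zSub)) : (M.tauMatExt g hg).map p = M.tauMatExt h hh := by
  have hl : p.comp (IsLocalization.Away.lift (S := Rloc ζ) ζ.zSub hg) =
      IsLocalization.Away.lift (S := Rloc ζ) ζ.zSub hh := by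
    apply IsLocalization.ringHom_ext (Submonoid.powers ζ.zSub)
    rw [RingHom.comp_assoc, IsLocalization.Away.lift_comp, IsLocalization.Away.lift_comp, hp]
  ext i j
  exact RingHom.congr_fun hl (M.tauMat i j)

/-- The coordinate matrix over `K^sep⟨z/ζ⟩` of a basis of `Ť M`. -/
def tateMat : Matrix M.Idx M.Idx (LocSht.Tate (Ksep K) ‖ζ.val‖) := M.exists_tateMat.choose

/-- The inverse of `tateMat`. -/
def tateInvMat : Matrix M.Idx M.Idx (LocSht.Tate (Ksep K) ‖ζ.val‖) :=
  M.exists_tateMat.choose_spec.choose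

theorem tateMat_mul_tateInvMat : M.tateMat * M.tateInvMat = 1 :=
  M.exists_tateMat.choose_spec.choose_spec.1

theorem tateInvMat_mul_tateMat : M.tateInvMat * M.tateMat = 1 :=
  mul_eq_one_comm.1 M.tateMat_mul_tateInvMat

theorem tauMatSep_mul_tateMat :
    M.tauMatSep * (M.tateMat.map (Subring.subtype _)).map (sigmaSep K F) =
      M.tateMat.map (Subring.subtype _) :=
  M.exists_tateMat.choose_spec.choose_spec.2

/-- The elements of `Ť M` whose coordinates are the columns of `tateMat`. -/
def tateVec (j : M.Idx) : M.Tate :=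
  ⟨(BC.basis (psSep K) M.base).equivFun.symm fun i => (M.tateMat i j : (Ksep K)⟦X⟧), by
    refine M.mem_invariants_iff_repr.2 fun i => ?_
    have h := congrFun (congrFun M.tauMatSep_mul_tateMat i) j
    rw [Matrix.mul_apply] at h
    simp only [← Module.Basis.equivFun_apply, LinearEquiv.apply_symm_apply]
    exact h⟩

theorem repr_tateToRat (t : M.Tate) (i : M.Idx) :
    (BC.basis (bSep K) M.base).repr (M.tateToRat t : BC (bSep K) M.carrier) i =
      ofPS (Ksep K) ((BC.basis (psSep K) M.base).repr (t : BC (psSep K) M.carrier) i) :=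
  BC.repr_push _ _ _ _ _

theorem repr_tateVec (i j : M.Idx) : (BC.basis (bSep K) M.base).repr
    (M.tateToRat (M.tateVec j) : BC (bSep K) M.carrier) i = tateToSep ζ (M.tateMat i j) := by
  rw [repr_tateToRat, tateVec, ← Module.Basis.equivFun_apply, LinearEquiv.apply_symm_apply]
  rfl

/-- The matrix of the chosen basis of `H_ε(M, Q_ε)` over `K^sep((z))`. -/
def ratMat : Matrix M.Idx M.Idx (Ksep K)⸨X⸩ := M.tateMat.map (tateToSep ζ)

theorem tateInvMat_mul_ratMat : M.tateInvMat.map (tateToSep ζ) * M.ratMat = 1 := by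
  rw [ratMat, ← Matrix.map_mul, tateInvMat_mul_tateMat]; simp

theorem ratMat_mul_tateInvMat : M.ratMat * M.tateInvMat.map (tateToSep ζ) = 1 :=
  mul_eq_one_comm.1 M.tateInvMat_mul_ratMat

theorem coe_sum_smul (a : M.Idx → F⸨X⸩) (v : M.Idx → M.RatTate) :
    ((∑ j, a j • v j : M.RatTate) : BC (bSep K) M.carrier) =
      ∑ j, constSep K F (a j) • (v j : BC (bSep K) M.carrier) := by
  rw [AddSubgroup.val_finsetSum]; rfl

theorem repr_sum_smul_tateVec (a : M.Idx → F⸨X⸩) (i : M.Idx) :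
    (BC.basis (bSep K) M.base).repr
      ((∑ j, a j • M.tateToRat (M.tateVec j) : M.RatTate) : BC (bSep K) M.carrier) i =
      M.ratMat.mulVec (fun j => constSep K F (a j)) i := by
  rw [coe_sum_smul, map_sum, Finsupp.finsetSum_apply, Matrix.mulVec, dotProduct]
  refine Finset.sum_congr rfl fun j _ => ?_
  rw [map_smul, Finsupp.smul_apply, repr_tateVec, smul_eq_mul, mul_comm]
  rfl

/-- For the coordinate vector `c` of a Frobenius invariant, `Y⁻¹ c` is invariant under `σ̂`, hence
comes from `F((z))`. -/
theorem exists_sum_smul_tateVec_eq (x : M.RatTate) :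
    ∃ a : M.Idx → F⸨X⸩, ∑ j, a j • M.tateToRat (M.tateVec j) = x := by
  let T := M.tauMatExt (bSep K) (isUnit_bSep_zSub ζ)
  let c : M.Idx → (Ksep K)⸨X⸩ := (BC.basis (bSep K) M.base).repr (x : BC (bSep K) M.carrier)
  let a := (M.tateInvMat.map (tateToSep ζ)).mulVec c
  have hca : c = M.ratMat.mulVec a := by
    rw [Matrix.mulVec_mulVec, ratMat_mul_tateInvMat, Matrix.one_mulVec]
  have hc : T.mulVec (sigmaSepL K F ∘ c) = c := funext (M.mem_invariants_iff_repr.1 x.2)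
  have hT : T * M.ratMat.map (sigmaSepL K F) = M.ratMat := by
    have h := congrArg (fun A => A.map (ofPS (Ksep K))) M.tauMatSep_mul_tateMat
    simp only [Matrix.map_mul] at h
    rw [M.map_tauMatExt (ofPS (Ksep K)) ofPS_comp_psSep _ (isUnit_bSep_zSub ζ)] at h
    refine Eq.trans (congrArg (T * ·) (Matrix.ext fun i j => ?_)) h
    exact RingHom.congr_fun (laurentMap_comp_ofPS (frobSep K F)) (M.tateMat i j : (Ksep K)⟦X⟧)
  have ha : sigmaSepL K F ∘ a = a := by
    have h1 : sigmaSepL K F ∘ c = (M.ratMat.map (sigmaSepL K F)).mulVec (sigmaSepL K F ∘ a) := by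
      funext i
      rw [hca]
      exact RingHom.map_mulVec _ _ _ _
    rw [h1, Matrix.mulVec_mulVec, hT] at hc
    have h2 := congrArg (M.tateInvMat.map (tateToSep ζ)).mulVec hc
    rwa [Matrix.mulVec_mulVec, tateInvMat_mul_ratMat, Matrix.one_mulVec] at h2
  choose α hα using fun j => mem_range_constSep_of_sigmaSepL_eq F (congrFun ha j)
  refine ⟨α, Subtype.ext ((BC.basis (bSep K) M.base).repr.injective (Finsupp.ext fun i => ?_))⟩
  rw [repr_sum_smul_tateVec]
  simp only [hα]
  exact (congrFun hca i).symm

/-- The basis of `H_ε(M, Q_ε)` given by a basis of the Tate module. -/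
def ratBasis : Module.Basis M.Idx F⸨X⸩ M.RatTate :=
  Module.Basis.mk (v := fun j => M.tateToRat (M.tateVec j))
    (by
      rw [Fintype.linearIndependent_iff]
      intro a ha j
      have h1 : M.ratMat.mulVec (fun j => constSep K F (a j)) = 0 := by
        funext i
        rw [← repr_sum_smul_tateVec, ha]
        simp
      have h2 := congrArg (M.tateInvMat.map (tateToSep ζ)).mulVec h1
      rw [Matrix.mulVec_mulVec, tateInvMat_mul_ratMat, Matrix.one_mulVec, Matrix.mulVec_zero] at h2
      exact constSep_injective F ((congrFun h2 j).trans (map_zero _).symm))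
    (by
      rintro x -
      obtain ⟨a, rfl⟩ := M.exists_sum_smul_tateVec_eq x
      exact Submodule.sum_mem _ fun j _ => Submodule.smul_mem _ _ (Submodule.subset_span ⟨j, rfl⟩))

theorem ratBasis_apply (j : M.Idx) : M.ratBasis j = M.tateToRat (M.tateVec j) :=
  Module.Basis.mk_apply _ _ _

theorem repr_ratTate (x : M.RatTate) (i : M.Idx) :
    (BC.basis (bSep K) M.base).repr (x : BC (bSep K) M.carrier) i =
      ∑ j, tateToSep ζ (M.tateMat i j) * constSep K F (M.ratBasis.repr x j) := by
  conv_lhs => rw [← M.ratBasis.sum_repr x]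
  simp only [ratBasis_apply]
  exact M.repr_sum_smul_tateVec _ i

/-! ### The comparison isomorphism -/

/-- The basis of `H_ε(M, Q_ε) ⊗ K̄((z - ζ))` given by a basis of the Tate module. -/
def epsBasis : Module.Basis M.Idx (Kbar K)⸨X⸩ M.EpsBar := BC.basis (constBar F ζ) M.ratBasis

/-- The basis of `M ⊗ K̄((z - ζ))` given by the chosen basis of `M`. -/
def barBasis : Module.Basis M.Idx (Kbar K)⸨X⸩ (BC (bdRbar ζ) M.carrier) :=
  BC.basis (bdRbar ζ) M.base

/-- The basis of `H_dR(M, K((z - ζ))) ⊗ K̄((z - ζ))` given by the chosen basis of `M`. -/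
def drBarBasis : Module.Basis M.Idx (Kbar K)⸨X⸩ M.DRBar :=
  BC.basis (toBarL K) (BC.basis (bdR ζ) M.sigBase)

theorem map_tateMat_mul_tateInvMat :
    M.tateMat.map (tateToBar ζ) * M.tateInvMat.map (tateToBar ζ) = 1 := by
  rw [← Matrix.map_mul, tateMat_mul_tateInvMat]; simp

/-- The isomorphism `H_ε(M, Q_ε) ⊗ K̄((z - ζ)) → M ⊗ K̄((z - ζ))` which expands the Tate module at
`z = ζ`. -/
def epsEquiv : M.EpsBar ≃ₗ[(Kbar K)⸨X⸩] BC (bdRbar ζ) M.carrier :=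
  LinearEquiv.ofIsUnitDet (f := Matrix.toLin M.epsBasis M.barBasis (M.tateMat.map (tateToBar ζ)))
    (v := M.epsBasis) (v' := M.barBasis) (by
      rw [LinearMap.toMatrix_toLin]
      exact (Matrix.isUnit_iff_isUnit_det _).1 ⟨⟨_, _, M.map_tateMat_mul_tateInvMat,
        mul_eq_one_comm.1 M.map_tateMat_mul_tateInvMat⟩, rfl⟩)

theorem repr_epsEquiv (x : M.EpsBar) (i : M.Idx) : M.barBasis.repr (M.epsEquiv x) i =
    ∑ j, tateToBar ζ (M.tateMat i j) * M.epsBasis.repr x j :=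
  congrFun (Matrix.repr_toLin M.epsBasis M.barBasis (M.tateMat.map (tateToBar ζ)) x) i

/-- The coordinates of `v ∈ H_ε(M, Q_ε)` expand at `z = ζ` to those of its image under
`epsEquiv`. -/
theorem repr_epsEquiv_mem_expansionGraph (x : M.RatTate) (i : M.Idx) :
    ((BC.basis (bSep K) M.base).repr (x : BC (bSep K) M.carrier) i,
      M.barBasis.repr (M.epsEquiv (BC.ι (constBar F ζ) x)) i) ∈ expansionGraph ζ := by
  rw [repr_ratTate, repr_epsEquiv]
  have h : ∀ j, M.epsBasis.repr (BC.ι (constBar F ζ) x) j =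
      constBar F ζ (M.ratBasis.repr x j) := fun j => BC.basis_repr_ι _ _ _ _
  simp only [h]
  exact sum_mul_mem_expansionGraph ζ (fun j => tate_mem_expansionGraph ζ (M.tateMat i j))
    fun j => const_mem_expansionGraph F ζ _

/-- `epsEquiv` is determined by expansion of coordinates. -/
theorem epsEquiv_eq {x : M.RatTate} {y : BC (bdRbar ζ) M.carrier}
    (h : ∀ i, ((BC.basis (bSep K) M.base).repr (x : BC (bSep K) M.carrier) i,
      M.barBasis.repr y i) ∈ expansionGraph ζ) : M.epsEquiv (BC.ι (constBar F ζ) x) = y :=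
  M.barBasis.repr.injective (Finsupp.ext fun i =>
    expansionGraph_unique ζ (M.repr_epsEquiv_mem_expansionGraph x i) (h i))

theorem tauBar_ι (x : M.DR) : M.tauBar (BC.ι (toBarL K) x) =
    BC.push (toBarL K) (toBarL_comp_bdR ζ) (M.tauExt (bdR ζ) (isUnit_bdR_zSub ζ) x) :=
  BC.desc_ι _ _ _ _

theorem isUnit_bdRbar_zSub (ζ : PU K) : IsUnit (bdRbar ζ ζ.zSub) :=
  (isUnit_bdR_zSub ζ).map (toBarL K)

theorem tauBar_bijective : Function.Bijective M.tauBar := by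
  have h : LinearMap.toMatrix M.drBarBasis M.barBasis M.tauBar =
      M.tauMatExt (bdRbar ζ) (isUnit_bdRbar_zSub ζ) := by
    ext i j : 1
    rw [LinearMap.toMatrix_apply, drBarBasis, BC.basis_apply, tauBar_ι, barBasis, BC.repr_push,
      tauExt_repr, Module.Basis.repr_self, ← M.map_tauMatExt (toBarL K) (toBarL_comp_bdR ζ)
        (isUnit_bdR_zSub ζ)]
    simp [Finsupp.single_apply]
  have hu : IsUnit (LinearMap.toMatrix M.drBarBasis M.barBasis M.tauBar).det := by
    rw [h]
    exact (Matrix.isUnit_iff_isUnit_det _).1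
      ⟨⟨_, _, M.tauMatExt_mul_tauInvMatExt _ _,
        mul_eq_one_comm.1 (M.tauMatExt_mul_tauInvMatExt _ _)⟩, rfl⟩
  exact (LinearEquiv.ofIsUnitDet hu).bijective

/-- The comparison isomorphism `h_{ε,dR} = τ⁻¹ ∘ (z ↦ ζ + (z - ζ))`. -/
def comparison : M.EpsBar ≃ₗ[(Kbar K)⸨X⸩] M.DRBar :=
  M.epsEquiv.trans (LinearEquiv.ofBijective M.tauBar M.tauBar_bijective).symm

theorem tauBar_comparison (x : M.EpsBar) : M.tauBar (M.comparison x) = M.epsEquiv x :=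
  (LinearEquiv.ofBijective M.tauBar M.tauBar_bijective).apply_symm_apply (M.epsEquiv x)

theorem exists_conv_tauBar_comparison (t : M.Tate) : ∃ m : M.Conv,
    M.convToSep m = (t : BC (psSep K) M.carrier) ∧
      M.tauBar (M.comparison (BC.ι (constBar F ζ) (M.tateToRat t))) = M.convExpand m := by
  obtain ⟨m, hm⟩ := M.exists_convToSep_eq t
  refine ⟨m, hm, ?_⟩
  rw [tauBar_comparison]
  refine M.epsEquiv_eq fun i => ?_
  rw [repr_tateToRat, ← hm, convToSep, BC.repr_push, convExpand, barBasis, BC.repr_push]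
  exact tate_mem_expansionGraph ζ _

/-! ### Functoriality and Galois equivariance -/

variable {M N} in
theorem homExt_repr {B : Type*} [CommRing B]
    (f : BC (ofPS (Rint K)) M.carrier →ₗ[(Rint K)⸨X⸩] BC (ofPS (Rint K)) N.carrier)
    {g : (Rint K)⟦X⟧ →+* B} (p : (Rint K)⸨X⸩ →+* B) (hp : p.comp (ofPS (Rint K)) = g)
    (x : BC g M.carrier) (i : N.Idx) : (BC.basis g N.base).repr (homExt f p hp x) i =
      ∑ j, p ((BC.basis (ofPS (Rint K)) N.base).repr (f (BC.ι _ (M.base j))) i) *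
        (BC.basis g M.base).repr x j := by
  rw [BC.repr_semilinear (homExt f p hp) (BC.basis g M.base)]
  refine Finset.sum_congr rfl fun j _ => ?_
  rw [BC.basis_apply, homExt, BC.desc_ι]
  exact congrArg (· * _) (BC.repr_push p hp N.base _ i)

theorem tauBar_map_dRMap (f : QuasiHom M N) (y : M.DRBar) :
    N.tauBar (BC.map f.dRMap y) =
      homExt f.toLin (laurentBar ζ) (laurentBar_comp ζ) (M.tauBar y) := by
  refine LinearMap.congr_fun (f := N.tauBar ∘ₗ BC.map f.dRMap)
    (g := homExt f.toLin (laurentBar ζ) (laurentBar_comp ζ) ∘ₗ M.tauBar)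
    (BC.hom_ext fun m => ?_) y
  have h1 : BC.map (f := toBarL K) f.dRMap (BC.ι (toBarL K) m) = BC.ι (toBarL K) (f.dRMap m) :=
    BC.desc_ι _ _ _ _
  rw [LinearMap.comp_apply, LinearMap.comp_apply, h1, tauBar_ι, tauBar_ι, QuasiHom.dRMap,
    f.comm_ext]
  exact QuasiHom.push_homExt f.toLin (laurentDR_comp ζ) (laurentBar_comp ζ) (toBarL K)
    (toBarL_comp_bdR ζ) rfl _

theorem comparison_functorial (f : QuasiHom M N) (x : M.EpsBar) :
    N.comparison (BC.map f.ratMap x) = BC.map f.dRMap (M.comparison x) := by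
  refine LinearMap.congr_fun (f := N.comparison.toLinearMap ∘ₗ BC.map f.ratMap)
    (g := BC.map f.dRMap ∘ₗ M.comparison.toLinearMap) (BC.hom_ext fun m => ?_) x
  have h1 : BC.map (f := constBar F ζ) f.ratMap (BC.ι (constBar F ζ) m) =
    BC.ι (constBar F ζ) (f.ratMap m) := BC.desc_ι _ _ _ _
  change N.comparison (BC.map f.ratMap (BC.ι (constBar F ζ) m)) =
    BC.map f.dRMap (M.comparison (BC.ι (constBar F ζ) m))
  rw [h1]
  apply N.tauBar_bijective.1
  rw [tauBar_comparison, tauBar_map_dRMap, tauBar_comparison]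
  refine N.epsEquiv_eq fun i => ?_
  have h2 : (f.ratMap m : BC (bSep K) N.carrier) =
    homExt f.toLin (laurentSep K) laurentSep_comp (m : BC (bSep K) M.carrier) := rfl
  rw [h2, homExt_repr, barBasis, homExt_repr]
  exact sum_mul_mem_expansionGraph ζ (fun j => laurent_mem_expansionGraph ζ _)
    fun j => M.repr_epsEquiv_mem_expansionGraph m j

theorem galBar_comp_bdRbar (g : Ksep K ≃ₐ[K] Ksep K) :
    (laurentMap (galBar g)).comp (bdRbar ζ) = bdRbar ζ := by
  rw [bdRbar, ← RingHom.comp_assoc, galBar_comp_toBarL]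

theorem tauBar_galDRBar (g : Ksep K ≃ₐ[K] Ksep K) (y : M.DRBar) :
    M.tauBar (M.galDRBar g y) =
      BC.push (laurentMap (galBar g)) (galBar_comp_bdRbar g) (M.tauBar y) := by
  refine LinearMap.congr_fun (f := M.tauBar.comp (M.galDRBar g))
    (g := (BC.push (laurentMap (galBar g)) (galBar_comp_bdRbar g)).comp M.tauBar)
    (BC.hom_ext fun m => ?_) y
  rw [LinearMap.comp_apply, LinearMap.comp_apply, galDRBar, BC.push_ι, tauBar_ι]
  refine (BC.basis (bdRbar ζ) M.base).repr.injective (Finsupp.ext fun i => ?_)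
  rw [BC.repr_push, BC.repr_push, BC.repr_push, ← RingHom.comp_apply, galBar_comp_toBarL]

theorem comparison_galEpsBar (g : Ksep K ≃ₐ[K] Ksep K) (x : M.EpsBar) :
    M.comparison (M.galEpsBar g x) = M.galDRBar g (M.comparison x) := by
  refine LinearMap.congr_fun (f := M.comparison.toLinearMap.comp (M.galEpsBar g))
    (g := (M.galDRBar g).comp M.comparison.toLinearMap) (BC.hom_ext fun m => ?_) x
  change M.comparison (M.galEpsBar g (BC.ι (constBar F ζ) m)) =
    M.galDRBar g (M.comparison (BC.ι (constBar F ζ) m))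
  have h1 : M.galEpsBar g (BC.ι (constBar F ζ) m) = BC.ι (constBar F ζ) (M.galRat g m) :=
    BC.desc_ι _ _ _ _
  rw [h1]
  apply M.tauBar_bijective.1
  rw [tauBar_comparison, tauBar_galDRBar, tauBar_comparison]
  refine M.epsEquiv_eq fun i => ?_
  have h2 : (BC.basis (bSep K) M.base).repr (M.galRat g m : BC (bSep K) M.carrier) i =
      laurentMap (galSep g) ((BC.basis (bSep K) M.base).repr (m : BC (bSep K) M.carrier) i) :=
    BC.repr_push _ _ _ _ _
  rw [h2, barBasis, BC.repr_push]
  exact gal_mem_expansionGraph ζ g (M.repr_epsEquiv_mem_expansionGraph m i)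

/-! ### Comparison of lattices -/

/-- The lattice `M ⊗ K̄⟦z - ζ⟧` in `M ⊗ K̄((z - ζ))`. -/
def barLattice : Submodule (Kbar K)⟦X⟧ (BC (bdRbar ζ) M.carrier) :=
  Submodule.span (Kbar K)⟦X⟧ (Set.range fun i => BC.ι (bdRbar ζ) (M.base i))

theorem ofPS_smul {V : Type*} [AddCommGroup V] [Module (Kbar K)⸨X⸩ V] [Module (Kbar K)⟦X⟧ V]
    [IsScalarTower (Kbar K)⟦X⟧ (Kbar K)⸨X⸩ V] (a : (Kbar K)⟦X⟧) (x : V) :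
    ofPS (Kbar K) a • x = a • x := by
  rw [← LaurentSeries.coe_algebraMap, algebraMap_smul]

theorem epsEquiv_tateVec (j : M.Idx) :
    M.epsEquiv (BC.ι (constBar F ζ) (M.tateToRat (M.tateVec j))) =
      ∑ i, tateDR ζ (M.tateMat i j) • BC.ι (bdRbar ζ) (M.base i) := by
  have h1 : BC.ι (constBar F ζ) (M.tateToRat (M.tateVec j)) = M.epsBasis j := by
    rw [epsBasis, BC.basis_apply, ratBasis_apply]
  rw [h1, ← M.barBasis.sum_repr (M.epsEquiv _)]
  refine Finset.sum_congr rfl fun i _ => ?_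
  rw [repr_epsEquiv, barBasis, BC.basis_apply, ← ofPS_smul]
  simp [Finsupp.single_apply]

/-- The inverse of `tateMat` expresses the basis of `M` by the expanded Tate module; its expansion
has coefficients in `K̄⟦z - ζ⟧`. -/
theorem ι_base_eq_sum (k : M.Idx) : BC.ι (bdRbar ζ) (M.base k) =
    ∑ j, tateDR ζ (M.tateInvMat j k) •
      M.epsEquiv (BC.ι (constBar F ζ) (M.tateToRat (M.tateVec j))) := by
  simp only [epsEquiv_tateVec, Finset.smul_sum, smul_smul]
  rw [Finset.sum_comm]
  have h1 : ∀ i, ∑ j, tateDR ζ (M.tateInvMat j k) * tateDR ζ (M.tateMat i j) =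
      if i = k then 1 else 0 := fun i => by
    have h2 := congrArg (tateDR ζ) (congrFun (congrFun M.tateMat_mul_tateInvMat i) k)
    rw [Matrix.mul_apply, map_sum, Matrix.one_apply] at h2
    simp only [map_mul] at h2
    simp only [mul_comm (tateDR ζ (M.tateInvMat _ k)), h2]
    split_ifs <;> simp
  simp only [← Finset.sum_smul, h1, ite_smul, one_smul, zero_smul, Finset.sum_ite_eq',
    Finset.mem_univ, if_true]

/-- The `K̄⟦z - ζ⟧`-span of a basis of `Ť M`. -/
def vecLattice : Submodule (Kbar K)⟦X⟧ M.EpsBar :=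
  Submodule.span (Kbar K)⟦X⟧
    (Set.range fun j => BC.ι (constBar F ζ) (M.tateToRat (M.tateVec j)))

/-- Since `z` is a unit of `K̄⟦z - ζ⟧`, the field `F((z))` maps into `K̄⟦z - ζ⟧`, and `H_ε(M, Q_ε)`
generates no larger lattice than `Ť M`. -/
theorem ratLattice_le_vecLattice : M.ratLattice ≤ M.vecLattice := by
  refine Submodule.span_le.2 ?_
  rintro _ ⟨x, rfl⟩
  rw [← M.ratBasis.sum_repr x, map_sum]
  refine Submodule.sum_mem _ fun j _ => ?_
  have h1 : constBar F ζ (M.ratBasis.repr x j) =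
      ofPS (Kbar K) (PowerSeries.map (toBar K) (constDR F ζ (M.ratBasis.repr x j))) := by
    rw [← RingHom.comp_apply (ofPS (Kbar K)), ← laurentMap_comp_ofPS]; rfl
  rw [LinearMap.map_smulₛₗ, h1, ofPS_smul, ratBasis_apply]
  exact Submodule.smul_mem _ _ (Submodule.subset_span ⟨j, rfl⟩)

theorem vecLattice_le_tateLattice : M.vecLattice ≤ M.tateLattice :=
  Submodule.span_mono (by rintro _ ⟨j, rfl⟩; exact ⟨_, rfl⟩)

theorem tateLattice_le_ratLattice : M.tateLattice ≤ M.ratLattice :=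
  Submodule.span_mono (by rintro _ ⟨j, rfl⟩; exact ⟨_, rfl⟩)

theorem ratLattice_eq : M.ratLattice = M.vecLattice :=
  le_antisymm M.ratLattice_le_vecLattice
    (M.vecLattice_le_tateLattice.trans M.tateLattice_le_ratLattice)

theorem tateLattice_eq : M.tateLattice = M.vecLattice :=
  le_antisymm (M.tateLattice_le_ratLattice.trans M.ratLattice_le_vecLattice)
    M.vecLattice_le_tateLattice

theorem epsEquiv_image_vecLattice :
    M.epsEquiv '' (M.vecLattice : Set M.EpsBar) = M.barLattice := by
  have h : M.vecLattice.map (M.epsEquiv.toLinearMap.restrictScalars (Kbar K)⟦X⟧) =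
      M.barLattice := by
    rw [vecLattice, Submodule.map_span, barLattice, ← Set.range_comp]
    refine le_antisymm (Submodule.span_le.2 ?_) (Submodule.span_le.2 ?_)
    · rintro _ ⟨j, rfl⟩
      change M.epsEquiv (BC.ι (constBar F ζ) (M.tateToRat (M.tateVec j))) ∈ _
      rw [epsEquiv_tateVec]
      exact Submodule.sum_mem _ fun i _ =>
        Submodule.smul_mem _ _ (Submodule.subset_span ⟨i, rfl⟩)
    · rintro _ ⟨i, rfl⟩
      change BC.ι (bdRbar ζ) (M.base i) ∈ _
      rw [ι_base_eq_sum]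
      exact Submodule.sum_mem _ fun j _ =>
        Submodule.smul_mem _ _ (Submodule.subset_span ⟨j, rfl⟩)
  rw [← h, Submodule.map_coe]
  rfl

theorem tauBar_image_hodgePinkBar :
    M.tauBar '' (M.hodgePinkBar : Set M.DRBar) = M.barLattice := by
  have h : M.hodgePinkBar.map (M.tauBar.restrictScalars (Kbar K)⟦X⟧) = M.barLattice := by
    rw [hodgePinkBar, Submodule.map_span, barLattice]
    refine le_antisymm (Submodule.span_le.2 ?_) (Submodule.span_le.2 ?_)
    · rintro _ ⟨_, ⟨y, ⟨m, hm⟩, rfl⟩, rfl⟩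
      change M.tauBar (BC.ι (toBarL K) y) ∈ _
      rw [tauBar_ι, ← hm, ← (BC.basis (psDR ζ) M.base).sum_repr m, map_sum, map_sum]
      refine Submodule.sum_mem _ fun i _ => ?_
      rw [LinearMap.map_smulₛₗ, LinearMap.map_smulₛₗ, BC.basis_apply, BC.push_ι, BC.push_ι,
        ← RingHom.comp_apply, laurentMap_comp_ofPS, RingHom.comp_apply, ofPS_smul]
      exact Submodule.smul_mem _ _ (Submodule.subset_span ⟨i, rfl⟩)
    · rintro _ ⟨i, rfl⟩
      obtain ⟨y, hy⟩ := (M.tauExt_bijective (bdR ζ) (isUnit_bdR_zSub ζ)).2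
        (BC.ι (bdR ζ) (M.base i))
      refine Submodule.subset_span ⟨BC.ι (toBarL K) y, ⟨y, ⟨BC.ι (psDR ζ) (M.base i), ?_⟩, rfl⟩, ?_⟩
      · rw [BC.push_ι, hy]
      · change M.tauBar (BC.ι (toBarL K) y) = _
        rw [tauBar_ι, hy, BC.push_ι]
  rw [← h, Submodule.map_coe]
  rfl

theorem comparison_image_vecLattice :
    M.comparison '' (M.vecLattice : Set M.EpsBar) = M.hodgePinkBar := by
  apply M.tauBar_bijective.1.image_injective
  rw [tauBar_image_hodgePinkBar, ← epsEquiv_image_vecLattice, Set.image_image]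
  simp only [tauBar_comparison]

/-! ### Galois invariants of the de Rham realizations -/

theorem comparison_image_invariants :
    M.comparison '' {x : M.EpsBar | ∀ g : Ksep K ≃ₐ[K] Ksep K, M.galEpsBar g x = x} =
      {y : M.DRBar | ∀ g : Ksep K ≃ₐ[K] Ksep K, M.galDRBar g y = y} := by
  ext y
  constructor
  · rintro ⟨x, hx, rfl⟩ g
    rw [← comparison_galEpsBar, hx g]
  · intro hy
    refine ⟨M.comparison.symm y, fun g => M.comparison.injective ?_,
      M.comparison.apply_symm_apply y⟩
    rw [comparison_galEpsBar, LinearEquiv.apply_symm_apply, hy g]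

/-- An invariant scalar outside `K` separates `H_dR(M, K((z - ζ)))` from the invariants. -/
theorem range_ι_DR_ssubset [Nonempty M.Idx] {a : Kbar K}
    (ha : ∀ g : Ksep K ≃ₐ[K] Ksep K, galBar g a = a) (ha' : a ∉ Set.range (toBar K)) :
    Set.range (BC.ι (toBarL K) : M.DR → M.DRBar) ⊂
      {y : M.DRBar | ∀ g : Ksep K ≃ₐ[K] Ksep K, M.galDRBar g y = y} := by
  refine BC.range_ι_ssubset_invariants (toBarL K) (BC.basis (bdR ζ) M.sigBase)
    (fun g : Ksep K ≃ₐ[K] Ksep K => laurentMap (galBar g)) galBar_comp_toBarL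
    (a := HahnSeries.C a) (fun g => ?_) ?_
  · ext n
    rw [laurentMap_coeff, HahnSeries.C_apply, HahnSeries.coeff_single]
    split_ifs
    · exact ha g
    · exact map_zero _
  · rintro ⟨f, hf⟩
    refine ha' ⟨f.coeff 0, ?_⟩
    rw [← laurentMap_coeff, hf, HahnSeries.C_apply, HahnSeries.coeff_single_same]

/-- An invariant scalar outside `K` separates `H_dR(M, K)` from the invariants. -/
theorem range_ι_DRK_ssubset [Nonempty M.Idx] {a : Kbar K}
    (ha : ∀ g : Ksep K ≃ₐ[K] Ksep K, galBar g a = a) (ha' : a ∉ Set.range (toBar K)) :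
    Set.range (BC.ι (toBar K) : M.DRK → BC (toBar K) M.DRK) ⊂
      {y : BC (toBar K) M.DRK | ∀ g : Ksep K ≃ₐ[K] Ksep K, M.galDRKBar g y = y} :=
  BC.range_ι_ssubset_invariants (toBar K) (BC.basis (evalDR ζ) M.sigBase)
    (fun g : Ksep K ≃ₐ[K] Ksep K => galBar g) galBar_comp_toBar ha ha'

end LocalShtuka

end LocSht

end

theorem mainTheorem3 {K : Type u} [NontriviallyNormedField K] [CompleteSpace K]
    [IsUltrametricDist K] (F : Type w) [Field F] [Fintype F] [Algebra F K] (ζ : LocSht.PU K) :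
    (∃ h : ∀ M : LocSht.LocalShtuka.{u, v, w} F ζ,
        M.EpsBar ≃ₗ[(LocSht.Kbar K)⸨X⸩] M.DRBar,
      -- `h` is the canonical map `τ⁻¹ ∘ (z ↦ ζ + (z - ζ))` on the Tate module
      (∀ (M : LocSht.LocalShtuka.{u, v, w} F ζ) (t : M.Tate), ∃ m : M.Conv,
        M.convToSep m = (t : LocSht.BC (LocSht.psSep K) M.carrier) ∧
          M.tauBar (h M (LocSht.BC.ι (LocSht.constBar F ζ) (M.tateToRat t))) = M.convExpand m) ∧
      -- `h` is functorial with respect to quasi-morphisms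
      (∀ (M N : LocSht.LocalShtuka.{u, v, w} F ζ) (f : LocSht.LocalShtuka.QuasiHom M N)
        (x : M.EpsBar), h N (LocSht.BC.map f.ratMap x) = LocSht.BC.map f.dRMap (h M x)) ∧
      -- comparison of lattices
      (∀ M : LocSht.LocalShtuka.{u, v, w} F ζ,
        h M '' (M.ratLattice : Set M.EpsBar) = M.hodgePinkBar ∧
          h M '' (M.tateLattice : Set M.EpsBar) = M.hodgePinkBar) ∧
      -- Galois equivariance
      (∀ (M : LocSht.LocalShtuka.{u, v, w} F ζ)
        (g : LocSht.Ksep K ≃ₐ[K] LocSht.Ksep K) (x : M.EpsBar),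
        h M (M.galEpsBar g x) = M.galDRBar g (h M x)) ∧
      -- if `K` is not perfect, the de Rham realizations are not the Galois invariants
      (¬ PerfectField K → ∀ M : LocSht.LocalShtuka.{u, v, w} F ζ, Nontrivial M.carrier →
        Set.range (LocSht.BC.ι (LocSht.toBarL K) : M.DR → M.DRBar) ⊂
            h M '' {x : M.EpsBar | ∀ g : LocSht.Ksep K ≃ₐ[K] LocSht.Ksep K,
              M.galEpsBar g x = x} ∧
          Set.range (LocSht.BC.ι (LocSht.toBar K) : M.DRK → LocSht.BC (LocSht.toBar K) M.DRK) ⊂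
            {x : LocSht.BC (LocSht.toBar K) M.DRK |
              ∀ g : LocSht.Ksep K ≃ₐ[K] LocSht.Ksep K, M.galDRKBar g x = x})) ∧
    -- the Galois invariants of `K̄` and of `K̄((z - ζ))`
    {x : LocSht.Kbar K | ∀ g : LocSht.Ksep K ≃ₐ[K] LocSht.Ksep K, LocSht.galBar g x = x} =
      LocSht.perfCompletion K ∧
    {f : (LocSht.Kbar K)⸨X⸩ | ∀ g : LocSht.Ksep K ≃ₐ[K] LocSht.Ksep K,
        LocSht.laurentMap (LocSht.galBar g) f = f} =
      {f : (LocSht.Kbar K)⸨X⸩ | ∀ n : ℤ, f.coeff n ∈ LocSht.perfCompletion K} := by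
  obtain ⟨p, hp⟩ := CharP.exists F
  have : Fact p.Prime := ⟨CharP.char_is_prime F p⟩
  have : CharP K p := charP_of_injective_algebraMap (algebraMap F K).injective p
  have hinv := LocSht.galBar_invariants_eq_perfCompletion (K := K) p
  refine ⟨⟨fun M => M.comparison, fun M t => M.exists_conv_tauBar_comparison t,
    fun M N f x => M.comparison_functorial N f x, fun M => ⟨?_, ?_⟩,
    fun M g x => M.comparison_galEpsBar g x, fun hK M hM => ?_⟩, hinv, ?_⟩
  · rw [M.ratLattice_eq, M.comparison_image_vecLattice]
  · rw [M.tateLattice_eq, M.comparison_image_vecLattice]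
  · have : Nonempty M.Idx := M.base.index_nonempty
    obtain ⟨a, ha, ha'⟩ := LocSht.exists_galBar_invariant_notMem_range (K := K) p hK
    rw [M.comparison_image_invariants]
    exact ⟨M.range_ι_DR_ssubset ha ha', M.range_ι_DRK_ssubset ha ha'⟩
  · ext f
    simp only [← hinv, Set.mem_ofPred_eq, HahnSeries.ext_iff, funext_iff,
      LocSht.laurentMap_coeff]
    exact forall_comm
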